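/- **Corollary.** For an integer $k\ge 1$ and a real number $x$ with $|x|<\sqrt{2\sqrt{k+1}-1}$ let $$M_k=\{(z,w)\in\mathbb C^2:\ w^{k+1}=z^k(z^2-1),\ z\neq\pm1\},\qquad c(k,x)=\sqrt{\frac{4k+3-2x^2-x^4}{4k}}\,\sqrt{\frac{A_k}{B_k}},$$ $$A_k=\int_0^1\frac{[t^k(1-t^2)]^{1/(k+1)}}{t^2-1}\,dt,\qquad B_k=-\frac12\int_0^1[t^k(1-t^2)]^{-1/(k+1)}\,dt,$$ and let $\Sigma_{k,x}=X_{k}(M_k)$ be the minimal surface, defined up to a translation, with Weierstrass data $$g=\frac{z^2-1}{z^2-x^2}\,\frac{c(k,x)}{w},\qquad \eta=\frac{(z^2-x^2)^2}{(z^2-1)^2}\Big(\frac zw\Big)^k dz,$$ where the surface with Weierstrass data $(g,\eta)$ is $X=\mathrm{Re}\int\big((1-g^2)\eta,\ i(1+g^2)\eta,\ 2g\,\eta\big)$. Here $c(k,x)>0$, and $X_k$ is a well-defined continuous map on $M_k$. Let $$S=\{(z,u)\in\mathbb C^2:\ z\ne0,\ e^u=(z^2-1)/z\},$$ and let $f_k:S\to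 M_k$, $f_k(z,u)=(z,\,z\,e^{u/(k+1)})$. Fix $x\in\mathbb R$ and let $k\to\infty$ (so that $|x|<\sqrt{2\sqrt{k+1}-1}$ for all large $k$). After suitable translations, depending on $k$, of the surfaces $\Sigma_{k,x}$, the following holds. 1. If $|x|=1$, then $\Sigma_{k,x}$ converges smoothly to Scherk's fifth surface $\{(x_1,x_2,x_3)\in\mathbb R^3:\cos x_2+\sinh x_1\sinh x_3=0\}$, parametrized bijectively by a map $Y:S\to\mathbb R^3$ with Weierstrass data $\big(\tfrac1z,\ \tfrac{z}{z^2-1}dz\big)$. 2. If $|x|\ne1$, then $\Sigma_{k,x}$ converges smoothly to the Scherk–Enneper surface with parameter $x$, that is, to the surface $Y:S\to\mathbb R^3$, well defined up to a translation, with Weierstrass data $$g=\frac{z^2-1}{z(z^2-x^2)},\qquad \eta=\frac{z(z^2-x^2)^2}{(z^2-1)^3}\,dz .$$ Smooth convergence means: on each compact subset of $S$ the maps $f_k$ are injective for all large $k$; the maps $X_k\circ f_k$ (for all large $k$) and $Y$ are smooth in the local coordinate $z$ of $S$, and $X_k\circ f_k$ converges to $Y$ with all derivatives, locally uniformly; and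 for every $R$ there is a compact set $K\subset S$ such that, for all large $k$, every point $p\in M_k$ with $\|X_k(p)\|\le R$ lies in $f_k(K)$. -/

import Mathlib

open scoped ContDiff Topology

noncomputable section

namespace ScherkLimit

/-- Euclidean three-space. -/
abbrev E3 : Type := EuclideanSpace ℝ (Fin 3)

/-- The coefficients (with respect to `dz`) of the three Weierstrass forms
`φ₁ = (1 - g²) η`, `φ₂ = i (1 + g²) η`, `φ₃ = 2 g η` of the Weierstrass data `(g, η dz)`. -/
def weierstrassForm (g η : ℂ × ℂ → ℂ) (j : Fin 3) (p : ℂ × ℂ) : ℂ :=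
  ![(1 - g p ^ 2) * η p, Complex.I * (1 + g p ^ 2) * η p, 2 * g p * η p] j

/-- `X` is the Weierstrass map `X = Re ∫ (φ₁, φ₂, φ₃)`, well defined on the complex curve `M ⊆ ℂ²`
(so that all real periods vanish), of the data `(g, η dz)`, where `z` is the first coordinate.
The discrete set `P` contains the poles of `g` and the points of `M` at which `z` is not a local
coordinate; there the forms `φ_j` extend holomorphically and `X` is determined by continuity.
The base point of the integral is left free, so `X` is determined up to a translation. -/
def IsWeierstrassMap (M P : Set (ℂ × ℂ)) (g η : ℂ × ℂ → ℂ) (X : ℂ × ℂ → E3) : Prop :=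
  ContinuousOn X M ∧
  ∀ γ : ℝ → ℂ × ℂ, ContDiff ℝ 1 γ → (∀ t ∈ Set.Icc (0 : ℝ) 1, γ t ∈ M \ P) →
    ∀ j : Fin 3, X (γ 1) j - X (γ 0) j =
      (∫ t in (0 : ℝ)..1, weierstrassForm g η j (γ t) * deriv (fun s => (γ s).1) t).re

/-- The punctured Riemann surface `M_k`: the curve `w^(k+1) = z^k (z² - 1)` without the points
over `z = ±1` (and without its point at infinity). The curve is unibranch at `(0, 0)`, hence this
subset of `ℂ²` is homeomorphic to the Riemann surface. -/
def curveM (k : ℕ) : Set (ℂ × ℂ) :=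
  {p | p.2 ^ (k + 1) = p.1 ^ k * (p.1 ^ 2 - 1) ∧ p.1 ≠ 1 ∧ p.1 ≠ -1}

/-- `A = ∫₀¹ [t^k (1 - t²)]^(1/(k+1)) / (t² - 1) dt`. -/
def intA (k : ℕ) : ℝ :=
  ∫ t in (0 : ℝ)..1, (t ^ k * (1 - t ^ 2)) ^ ((1 : ℝ) / (k + 1)) / (t ^ 2 - 1)

/-- `B = -½ ∫₀¹ [t^k (1 - t²)]^(-1/(k+1)) dt`. -/
def intB (k : ℕ) : ℝ :=
  -(1 / 2) * ∫ t in (0 : ℝ)..1, (t ^ k * (1 - t ^ 2)) ^ (-(1 : ℝ) / (k + 1))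

/-- The positive constant `c(k, x)` that solves the period problem. -/
def constC (k : ℕ) (x : ℝ) : ℝ :=
  √((4 * k + 3 - 2 * x ^ 2 - x ^ 4) / (4 * k)) * √(intA k / intB k)

/-- The Gauss map `g = (z² - 1) / (z² - x²) · c / w` of `Σ_{k,x}`. -/
def gaussSigma (k : ℕ) (x : ℝ) (p : ℂ × ℂ) : ℂ :=
  (p.1 ^ 2 - 1) / (p.1 ^ 2 - (x : ℂ) ^ 2) * ((constC k x : ℂ) / p.2)

/-- The coefficient of `η = (z² - x²)² / (z² - 1)² · (z / w)^k dz` of `Σ_{k,x}`. -/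
def etaSigma (k : ℕ) (x : ℝ) (p : ℂ × ℂ) : ℂ :=
  (p.1 ^ 2 - (x : ℂ) ^ 2) ^ 2 / (p.1 ^ 2 - 1) ^ 2 * (p.1 / p.2) ^ k

/-- `X : M_k → ℝ³` is the Weierstrass map parametrizing the surface `Σ_{k,x} = X(M_k)`
(unique up to a translation). -/
def IsSigma (k : ℕ) (x : ℝ) (X : ℂ × ℂ → E3) : Prop :=
  IsWeierstrassMap (curveM k) {p | p.1 = 0 ∨ p.1 ^ 2 = (x : ℂ) ^ 2}
    (gaussSigma k x) (etaSigma k x) X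

/-- The infinite cyclic covering of `ℂ \ {0, 1, -1}` on which `u = log ((z² - 1) / z)` is single
valued. -/
def limitCurve : Set (ℂ × ℂ) :=
  {p | p.1 ≠ 0 ∧ Complex.exp p.2 = (p.1 ^ 2 - 1) / p.1}

/-- The holomorphic covering map `(z, u) ↦ (z, w)`, `w = z exp (u / (k + 1))`, from `limitCurve`
onto `M_k` without the point `(0, 0)`. In the local coordinate `z` it is the identity. -/
def sheetMap (k : ℕ) (p : ℂ × ℂ) : ℂ × ℂ :=
  (p.1, p.1 * Complex.exp (p.2 / (k + 1)))

/-- Scherk's fifth surface, `cos y + sinh x sinh z = 0`. -/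
def scherkFifth : Set E3 :=
  {q | Real.cos (q 1) + Real.sinh (q 0) * Real.sinh (q 2) = 0}

/-- `Y` parametrizes Scherk's fifth surface bijectively, as the Weierstrass map of the data
`(1/z, z/(z² - 1) dz)`. -/
def IsScherkFifth (Y : ℂ × ℂ → E3) : Prop :=
  IsWeierstrassMap limitCurve ∅ (fun p => 1 / p.1) (fun p => p.1 / (p.1 ^ 2 - 1)) Y ∧
  Set.BijOn Y limitCurve scherkFifth

/-- `Y` is the Weierstrass map (unique up to a translation) of the Scherk-Enneper surface with
parameter `x`: `g = (z² - 1) / (z (z² - x²))`, `η = z (z² - x²)² / (z² - 1)³ dz`. -/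
def IsScherkEnneper (x : ℝ) (Y : ℂ × ℂ → E3) : Prop :=
  IsWeierstrassMap limitCurve {p | p.1 ^ 2 = (x : ℂ) ^ 2}
    (fun p => (p.1 ^ 2 - 1) / (p.1 * (p.1 ^ 2 - (x : ℂ) ^ 2)))
    (fun p => p.1 * (p.1 ^ 2 - (x : ℂ) ^ 2) ^ 2 / (p.1 ^ 2 - 1) ^ 3) Y

/-- Smooth convergence of the surfaces `X k : M k → ℝ³` to the surface `Y : S → ℝ³`, the points of
`S` being identified with points of `M k` by means of `f k`. Here `S` is a Riemann surface in `ℂ²`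
on which the first coordinate `z` is a local coordinate, and `f k` is a local diffeomorphism.
* `f k` maps `S` to `M k`, and on each compact part of `S` it is eventually injective;
* in the coordinate `z` (that is, along each holomorphic local section `z ↦ (z, s z)` of `S`),
  the maps `X k ∘ f k` and `Y` are smooth, and `X k ∘ f k` converges to `Y` with all derivatives,
  locally uniformly;
* nothing else of the surfaces remains in a bounded region: for every `R` there is a compact part
  `K` of `S` such that eventually `f k (K)` contains all points of `M k` that `X k` sends to the
  ball of radius `R`. -/
def ConvergesSmoothly (f : ℕ → ℂ × ℂ → ℂ × ℂ) (M : ℕ → Set (ℂ × ℂ)) (X : ℕ → ℂ × ℂ → E3)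
    (S : Set (ℂ × ℂ)) (Y : ℂ × ℂ → E3) : Prop :=
  (∀ᶠ k in Filter.atTop, Set.MapsTo (f k) S (M k)) ∧
  (∀ K : Set (ℂ × ℂ), K ⊆ S → IsCompact K → ∀ᶠ k in Filter.atTop, Set.InjOn (f k) K) ∧
  (∀ (U : Set ℂ) (s : ℂ → ℂ), IsOpen U → DifferentiableOn ℂ s U → (∀ z ∈ U, (z, s z) ∈ S) →
    ContDiffOn ℝ ∞ (fun z => Y (z, s z)) U ∧
    (∀ᶠ k in Filter.atTop, ContDiffOn ℝ ∞ (fun z => X k (f k (z, s z))) U) ∧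
    ∀ n : ℕ, TendstoLocallyUniformlyOn
      (fun k => iteratedFDeriv ℝ n (fun z => X k (f k (z, s z))))
      (iteratedFDeriv ℝ n (fun z => Y (z, s z))) Filter.atTop U) ∧
  (∀ R : ℝ, ∃ K : Set (ℂ × ℂ), K ⊆ S ∧ IsCompact K ∧
    ∀ᶠ k in Filter.atTop, ∀ p ∈ M k, ‖X k p‖ ≤ R → p ∈ f k '' K)

end ScherkLimit

end

/-!
Put `v = z²`, `e = 1 / (k + 1)`, `u = log ((z² - 1) / z)` and `τ = w / z`. On the curve `M_k` one has
`τ ^ (k + 1) = (z² - 1) / z`, so `τ = exp (e u)`; on different sheets `τ` differs by a root of unity,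
and `|τ|` is a function of `v`. The form `2 g η` is rational in `z`, and its real primitive is the
elementary function `height`; `η` and `g² η` are `τ` and `1 / τ` times rational forms in `v`.
Integration by parts lowers the poles of `η` at `v = 1`, so the primitives of both
are elementary terms plus solutions of first-order equations in `v`, that is, incomplete beta
functions: `solP0`, `solQ0` centred at `v = 0` and `solP1`, `solQ1` centred at `v = 1`. The two
solutions differ by beta integrals times the homogeneous solution. These differences cancel in
`X₁ - i X₂ = ∫ η - conj (∫ g² η)` exactly when `c² betaB = 2 kappa betaA`, because `τ / exp (e u)` is
unimodular for every branch of `u` (`horiz_eq_of_mem_slitPlane`). The constant `c (k, x)` is the one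
with this property (`constC_period`), and so the Weierstrass map is single valued
(`isSigma_sigmaMap`).

The horizontal coordinate is equivariant under rotations of `τ` (`horiz_rotate`): a change of sheet
rotates the surface about a vertical axis. The distance from this axis to the part of the surface
over `v = 1/2` is asymptotic to `k + 1` (`tendsto_mul_shift`), so after a horizontal translation by
`shift` the rotations by the angle `e Im u` tend to translations by `Im u`
(`eventually_rotation_close`). This explains why the limit `limitMap` lives on an infinite cyclic
covering. Its differential is the limit of the differentials, as `τ → 1` and `c → 1`. The
Weierstrass data of the limit are those of the Scherk–Enneper surface (`isScherkEnneper_limitMap`);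
for `x² = 1` its coordinates are `log |z|`, `-Im u` and `log |z - 1| - log |z + 1|`, and these
parametrize Scherk's fifth surface bijectively (`isScherkFifth_limitMap`).

The translated surfaces converge at `v = 1/2` by the choice of `shift`; convergence of the differentials
spreads this over the connected set `ℂ \ {0, 1}` (`tendstoLocallyUniformlyOn_reducedHoriz`). The
derivatives of all orders then converge because the differentials are real parts of holomorphic
forms converging locally uniformly (`smooth_convergence_section`).

There remains the claim that nothing else stays in a bounded region
(`exists_isCompact_image_sheetMap`). Integration along rays gives expansions of the horizontal
coordinate near `v = ∞`, `0` and `1` that are uniform in `e`: up to a bounded error the distance to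
the axis grows like `|v| ^ (e / 2) / e` towards `v = ∞` (`exists_horiz_sub_le_atInfinity`) and shrinks
like `c² |v| ^ (e / 2) / e` towards `v = 0` (`exists_horiz_sub_le_atZero`), while at `v = 1`
the leading term is a multiple of `(v - 1) ^ (-2) |v - 1| ^ e` (`exists_horiz_sub_le_atOne`). The first
two keep `v` away from `∞` and `0`. At `v = 1` the height is decisive: if `x² = 1`, it is unbounded
there; otherwise a bound on it forces `v - 1` to be almost imaginary, where the leading term moves
the point away from the axis. Finally, on the remaining compact set of values of `v`, a point
of bounded norm is displaced by a bounded amount by its rotation about the remote axis, which bounds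
`Im u`.
-/

noncomputable section

namespace ScherkLimit

open Complex MeasureTheory Set Filter
open scoped ComplexConjugate

/-! ### Incomplete beta integrals -/

/-- The integral `∫₀¹ s^(a-1) (1 - s v)^b ds`, a normalized incomplete beta function: for `0 < v < 1`
it is `v^(-a) ∫₀^v t^(a-1) (1-t)^b dt`. It is used for `1 - v` in the slit plane. -/
def incBeta (a b : ℝ) (v : ℂ) : ℂ :=
  ∫ s in (0 : ℝ)..1, ((s ^ (a - 1) : ℝ) : ℂ) * (1 - s * v) ^ (b : ℂ)

lemma one_sub_mul_mem_slitPlane {v : ℂ} (hv : 1 - v ∈ slitPlane) {s : ℝ} (h0 : 0 ≤ s)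
    (h1 : s ≤ 1) : 1 - s * v ∈ slitPlane := by
  have := StarConvex.add_smul_mem starConvex_one_slitPlane (y := -v)
    (by simpa [sub_eq_add_neg] using hv) h0 h1
  simpa [sub_eq_add_neg] using this

lemma isOpen_one_sub_slitPlane : IsOpen {v : ℂ | 1 - v ∈ slitPlane} :=
  isOpen_slitPlane.preimage (by fun_prop)

lemma continuousOn_one_sub_mul_cpow {v : ℂ} (hv : 1 - v ∈ slitPlane) (b : ℂ) :
    ContinuousOn (fun s : ℝ => (1 - s * v : ℂ) ^ b) (Icc 0 1) := by
  intro s hs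
  refine ContinuousAt.continuousWithinAt ?_
  refine ContinuousAt.cpow (by fun_prop) continuousAt_const (one_sub_mul_mem_slitPlane hv hs.1 hs.2)

lemma intervalIntegrable_incBeta {a : ℝ} (ha : 0 < a) {v : ℂ} (hv : 1 - v ∈ slitPlane) (b : ℂ) :
    IntervalIntegrable (fun s : ℝ => ((s ^ (a - 1) : ℝ) : ℂ) * (1 - s * v) ^ b) volume 0 1 := by
  have h1 : IntervalIntegrable (fun s : ℝ => ((s ^ (a - 1) : ℝ) : ℂ)) volume 0 1 := by
    have := intervalIntegral.intervalIntegrable_rpow' (a := 0) (b := 1) (r := a - 1) (by linarith)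
    exact ⟨this.1.ofReal, this.2.ofReal⟩
  refine h1.mul_continuousOn ?_
  rw [uIcc_of_le zero_le_one]
  exact continuousOn_one_sub_mul_cpow hv b

/-- The derivative of `incBeta` in the form of the differential equation
`v W' + a W = (1 - v)^b` that it satisfies. -/
lemma exists_hasDerivAt_incBeta {a : ℝ} (ha : 0 < a) (b : ℝ) {v : ℂ} (hv : 1 - v ∈ slitPlane) :
    ∃ W' : ℂ, HasDerivAt (incBeta a b) W' v ∧ v * W' + a * incBeta a b v = (1 - v) ^ (b : ℂ) := by
  obtain ⟨r, hr, hrs⟩ := Metric.nhds_basis_closedBall.mem_iff.1 (isOpen_one_sub_slitPlane.mem_nhds hv)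
  have hcont : ContinuousOn (fun p : ℂ × ℝ => -(b : ℂ) * p.2 * (1 - p.2 * p.1) ^ ((b : ℂ) - 1))
      (Metric.closedBall v r ×ˢ Icc (0 : ℝ) 1) := by
    rintro ⟨z, s⟩ ⟨hz, hs⟩
    refine ContinuousAt.continuousWithinAt ?_
    refine ContinuousAt.mul (by fun_prop) ?_
    exact ContinuousAt.cpow (by fun_prop) continuousAt_const (one_sub_mul_mem_slitPlane (hrs hz) hs.1 hs.2)
  obtain ⟨M, hM⟩ := ((isCompact_closedBall v r).prod isCompact_Icc).exists_bound_of_continuousOn hcont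
  have hrp := intervalIntegral.intervalIntegrable_rpow' (a := 0) (b := 1) (r := a - 1) (by linarith)
  have key := intervalIntegral.hasDerivAt_integral_of_dominated_loc_of_deriv_le (𝕜 := ℂ)
    (μ := volume) (a := 0) (b := 1) (x₀ := v) (s := Metric.closedBall v r)
    (F := fun v s => ((s ^ (a - 1) : ℝ) : ℂ) * (1 - s * v) ^ (b : ℂ))
    (F' := fun v s => ((s ^ (a - 1) : ℝ) : ℂ) * (-(b : ℂ) * s * (1 - s * v) ^ ((b : ℂ) - 1)))
    (bound := fun s => s ^ (a - 1) * M)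
    (Metric.closedBall_mem_nhds v hr) ?_ (intervalIntegrable_incBeta ha hv b) ?_ ?_
    (hrp.mul_const _) ?_
  · refine ⟨_, key.2, ?_⟩
    -- integrate the derivative of `s ^ a * (1 - s v) ^ b` over `[0, 1]`
    have hd : ∀ s ∈ Ioo (0 : ℝ) 1, HasDerivAt (fun s : ℝ => ((s ^ a : ℝ) : ℂ) * (1 - s * v) ^ (b : ℂ))
        (v * (((s ^ (a - 1) : ℝ) : ℂ) * (-(b : ℂ) * s * (1 - s * v) ^ ((b : ℂ) - 1))) +
          a * (((s ^ (a - 1) : ℝ) : ℂ) * (1 - s * v) ^ (b : ℂ))) s := by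
      intro s hs
      have h1 : HasDerivAt (fun s : ℝ => ((s ^ a : ℝ) : ℂ)) ((a * s ^ (a - 1) : ℝ) : ℂ) s :=
        (Real.hasDerivAt_rpow_const (Or.inl hs.1.ne')).ofReal_comp
      have h2 : HasDerivAt (fun s : ℝ => (1 - s * v : ℂ)) (-v) s := by
        simpa using ((hasDerivAt_id s).ofReal_comp.mul_const v).const_sub (1 : ℂ)
      have h3 := (hasStrictDerivAt_cpow_const (c := (b : ℂ))
        (one_sub_mul_mem_slitPlane hv hs.1.le hs.2.le)).hasDerivAt.comp s h2
      refine (h1.mul h3).congr_deriv ?_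
      have : (s ^ a : ℝ) = s ^ (a - 1) * s := by
        rw [← Real.rpow_add_one hs.1.ne', sub_add_cancel]
      simp only [Function.comp, this]
      push_cast
      ring
    have hc : ContinuousOn (fun s : ℝ => ((s ^ a : ℝ) : ℂ) * (1 - s * v) ^ (b : ℂ)) (Icc 0 1) := by
      refine ContinuousOn.mul ?_ (continuousOn_one_sub_mul_cpow hv b)
      exact (continuous_ofReal.comp (Real.continuous_rpow_const ha.le)).continuousOn
    have hi := intervalIntegral.integral_eq_sub_of_hasDerivAt_of_le zero_le_one hc hd
      ((key.1.const_mul v).add ((intervalIntegrable_incBeta ha hv b).const_mul (a : ℂ)))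
    rw [intervalIntegral.integral_add (key.1.const_mul v)
      ((intervalIntegrable_incBeta ha hv b).const_mul (a : ℂ)),
      intervalIntegral.integral_const_mul, intervalIntegral.integral_const_mul] at hi
    rw [incBeta, hi]
    simp [Real.zero_rpow ha.ne']
  · filter_upwards [isOpen_one_sub_slitPlane.mem_nhds hv] with z hz
    exact (intervalIntegrable_iff.1 (intervalIntegrable_incBeta ha hz b)).aestronglyMeasurable
  · have hc : ContinuousOn (fun s : ℝ => -(b : ℂ) * s * (1 - s * v : ℂ) ^ ((b : ℂ) - 1))
        (uIcc 0 1) := by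
      rw [uIcc_of_le zero_le_one]
      exact ContinuousOn.mul (by fun_prop) (continuousOn_one_sub_mul_cpow hv _)
    have hi : IntervalIntegrable (fun s : ℝ => ((s ^ (a - 1) : ℝ) : ℂ)) volume 0 1 :=
      ⟨hrp.1.ofReal, hrp.2.ofReal⟩
    exact (intervalIntegrable_iff.1 (hi.mul_continuousOn hc)).aestronglyMeasurable
  · refine Eventually.of_forall fun s hs z hz => ?_
    rw [uIoc_of_le zero_le_one] at hs
    rw [norm_mul]
    have h0 : 0 ≤ s ^ (a - 1) := Real.rpow_nonneg hs.1.le _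
    rw [Complex.norm_of_nonneg h0]
    exact mul_le_mul_of_nonneg_left (hM (z, s) ⟨hz, hs.1.le, hs.2⟩) h0
  · refine Eventually.of_forall fun s hs z hz => ?_
    rw [uIoc_of_le zero_le_one] at hs
    have h2 : HasDerivAt (fun z : ℂ => (1 - s * z : ℂ)) (-s) z := by
      simpa using ((hasDerivAt_id z).const_mul (s : ℂ)).const_sub (1 : ℂ)
    refine ((h2.cpow_const (c := (b : ℂ))
      (one_sub_mul_mem_slitPlane (hrs hz) hs.1.le hs.2)).const_mul
        ((s ^ (a - 1) : ℝ) : ℂ)).congr_deriv ?_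
    ring

lemma hasDerivAt_incBeta {a : ℝ} (ha : 0 < a) (b : ℝ) {v : ℂ} (hv : 1 - v ∈ slitPlane)
    (h0 : v ≠ 0) :
    HasDerivAt (incBeta a b) (((1 - v) ^ (b : ℂ) - a * incBeta a b v) / v) v := by
  obtain ⟨W', h, h'⟩ := exists_hasDerivAt_incBeta ha b hv
  refine h.congr_deriv ?_
  rw [← h']
  field_simp
  ring

/-- `∫₀^y t^(a-1) (1-t)^b dt`. -/
def realIncBeta (a b y : ℝ) : ℝ := ∫ t in (0 : ℝ)..y, t ^ (a - 1) * (1 - t) ^ b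

lemma incBeta_ofReal (a b : ℝ) {y : ℝ} (hy : 0 < y) (hy1 : y < 1) :
    incBeta a b y = ((y ^ (-a) * realIncBeta a b y : ℝ) : ℂ) := by
  have h1 : realIncBeta a b y = y * ∫ s in (0 : ℝ)..1, (y * s) ^ (a - 1) * (1 - y * s) ^ b := by
    rw [intervalIntegral.integral_comp_mul_left (f := fun t : ℝ => t ^ (a - 1) * (1 - t) ^ b) hy.ne',
      realIncBeta]
    simp [hy.ne']
  have h2 : ∫ s in (0 : ℝ)..1, (y * s) ^ (a - 1) * (1 - y * s) ^ b =
      y ^ (a - 1) * ∫ s in (0 : ℝ)..1, s ^ (a - 1) * (1 - s * y) ^ b := by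
    rw [← intervalIntegral.integral_const_mul]
    refine intervalIntegral.integral_congr fun s hs => ?_
    rw [uIcc_of_le zero_le_one] at hs
    rw [Real.mul_rpow hy.le hs.1, mul_comm y s]
    ring
  rw [h1, h2, incBeta]
  have h3 : y ^ (-a) * (y * (y ^ (a - 1) * ∫ s in (0 : ℝ)..1, s ^ (a - 1) * (1 - s * y) ^ b)) =
      ∫ s in (0 : ℝ)..1, s ^ (a - 1) * (1 - s * y) ^ b := by
    have : y ^ (-a) * (y * y ^ (a - 1)) = 1 := by
      rw [Real.rpow_sub_one hy.ne', mul_div_cancel₀ _ hy.ne', ← Real.rpow_add hy, neg_add_cancel,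
        Real.rpow_zero]
    rw [← mul_assoc, ← mul_assoc, mul_assoc (y ^ (-a)), this, one_mul]
  rw [h3, ← intervalIntegral.integral_ofReal]
  refine intervalIntegral.integral_congr fun s hs => ?_
  rw [uIcc_of_le zero_le_one] at hs
  have : 0 ≤ 1 - s * y := by nlinarith [hs.1, hs.2]
  rw [ofReal_mul, ofReal_cpow this]
  push_cast
  ring

lemma intervalIntegrable_realIncBeta {a : ℝ} (ha : 0 < a) (b : ℝ) {y : ℝ} (hy : 0 ≤ y) (hy1 : y < 1) :
    IntervalIntegrable (fun t : ℝ => t ^ (a - 1) * (1 - t) ^ b) volume 0 y := by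
  refine (intervalIntegral.intervalIntegrable_rpow' (by linarith)).mul_continuousOn ?_
  rw [uIcc_of_le hy]
  intro s hs
  refine ContinuousAt.continuousWithinAt ?_
  exact ContinuousAt.rpow_const (by fun_prop) (Or.inl (by linarith [hs.2]))

/-- Both ends of a beta integral are incomplete beta integrals. -/
lemma realIncBeta_add {a b : ℝ} (ha : 0 < a) (hb : 0 < b) :
    IntervalIntegrable (fun t : ℝ => t ^ (a - 1) * (1 - t) ^ (b - 1)) volume 0 1 ∧
    ∫ t in (0 : ℝ)..1, t ^ (a - 1) * (1 - t) ^ (b - 1) =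
      realIncBeta a (b - 1) (1 / 2) + realIncBeta b (a - 1) (1 / 2) := by
  have i1 := intervalIntegrable_realIncBeta ha (b - 1) (y := 1 / 2) (by norm_num) (by norm_num)
  have i2 := intervalIntegrable_realIncBeta hb (a - 1) (y := 1 / 2) (by norm_num) (by norm_num)
  have i3 := (i2.comp_sub_left 1).symm
  have e1 : (fun x : ℝ => (1 - x) ^ (b - 1) * (1 - (1 - x)) ^ (a - 1)) =
      fun t : ℝ => t ^ (a - 1) * (1 - t) ^ (b - 1) := by
    ext x; rw [sub_sub_cancel, mul_comm]
  have e2 : (1 : ℝ) - 1 / 2 = 1 / 2 := by norm_num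
  rw [e1, sub_zero, e2] at i3
  refine ⟨i1.trans i3, ?_⟩
  rw [← intervalIntegral.integral_add_adjacent_intervals i1 i3, realIncBeta, realIncBeta]
  congr 1
  have := intervalIntegral.integral_comp_sub_left (a := 1 / 2) (b := 1)
    (fun t : ℝ => t ^ (b - 1) * (1 - t) ^ (a - 1)) 1
  rw [e1] at this
  rw [this, sub_self, e2]

/-- The elementary two-sided bound from `1/2 ≤ 1 - t ≤ 1`. -/
lemma realIncBeta_half_bounds {a : ℝ} (ha : 0 < a) (b : ℝ) :
    (1 / 2) ^ a * 2 ^ (-|b|) / a ≤ realIncBeta a b (1 / 2) ∧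
      realIncBeta a b (1 / 2) ≤ (1 / 2) ^ a * 2 ^ |b| / a := by
  have i1 := intervalIntegrable_realIncBeta ha b (y := 1 / 2) (by norm_num) (by norm_num)
  have i0 := intervalIntegral.intervalIntegrable_rpow' (a := 0) (b := 1 / 2) (r := a - 1)
    (by linarith)
  have e (C : ℝ) : ∫ t in (0 : ℝ)..1 / 2, t ^ (a - 1) * C = (1 / 2) ^ a * C / a := by
    rw [intervalIntegral.integral_mul_const, integral_rpow (Or.inl (by linarith)), sub_add_cancel,
      Real.zero_rpow ha.ne']
    ring
  have hb1 : ∀ t ∈ Icc (0 : ℝ) (1 / 2), 2 ^ (-|b|) ≤ (1 - t) ^ b ∧ (1 - t) ^ b ≤ 2 ^ |b| := by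
    intro t ht
    have h0 : (0 : ℝ) < 1 - t := by linarith [ht.2]
    have hl : |Real.log (1 - t)| ≤ Real.log 2 := by
      rw [abs_le]
      constructor
      · rw [← Real.log_inv]
        exact Real.log_le_log (by norm_num) (by linarith [ht.2])
      · exact Real.log_le_log h0 (by linarith [ht.1])
    have hm : |Real.log (1 - t) * b| ≤ Real.log 2 * |b| := by
      rw [abs_mul]; exact mul_le_mul_of_nonneg_right hl (abs_nonneg b)
    rw [abs_le] at hm
    rw [Real.rpow_def_of_pos h0, Real.rpow_def_of_pos two_pos, Real.rpow_def_of_pos two_pos]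
    exact ⟨Real.exp_le_exp.2 (by linarith [hm.1]), Real.exp_le_exp.2 hm.2⟩
  constructor
  · rw [← e]
    refine intervalIntegral.integral_mono_on (by norm_num) (i0.mul_const _) i1 fun t ht => ?_
    exact mul_le_mul_of_nonneg_left (hb1 t ht).1 (Real.rpow_nonneg ht.1 _)
  · rw [← e]
    refine intervalIntegral.integral_mono_on (by norm_num) i1 (i0.mul_const _) fun t ht => ?_
    exact mul_le_mul_of_nonneg_left (hb1 t ht).2 (Real.rpow_nonneg ht.1 _)

/-! ### Solutions of the first-order equations for the horizontal primitives -/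

/-- The derivative of `u = log ((v - 1) / √v)` with respect to `v = z²`. -/
def logSlope (v : ℂ) : ℂ := 1 / (v - 1) - 1 / (2 * v)

/-- The real part `log (|v - 1| / √|v|)` of `u`, a single valued function of `v = z²`. -/
def logModulus (v : ℂ) : ℝ := Real.log ‖v - 1‖ - Real.log ‖v‖ / 2

lemma hasDerivAt_cpow_const_div {f : ℂ → ℂ} {f' v : ℂ} (hf : HasDerivAt f f' v)
    (hv : f v ∈ slitPlane) (c : ℂ) :
    HasDerivAt (fun z => f z ^ c) (c * (f' / f v) * f v ^ c) v := by
  refine (hf.cpow_const hv).congr_deriv ?_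
  rw [cpow_sub _ _ (slitPlane_ne_zero hv), cpow_one]
  ring

/-- The solution of `P' = 1 / (v - 1) - e u' P` that vanishes at `v = 0`, on the plane slit along
`[1, ∞)`. -/
def solP0 (e : ℝ) (v : ℂ) : ℂ := -v * (1 - v) ^ (-(e : ℂ)) * incBeta (1 - e / 2) (e - 1) v

/-- The solution of `Q' = 1 / v + e u' Q` that is regular at `v = 0`, on the plane slit along
`[1, ∞)`. -/
def solQ0 (e : ℝ) (v : ℂ) : ℂ := (1 - v) ^ (e : ℂ) * incBeta (e / 2) (-e) v

/-- The solution of `P' = 1 / (v - 1) - e u' P` that is regular at `v = 1`, on the plane slit along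
`(-∞, 0]`. -/
def solP1 (e : ℝ) (v : ℂ) : ℂ := v ^ ((e / 2 : ℝ) : ℂ) * incBeta e (-(e / 2)) (1 - v)

/-- The solution of `Q' = 1 / v + e u' Q` that vanishes at `v = 1`, on the plane slit along
`(-∞, 0]`. -/
def solQ1 (e : ℝ) (v : ℂ) : ℂ :=
  (v - 1) * v ^ (-((e / 2 : ℝ) : ℂ)) * incBeta (1 - e) (e / 2 - 1) (1 - v)

section ODE
variable {e : ℝ} {v : ℂ}

lemma hasDerivAt_one_sub (v : ℂ) : HasDerivAt (fun z : ℂ => 1 - z) (-1) v := by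
  simpa using (hasDerivAt_id v).const_sub (1 : ℂ)

lemma ne_one_of_one_sub_mem (hv : 1 - v ∈ slitPlane) : v - 1 ≠ 0 := by
  have := slitPlane_ne_zero hv
  intro h
  exact this (by linear_combination -h)

lemma hasDerivAt_solP0 (he2 : e < 2) (hv : 1 - v ∈ slitPlane) (h0 : v ≠ 0) :
    HasDerivAt (solP0 e) (1 / (v - 1) - e * logSlope v * solP0 e v) v := by
  have hW := hasDerivAt_incBeta (a := 1 - e / 2) (by linarith) (e - 1) hv h0
  have hA := hasDerivAt_cpow_const_div (hasDerivAt_one_sub v) hv (-(e : ℂ))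
  have h1 := slitPlane_ne_zero hv
  have h2 := ne_one_of_one_sub_mem hv
  have hp : (1 - v) ^ ((e - 1 : ℝ) : ℂ) * (1 - v) ^ (-(e : ℂ)) = 1 / (1 - v) := by
    rw [← cpow_add _ _ h1, one_div, ← cpow_neg_one]
    congr 1
    push_cast
    ring
  refine ((((hasDerivAt_id v).neg).mul hA).mul hW).congr_deriv ?_
  simp only [solP0, logSlope, Pi.mul_apply, Pi.neg_apply, id]
  set A := (1 - v) ^ (-(e : ℂ))
  set B := (1 - v) ^ ((e - 1 : ℝ) : ℂ)
  set W := incBeta (1 - e / 2) (e - 1) v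
  have hB : -v * A * ((B - ((1 - e / 2 : ℝ) : ℂ) * W) / v) =
      -(1 / (1 - v)) + A * ((1 - e / 2 : ℝ) : ℂ) * W := by
    rw [← hp]; field_simp; ring
  rw [hB]
  have h3 : 1 / (v - 1) = -(1 / (1 - v)) := by rw [← neg_sub 1 v]; field_simp
  rw [h3]
  push_cast
  field_simp
  ring

lemma hasDerivAt_solQ0 (he : 0 < e) (hv : 1 - v ∈ slitPlane) (h0 : v ≠ 0) :
    HasDerivAt (solQ0 e) (1 / v + e * logSlope v * solQ0 e v) v := by
  have hW := hasDerivAt_incBeta (a := e / 2) (by linarith) (-e) hv h0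
  have hA := hasDerivAt_cpow_const_div (hasDerivAt_one_sub v) hv (e : ℂ)
  have h1 := slitPlane_ne_zero hv
  have hp : (1 - v) ^ (e : ℂ) * (1 - v) ^ ((-e : ℝ) : ℂ) = 1 := by
    rw [← cpow_add _ _ h1]; simp
  refine (hA.mul hW).congr_deriv ?_
  simp only [solQ0, logSlope]
  set A := (1 - v) ^ (e : ℂ)
  set B := (1 - v) ^ ((-e : ℝ) : ℂ)
  set W := incBeta (e / 2) (-e) v
  have hB : A * ((B - ((e / 2 : ℝ) : ℂ) * W) / v) = 1 / v - A * ((e / 2 : ℝ) : ℂ) * W / v := by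
    rw [← hp]; field_simp
  rw [hB]
  have h3 : 1 / (v - 1) = -(1 / (1 - v)) := by rw [← neg_sub 1 v]; field_simp
  rw [h3]
  push_cast
  field_simp
  ring

lemma hasDerivAt_incBeta_one_sub {a : ℝ} (ha : 0 < a) (b : ℝ) (hv : v ∈ slitPlane) (h1 : v ≠ 1) :
    HasDerivAt (fun z => incBeta a b (1 - z))
      ((v ^ (b : ℂ) - a * incBeta a b (1 - v)) / (v - 1)) v := by
  have h := (hasDerivAt_incBeta ha b (v := 1 - v) (by simpa using hv)
    (sub_ne_zero.2 h1.symm)).comp v (hasDerivAt_one_sub v)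
  refine h.congr_deriv ?_
  have h2 : v - 1 ≠ 0 := sub_ne_zero.2 h1
  have h3 : 1 - v ≠ 0 := sub_ne_zero.2 h1.symm
  rw [sub_sub_cancel, ← neg_sub v 1]
  field_simp

lemma hasDerivAt_solP1 (he : 0 < e) (hv : v ∈ slitPlane) (h1 : v ≠ 1) :
    HasDerivAt (solP1 e) (1 / (v - 1) - e * logSlope v * solP1 e v) v := by
  have hW := hasDerivAt_incBeta_one_sub he (-(e / 2)) hv h1
  have hA := hasDerivAt_cpow_const_div (hasDerivAt_id v) hv ((e / 2 : ℝ) : ℂ)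
  have h0 : v ≠ 0 := slitPlane_ne_zero hv
  have h2 : v - 1 ≠ 0 := sub_ne_zero.2 h1
  have hp : v ^ ((e / 2 : ℝ) : ℂ) * v ^ ((-(e / 2) : ℝ) : ℂ) = 1 := by
    rw [← cpow_add _ _ h0]; simp
  refine (hA.mul hW).congr_deriv ?_
  simp only [solP1, logSlope, id]
  set A := v ^ ((e / 2 : ℝ) : ℂ)
  set B := v ^ ((-(e / 2) : ℝ) : ℂ)
  set W := incBeta e (-(e / 2)) (1 - v)
  have hB : A * ((B - (e : ℂ) * W) / (v - 1)) = 1 / (v - 1) - A * e * W / (v - 1) := by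
    rw [← hp]; field_simp
  rw [hB]
  push_cast
  field_simp
  ring

lemma hasDerivAt_solQ1 (he : e < 1) (hv : v ∈ slitPlane) (h1 : v ≠ 1) :
    HasDerivAt (solQ1 e) (1 / v + e * logSlope v * solQ1 e v) v := by
  have hW := hasDerivAt_incBeta_one_sub (a := 1 - e) (by linarith) (e / 2 - 1) hv h1
  have hA := hasDerivAt_cpow_const_div (hasDerivAt_id v) hv (-((e / 2 : ℝ) : ℂ))
  have h0 : v ≠ 0 := slitPlane_ne_zero hv
  have h2 : v - 1 ≠ 0 := sub_ne_zero.2 h1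
  have hp : v ^ (-((e / 2 : ℝ) : ℂ)) * v ^ ((e / 2 - 1 : ℝ) : ℂ) = 1 / v := by
    rw [← cpow_add _ _ h0, one_div, ← cpow_neg_one]
    congr 1
    push_cast
    ring
  refine ((((hasDerivAt_id v).sub_const (1 : ℂ)).mul hA).mul hW).congr_deriv ?_
  simp only [solQ1, logSlope, id, Pi.mul_apply]
  set A := v ^ (-((e / 2 : ℝ) : ℂ))
  set B := v ^ ((e / 2 - 1 : ℝ) : ℂ)
  set W := incBeta (1 - e) (e / 2 - 1) (1 - v)
  have hB : (v - 1) * A * ((B - ((1 - e : ℝ) : ℂ) * W) / (v - 1)) =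
      1 / v - A * ((1 - e : ℝ) : ℂ) * W := by
    rw [← hp]; field_simp
  rw [hB]
  push_cast
  field_simp
  ring

lemma continuousAt_solP0 (he2 : e < 2) (hv : 1 - v ∈ slitPlane) : ContinuousAt (solP0 e) v := by
  obtain ⟨_, h, _⟩ := exists_hasDerivAt_incBeta (a := 1 - e / 2) (by linarith) (e - 1) hv
  have hA := hasDerivAt_cpow_const_div (hasDerivAt_one_sub v) hv (-(e : ℂ))
  exact (continuousAt_id.neg.mul hA.continuousAt).mul h.continuousAt

lemma continuousAt_solQ0 (he : 0 < e) (hv : 1 - v ∈ slitPlane) : ContinuousAt (solQ0 e) v := by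
  obtain ⟨_, h, _⟩ := exists_hasDerivAt_incBeta (a := e / 2) (by linarith) (-e) hv
  have hA := hasDerivAt_cpow_const_div (hasDerivAt_one_sub v) hv (e : ℂ)
  exact hA.continuousAt.mul h.continuousAt

end ODE

/-- The branch `log (1 - v) - ½ log v` of `u` (up to the constant `iπ`) on the doubly slit
plane. -/
def slitBranch (v : ℂ) : ℂ := Complex.log (1 - v) - Complex.log v / 2

/-- The complex plane slit along `(-∞, 0]` and `[1, ∞)`. -/
def doublySlit : Set ℂ := {v | v ∈ slitPlane ∧ 1 - v ∈ slitPlane}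

lemma isOpen_doublySlit : IsOpen doublySlit := isOpen_slitPlane.inter isOpen_one_sub_slitPlane

lemma half_mem_doublySlit : (1 / 2 : ℂ) ∈ doublySlit := by
  constructor <;> left <;> norm_num

lemma isPreconnected_doublySlit : IsPreconnected doublySlit := by
  have hh : ((1 / 2 : ℝ) : ℂ) = 1 / 2 := by norm_num
  have hs : StarConvex ℝ (1 / 2 : ℂ) doublySlit := by
    intro y hy a b ha hb hab
    have h1 := starConvex_ofReal_slitPlane (x := 1 / 2) (by norm_num) hy.1 ha hb hab
    have h2 := starConvex_ofReal_slitPlane (x := 1 / 2) (by norm_num) hy.2 ha hb hab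
    rw [hh] at h1 h2
    refine ⟨h1, ?_⟩
    convert h2 using 1
    simp only [real_smul]
    have : (a : ℂ) + b = 1 := by exact_mod_cast hab
    linear_combination (-1 : ℂ) * this
  exact (hs.isPathConnected half_mem_doublySlit).isConnected.2

lemma hasDerivAt_slitBranch {v : ℂ} (hv : v ∈ doublySlit) :
    HasDerivAt slitBranch (logSlope v) v := by
  have h1 := slitPlane_ne_zero hv.2
  have h2 := ne_one_of_one_sub_mem hv.2
  have h0 := slitPlane_ne_zero hv.1
  refine (((hasDerivAt_one_sub v).clog hv.2).sub ((hasDerivAt_log hv.1).div_const 2)).congr_deriv ?_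
  rw [logSlope, ← neg_sub v 1]
  field_simp

lemma slitBranch_re (v : ℂ) : (slitBranch v).re = logModulus v := by
  rw [slitBranch, logModulus, ← norm_neg (v - 1), neg_sub]
  simp [Complex.log_re]

/-- The beta integral `∫₀¹ t^(-e/2) (1-t)^(e-1) dt`, cut at `1/2`. -/
def betaA (e : ℝ) : ℝ := realIncBeta (1 - e / 2) (e - 1) (1 / 2) + realIncBeta e (-(e / 2)) (1 / 2)

/-- The beta integral `∫₀¹ t^(e/2-1) (1-t)^(-e) dt`, cut at `1/2`. -/
def betaB (e : ℝ) : ℝ := realIncBeta (e / 2) (-e) (1 / 2) + realIncBeta (1 - e) (e / 2 - 1) (1 / 2)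

lemma incBeta_half (a b : ℝ) :
    incBeta a b (1 / 2) = (((1 / 2) ^ (-a) * realIncBeta a b (1 / 2) : ℝ) : ℂ) := by
  have := incBeta_ofReal a b (y := 1 / 2) (by norm_num) (by norm_num)
  rw [← this]; norm_num

lemma half_cpow (t : ℝ) : (1 / 2 : ℂ) ^ (t : ℂ) = (((1 / 2) ^ t : ℝ) : ℂ) := by
  rw [ofReal_cpow (by norm_num)]; norm_num

lemma solP0_half (e : ℝ) : solP0 e (1 / 2) =
    ((-((1 / 2) ^ (-(e / 2)) * realIncBeta (1 - e / 2) (e - 1) (1 / 2)) : ℝ) : ℂ) := by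
  have h1 : (1 : ℂ) - 1 / 2 = 1 / 2 := by norm_num
  have h2 : (1 / 2 : ℂ) = ((1 / 2 : ℝ) : ℂ) := by norm_num
  rw [solP0, incBeta_half, h1, ← ofReal_neg, half_cpow, h2]
  norm_cast
  have : ((1 / 2 : ℝ)) ^ (-(e / 2)) = 1 / 2 * (1 / 2) ^ (-e) * (1 / 2) ^ (-(1 - e / 2)) := by
    have h : -(e / 2) = 1 + -e + -(1 - e / 2) := by ring
    rw [h, Real.rpow_add (by norm_num), Real.rpow_add (by norm_num), Real.rpow_one]
  rw [this]; ring

lemma solQ0_half (e : ℝ) : solQ0 e (1 / 2) =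
    (((1 / 2) ^ (e / 2) * realIncBeta (e / 2) (-e) (1 / 2) : ℝ) : ℂ) := by
  have h1 : (1 : ℂ) - 1 / 2 = 1 / 2 := by norm_num
  rw [solQ0, incBeta_half, h1, half_cpow]
  norm_cast
  rw [← mul_assoc, ← Real.rpow_add (by norm_num)]
  ring_nf

lemma solP1_half (e : ℝ) : solP1 e (1 / 2) =
    (((1 / 2) ^ (-(e / 2)) * realIncBeta e (-(e / 2)) (1 / 2) : ℝ) : ℂ) := by
  have h1 : (1 : ℂ) - 1 / 2 = 1 / 2 := by norm_num
  rw [solP1, h1, incBeta_half, half_cpow]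
  norm_cast
  rw [← mul_assoc, ← Real.rpow_add (by norm_num)]
  ring_nf

lemma solQ1_half (e : ℝ) : solQ1 e (1 / 2) =
    ((-((1 / 2) ^ (e / 2) * realIncBeta (1 - e) (e / 2 - 1) (1 / 2)) : ℝ) : ℂ) := by
  have h1 : (1 : ℂ) - 1 / 2 = 1 / 2 := by norm_num
  have h3 : (1 / 2 : ℂ) - 1 = ((-(1 / 2) : ℝ) : ℂ) := by norm_num
  rw [solQ1, h3, h1, incBeta_half, ← ofReal_neg, half_cpow]
  norm_cast
  have : ((1 / 2 : ℝ)) ^ (e / 2) = 1 / 2 * (1 / 2) ^ (-(e / 2)) * (1 / 2) ^ (-(1 - e)) := by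
    have h : e / 2 = 1 + -(e / 2) + -(1 - e) := by ring
    rw [h, Real.rpow_add (by norm_num), Real.rpow_add (by norm_num), Real.rpow_one, ← h]
  rw [this]; ring

lemma exp_slitBranch_half (t : ℝ) :
    exp (t * slitBranch (1 / 2)) = (((1 / 2) ^ (t / 2) : ℝ) : ℂ) := by
  have h1 : (1 : ℂ) - 1 / 2 = 1 / 2 := by norm_num
  have h2 : Complex.log (1 / 2) = ((Real.log (1 / 2) : ℝ) : ℂ) := by
    rw [ofReal_log (by norm_num)]; norm_num
  rw [slitBranch, h1, h2, Real.rpow_def_of_pos (by norm_num), ofReal_exp]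
  congr 1
  push_cast
  ring

/-- The two solutions for `P` differ by `-betaA e` times the homogeneous solution. -/
lemma solP0_sub_solP1 {e : ℝ} (he : 0 < e) (he1 : e < 1) {v : ℂ} (hv : v ∈ doublySlit) :
    (solP0 e v - solP1 e v) * exp (e * slitBranch v) = -betaA e := by
  have hd : ∀ w ∈ doublySlit, HasDerivAt
      (fun v => (solP0 e v - solP1 e v) * exp (e * slitBranch v)) 0 w := by
    intro w hw
    have h0 := slitPlane_ne_zero hw.1
    have h1 : w ≠ 1 := sub_ne_zero.1 (ne_one_of_one_sub_mem hw.2)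
    refine (((hasDerivAt_solP0 (by linarith) hw.2 h0).sub (hasDerivAt_solP1 he hw.1 h1)).mul
      (((hasDerivAt_slitBranch hw).const_mul (e : ℂ)).cexp)).congr_deriv ?_
    simp only [Pi.sub_apply]
    ring
  have := isOpen_doublySlit.is_const_of_deriv_eq_zero isPreconnected_doublySlit
    (fun w hw => (hd w hw).differentiableAt.differentiableWithinAt)
    (fun w hw => (hd w hw).deriv) hv half_mem_doublySlit
  have hp : ((1 / 2 : ℝ)) ^ (-(e / 2)) * (1 / 2) ^ (e / 2) = 1 := by
    rw [← Real.rpow_add (by norm_num)]; simp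
  rw [this, solP0_half, solP1_half, exp_slitBranch_half, betaA]
  norm_cast
  linear_combination (-(realIncBeta (1 - e / 2) (e - 1) (1 / 2)) -
    realIncBeta e (-(e / 2)) (1 / 2)) * hp

/-- The two solutions for `Q` differ by `betaB e` times the homogeneous solution. -/
lemma solQ0_sub_solQ1 {e : ℝ} (he : 0 < e) (he1 : e < 1) {v : ℂ} (hv : v ∈ doublySlit) :
    (solQ0 e v - solQ1 e v) * exp (-(e * slitBranch v)) = betaB e := by
  have hd : ∀ w ∈ doublySlit, HasDerivAt
      (fun v => (solQ0 e v - solQ1 e v) * exp (-(e * slitBranch v))) 0 w := by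
    intro w hw
    have h0 := slitPlane_ne_zero hw.1
    have h1 : w ≠ 1 := sub_ne_zero.1 (ne_one_of_one_sub_mem hw.2)
    refine (((hasDerivAt_solQ0 he hw.2 h0).sub (hasDerivAt_solQ1 he1 hw.1 h1)).mul
      (((hasDerivAt_slitBranch hw).const_mul (e : ℂ)).neg.cexp)).congr_deriv ?_
    simp only [Pi.sub_apply, Pi.neg_apply]
    ring
  have := isOpen_doublySlit.is_const_of_deriv_eq_zero isPreconnected_doublySlit
    (fun w hw => (hd w hw).differentiableAt.differentiableWithinAt)
    (fun w hw => (hd w hw).deriv) hv half_mem_doublySlit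
  have hp : ((1 / 2 : ℝ)) ^ (e / 2) * (1 / 2) ^ (-e / 2) = 1 := by
    rw [← Real.rpow_add (by norm_num), neg_div]; simp
  have hn : -((e : ℂ) * slitBranch (1 / 2)) = ((-e : ℝ) : ℂ) * slitBranch (1 / 2) := by
    push_cast; ring
  rw [this, solQ0_half, solQ1_half, hn, exp_slitBranch_half, betaB]
  norm_cast
  linear_combination (realIncBeta (e / 2) (-e) (1 / 2) +
    realIncBeta (1 - e) (e / 2 - 1) (1 / 2)) * hp

/-! ### The horizontal coordinate and the period problem -/

/-- Coefficient of `v / (v - 1)` in `ratPart`. -/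
def ratAlpha (e x : ℝ) : ℝ := -((1 - x ^ 2) - (1 - x ^ 2) ^ 2 / 4) / (1 - e)

/-- Coefficient of `v / (v - 1)²` in `ratPart`. -/
def ratBeta (e x : ℝ) : ℝ := -(1 - x ^ 2) ^ 2 / (2 * (2 - e))

/-- The factor `(4k + 3 - 2x² - x⁴) / (4k)` for `e = 1 / (k + 1)`: the weight of the beta integral
that remains when the poles of `η` have been removed by integration by parts. -/
def kappa (e x : ℝ) : ℝ := 1 - e * ratAlpha e x

/-- The rational factor of the algebraic part of `∫ η`; it vanishes at `v = 0`. -/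
def ratPart (e x : ℝ) (v : ℂ) : ℂ := v * (ratAlpha e x / (v - 1) + ratBeta e x / (v - 1) ^ 2)

/-- The primitive `∫ η` as a function of `v = z²` and `τ = w / z = exp (e u)`, for a given solution
`P` of `P' = 1 / (v - 1) - e u' P`. -/
def primEta (e x : ℝ) (P : ℂ → ℂ) (v τ : ℂ) : ℂ := τ * (ratPart e x v + kappa e x / 2 * P v)

/-- The primitive `∫ g² η` as a function of `v = z²` and `τ = w / z = exp (e u)`, for a given
solution `Q` of `Q' = 1 / v + e u' Q`; here `c2` is the square of the constant `c`. -/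
def primGauss (e c2 : ℝ) (Q : ℂ → ℂ) (v τ : ℂ) : ℂ := -(c2 / τ) * (1 / (2 * e) + Q v / 4)

/-- The coefficient of `η` with respect to `dv`, `v = z²`. -/
def etaCoeff (x : ℝ) (v τ : ℂ) : ℂ := τ * (v - x ^ 2) ^ 2 / (2 * (v - 1) ^ 3)

/-- The coefficient of `g² η` with respect to `dv`, `v = z²`. -/
def gaussCoeff (c2 : ℝ) (v τ : ℂ) : ℂ := c2 / (2 * τ * v * (v - 1))

open Classical in
/-- The complex horizontal coordinate `X₁ - i X₂ = ∫ η - conj (∫ g² η)` of the surface as a function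
of `v = z²` and `τ = w / z`: the primitives built from `solP0` and `solQ0` are used off the slit
`[1, ∞)`, and those built from `solP1` and `solQ1` on the slit. -/
def horiz (e x c2 : ℝ) (v τ : ℂ) : ℂ :=
  if 1 - v ∈ slitPlane then
    primEta e x (solP0 e) v τ - conj (primGauss e c2 (solQ0 e) v τ)
  else primEta e x (solP1 e) v τ - conj (primGauss e c2 (solQ1 e) v τ)

lemma mem_slitPlane_of_one_sub_notMem {v : ℂ} (h : 1 - v ∉ slitPlane) : v ∈ slitPlane := by
  rw [mem_slitPlane_iff] at h ⊢
  push Not at h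
  simp only [sub_re, one_re] at h
  left
  linarith [h.1]

section FDeriv

variable {E : Type*} [NormedAddCommGroup E] [NormedSpace ℝ E]

lemma hasFDerivAt_comp_of_hasDerivAt {f : ℂ → ℂ} {f' : ℂ} {g : E → ℂ} {g' : E →L[ℝ] ℂ} {t : E}
    (hf : HasDerivAt f f' (g t)) (hg : HasFDerivAt g g' t) :
    HasFDerivAt (fun s => f (g s)) (f' • g') t := by
  refine ((hf.hasFDerivAt.restrictScalars ℝ).comp t hg).congr_fderiv ?_
  ext h
  simp [mul_comm]

lemma hasDerivAt_ratPart (e x : ℝ) {v : ℂ} (h1 : v - 1 ≠ 0) :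
    HasDerivAt (ratPart e x) (-(ratAlpha e x + ratBeta e x) / (v - 1) ^ 2 -
      2 * ratBeta e x / (v - 1) ^ 3) v := by
  have hs : HasDerivAt (fun v : ℂ => v - 1) 1 v := (hasDerivAt_id v).sub_const 1
  refine ((hasDerivAt_id v).mul (((hasDerivAt_const v (ratAlpha e x : ℂ)).div hs h1).add
    ((hasDerivAt_const v (ratBeta e x : ℂ)).div (hs.pow 2) (pow_ne_zero 2 h1)))).congr_deriv ?_
  simp only [Pi.add_apply, Pi.div_apply, Pi.pow_apply, id]
  field_simp
  ring

/-- Integration by parts: the derivative of `τ * ratPart` together with the simple pole of weight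
`kappa / 2` at `v = 1` is `η`. This determines `ratAlpha`, `ratBeta` and `kappa`. -/
lemma rat_identity {e : ℝ} (x : ℝ) (he : e < 1) {v : ℂ} (h0 : v ≠ 0) (h1 : v - 1 ≠ 0) :
    e * logSlope v * ratPart e x v + (-(ratAlpha e x + ratBeta e x) / (v - 1) ^ 2 -
      2 * ratBeta e x / (v - 1) ^ 3) + kappa e x / 2 * (1 / (v - 1)) =
      (v - x ^ 2) ^ 2 / (2 * (v - 1) ^ 3) := by
  have e1 : (1 - e : ℂ) ≠ 0 := by
    exact_mod_cast (by linarith : (1 - e : ℝ) ≠ 0)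
  have e2 : (2 - e : ℂ) ≠ 0 := by
    exact_mod_cast (by linarith : (2 - e : ℝ) ≠ 0)
  simp only [logSlope, ratPart, kappa, ratAlpha, ratBeta]
  push_cast
  field_simp
  ring

lemma hasFDerivAt_primEta {e x : ℝ} (he : e < 1) {P : ℂ → ℂ} {v τ : E → ℂ} {v' : E →L[ℝ] ℂ} {t : E}
    (hv : HasFDerivAt v v' t) (hτ : HasFDerivAt τ ((e * logSlope (v t) * τ t) • v') t)
    (h0 : v t ≠ 0) (h1 : v t ≠ 1)
    (hP : HasDerivAt P (1 / (v t - 1) - e * logSlope (v t) * P (v t)) (v t)) :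
    HasFDerivAt (fun s => primEta e x P (v s) (τ s)) (etaCoeff x (v t) (τ t) • v') t := by
  have h1' : v t - 1 ≠ 0 := sub_ne_zero.2 h1
  have := hasFDerivAt_comp_of_hasDerivAt ((hasDerivAt_ratPart e x h1').add
    (hP.const_mul (kappa e x / 2 : ℂ))) hv
  refine (hτ.mul this).congr_fderiv ?_
  ext h
  simp only [add_apply, smul_apply, smul_eq_mul, etaCoeff, Pi.add_apply]
  linear_combination τ t * v' h * rat_identity x he h0 h1'

lemma hasFDerivAt_primGauss {e c2 : ℝ} (he : e ≠ 0) {Q : ℂ → ℂ} {v τ : E → ℂ} {v' : E →L[ℝ] ℂ} {t : E}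
    (hv : HasFDerivAt v v' t) (hτ : HasFDerivAt τ ((e * logSlope (v t) * τ t) • v') t)
    (h0 : v t ≠ 0) (h1 : v t ≠ 1) (hne : τ t ≠ 0)
    (hQ : HasDerivAt Q (1 / v t + e * logSlope (v t) * Q (v t)) (v t)) :
    HasFDerivAt (fun s => primGauss e c2 Q (v s) (τ s)) (gaussCoeff c2 (v t) (τ t) • v') t := by
  have h1' : v t - 1 ≠ 0 := sub_ne_zero.2 h1
  have he' : (e : ℂ) ≠ 0 := by exact_mod_cast he
  have hi : HasDerivAt (fun w : ℂ => -((c2 : ℂ) / w)) (c2 / (τ t) ^ 2) (τ t) := by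
    refine ((hasDerivAt_const _ (c2 : ℂ)).div (hasDerivAt_id (τ t)) hne).neg.congr_deriv ?_
    simp only [id]
    ring
  have := hasFDerivAt_comp_of_hasDerivAt ((hQ.div_const 4).const_add (1 / (2 * e : ℂ))) hv
  refine ((hasFDerivAt_comp_of_hasDerivAt hi hτ).mul this).congr_fderiv ?_
  ext h
  simp only [add_apply, smul_apply, smul_eq_mul, gaussCoeff, logSlope]
  field_simp
  ring

/-- The real differential of `∫ η - conj (∫ g² η)`. -/
def horizForm (x c2 : ℝ) (v τ : ℂ) (v' : E →L[ℝ] ℂ) : E →L[ℝ] ℂ :=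
  etaCoeff x v τ • v' - (conjCLE : ℂ →L[ℝ] ℂ).comp (gaussCoeff c2 v τ • v')

/-- The period problem: thanks to the choice of the constant `c`, the two pairs of primitives
define the same horizontal coordinate. -/
lemma horiz_eq_of_mem_slitPlane {e x c2 : ℝ} (he : 0 < e) (he1 : e < 1)
    (hc : c2 * betaB e = 2 * kappa e x * betaA e) {v τ : ℂ} (hv : v ∈ slitPlane)
    (hτ : ‖τ‖ = Real.exp (e * logModulus v)) :
    horiz e x c2 v τ = primEta e x (solP1 e) v τ - conj (primGauss e c2 (solQ1 e) v τ) := by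
  rw [horiz]
  split_ifs with h
  · have hvd : v ∈ doublySlit := ⟨hv, h⟩
    have hP := solP0_sub_solP1 he he1 hvd
    have hQ := solQ0_sub_solQ1 he he1 hvd
    set Z := exp (e * slitBranch v) with hZ
    have hZ0 : Z ≠ 0 := exp_ne_zero _
    rw [exp_neg, ← hZ] at hQ
    have hZn : ‖Z‖ = ‖τ‖ := by
      rw [hZ, norm_exp, hτ, ← slitBranch_re, re_ofReal_mul]
    have hτ0 : τ ≠ 0 := by
      rw [← norm_ne_zero_iff, hτ]; exact (Real.exp_pos _).ne'
    have hP' : solP0 e v = solP1 e v - betaA e / Z := by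
      field_simp
      linear_combination hP
    have hQ' : solQ0 e v = solQ1 e v + betaB e * Z := by
      field_simp at hQ
      linear_combination hQ
    have hcc : conj Z * Z = conj τ * τ := by
      rw [← normSq_eq_conj_mul_self, ← normSq_eq_conj_mul_self, normSq_eq_norm_sq,
        normSq_eq_norm_sq, hZn]
    have hc' : (c2 : ℂ) * betaB e = 2 * kappa e x * betaA e := by exact_mod_cast hc
    have hcτ : conj τ ≠ 0 := by simpa using hτ0
    -- `|τ| = |Z|`, so the differences of the two primitives have the same dependence on `τ`
    have key : conj Z / conj τ = τ / Z := by
      rw [div_eq_div_iff hcτ hZ0, hcc, mul_comm]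
    simp only [primEta, primGauss, hP', hQ', map_mul, map_neg, map_add, map_div₀, conj_ofReal,
      map_one, map_ofNat]
    have e2 : -((c2 : ℂ) / conj τ) * (1 / (2 * e) + (conj (solQ1 e v) + betaB e * conj Z) / 4) =
        -((c2 : ℂ) / conj τ) * (1 / (2 * e) + conj (solQ1 e v) / 4) -
          c2 * betaB e * (conj Z / conj τ) / 4 := by
      ring
    rw [e2, key, hc']
    ring
  · rfl

/-- Along a solution `τ` of `dτ = e τ du` with the correct modulus the horizontal coordinate is
differentiable for `v ≠ 0, 1`, in particular across the slits, with differential `η - conj (g² η)`. -/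
theorem hasFDerivAt_horiz {e x c2 : ℝ} (he : 0 < e) (he1 : e < 1)
    (hc : c2 * betaB e = 2 * kappa e x * betaA e) {v τ : E → ℂ} {v' : E →L[ℝ] ℂ} {t : E}
    (hv : HasFDerivAt v v' t) (hτ : HasFDerivAt τ ((e * logSlope (v t) * τ t) • v') t)
    (hmod : ∀ᶠ s in 𝓝 t, ‖τ s‖ = Real.exp (e * logModulus (v s)))
    (h0 : v t ≠ 0) (h1 : v t ≠ 1) :
    HasFDerivAt (fun s => horiz e x c2 (v s) (τ s)) (horizForm x c2 (v t) (τ t) v') t := by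
  have hτ0 : τ t ≠ 0 := by
    rw [← norm_ne_zero_iff, hmod.self_of_nhds]; exact (Real.exp_pos _).ne'
  have hcj (f : E → ℂ) (f' : E →L[ℝ] ℂ) (hf : HasFDerivAt f f' t) :
      HasFDerivAt (fun s => conj (f s)) ((conjCLE : ℂ →L[ℝ] ℂ).comp f') t :=
    (conjCLE : ℂ →L[ℝ] ℂ).hasFDerivAt.comp t hf
  by_cases hs : 1 - v t ∈ slitPlane
  · have hev : ∀ᶠ s in 𝓝 t, 1 - v s ∈ slitPlane :=
      (continuousAt_const.sub hv.continuousAt).eventually_mem (isOpen_slitPlane.mem_nhds hs)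
    refine HasFDerivAt.congr_of_eventuallyEq ?_ (hev.mono fun s h => if_pos h)
    exact (hasFDerivAt_primEta he1 hv hτ h0 h1 (hasDerivAt_solP0 (by linarith) hs h0)).sub
      (hcj _ _ (hasFDerivAt_primGauss he.ne' hv hτ h0 h1 hτ0 (hasDerivAt_solQ0 he hs h0)))
  · have hs' := mem_slitPlane_of_one_sub_notMem hs
    have hev : ∀ᶠ s in 𝓝 t, v s ∈ slitPlane :=
      hv.continuousAt.eventually_mem (isOpen_slitPlane.mem_nhds hs')
    refine HasFDerivAt.congr_of_eventuallyEq ?_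
      ((hev.and hmod).mono fun s h => horiz_eq_of_mem_slitPlane he he1 hc h.1 h.2)
    exact (hasFDerivAt_primEta he1 hv hτ h0 h1 (hasDerivAt_solP1 he hs' h1)).sub
      (hcj _ _ (hasFDerivAt_primGauss he.ne' hv hτ h0 h1 hτ0 (hasDerivAt_solQ1 he1 hs' h1)))

end FDeriv

/-- The horizontal coordinate is equivariant under rotations of `τ`. -/
lemma horiz_rotate (e x c2 : ℝ) (v τ ζ : ℂ) (hζ : ‖ζ‖ = 1) :
    horiz e x c2 v (ζ * τ) = ζ * horiz e x c2 v τ := by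
  have h : conj ζ ≠ 0 := by
    rw [← norm_ne_zero_iff, norm_conj, hζ]; exact one_ne_zero
  have h' : ζ * conj ζ = 1 := by
    rw [mul_conj, normSq_eq_norm_sq, hζ]; norm_num
  have h2 : ((c2 : ℂ) / (conj ζ * conj τ)) = ζ * (c2 / conj τ) := by
    rw [← mul_div_mul_left (c2 : ℂ) (conj ζ * conj τ) (c := ζ) (by rintro rfl; simp at hζ),
      ← mul_assoc ζ, h', one_mul, mul_div_assoc]
  simp only [horiz, primEta, primGauss, map_mul, map_neg, map_div₀, conj_ofReal, h2]
  split_ifs <;> ring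

/-! ### The constants, the height and the real Weierstrass forms -/

section Constant

lemma betaA_pos {e : ℝ} (he : 0 < e) (he1 : e < 1) : 0 < betaA e := by
  have h1 := (realIncBeta_half_bounds (a := 1 - e / 2) (by linarith) (e - 1)).1
  have h2 := (realIncBeta_half_bounds he (-(e / 2))).1
  have h3 : 0 < (1 / 2 : ℝ) ^ (1 - e / 2) * 2 ^ (-|e - 1|) / (1 - e / 2) := by
    have : 0 < 1 - e / 2 := by linarith
    positivity
  have h4 : 0 < (1 / 2 : ℝ) ^ e * 2 ^ (-|-(e / 2)|) / e := by positivity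
  exact add_pos (h3.trans_le h1) (h4.trans_le h2)

lemma betaB_pos {e : ℝ} (he : 0 < e) (he1 : e < 1) : 0 < betaB e := by
  have h1 := (realIncBeta_half_bounds (a := e / 2) (by linarith) (-e)).1
  have h2 := (realIncBeta_half_bounds (a := 1 - e) (by linarith) (e / 2 - 1)).1
  have h3 : 0 < (1 / 2 : ℝ) ^ (e / 2) * 2 ^ (-|-e|) / (e / 2) := by positivity
  have h4 : 0 < (1 / 2 : ℝ) ^ (1 - e) * 2 ^ (-|e / 2 - 1|) / (1 - e) := by
    have : 0 < 1 - e := by linarith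
    positivity
  exact add_pos (h3.trans_le h1) (h4.trans_le h2)

lemma betaA_eq {e : ℝ} (he : 0 < e) (he1 : e < 1) :
    ∫ t in (0 : ℝ)..1, t ^ (-(e / 2)) * (1 - t) ^ (e - 1) = betaA e := by
  have h := (realIncBeta_add (a := 1 - e / 2) (b := e) (by linarith) he).2
  rw [show 1 - e / 2 - 1 = -(e / 2) by ring] at h
  exact h

lemma betaB_eq {e : ℝ} (he : 0 < e) (he1 : e < 1) :
    ∫ t in (0 : ℝ)..1, t ^ (e / 2 - 1) * (1 - t) ^ (-e) = betaB e := by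
  have h := (realIncBeta_add (a := e / 2) (b := 1 - e) (by linarith) (by linarith)).2
  rw [show 1 - e - 1 = -e by ring] at h
  exact h

/-- The substitution `v = t²` on the unit interval. -/
lemma integral_sq_substitution (g : ℝ → ℝ) :
    ∫ t in (0 : ℝ)..1, 2 * t * g (t ^ 2) = ∫ v in (0 : ℝ)..1, g v := by
  have him : (fun t : ℝ => t ^ 2) '' Ioo 0 1 = Ioo 0 1 := by
    ext v
    constructor
    · rintro ⟨t, ht, rfl⟩
      exact ⟨by have := ht.1; positivity, by nlinarith [ht.1, ht.2]⟩
    · intro hv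
      refine ⟨√v, ⟨Real.sqrt_pos.2 hv.1, ?_⟩, Real.sq_sqrt hv.1.le⟩
      rw [Real.sqrt_lt' one_pos]; simpa using hv.2
  have h := MeasureTheory.integral_image_eq_integral_abs_deriv_smul (s := Ioo (0 : ℝ) 1)
    (f := fun t => t ^ 2) (f' := fun t => 2 * t) measurableSet_Ioo
    (fun t _ => by simpa using (hasDerivAt_pow 2 t).hasDerivWithinAt)
    (fun a ha b hb hab => by
      have := (pow_left_inj₀ ha.1.le hb.1.le two_ne_zero).1 hab
      exact this) g
  rw [him] at h
  rw [intervalIntegral.integral_of_le zero_le_one, intervalIntegral.integral_of_le zero_le_one,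
    integral_Ioc_eq_integral_Ioo, integral_Ioc_eq_integral_Ioo, h]
  refine setIntegral_congr_fun measurableSet_Ioo fun t ht => ?_
  rw [smul_eq_mul, abs_of_pos (by linarith [ht.1])]

/-- The small parameter `1 / (k + 1)`. -/
def inv1 (k : ℕ) : ℝ := 1 / ((k : ℝ) + 1)

lemma inv1_pos (k : ℕ) : 0 < inv1 k := by unfold inv1; positivity

lemma inv1_mul (k : ℕ) : inv1 k * (k + 1) = 1 := by
  unfold inv1; field_simp

lemma inv1_lt_one {k : ℕ} (hk : 1 ≤ k) : inv1 k < 1 := by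
  have : (1 : ℝ) ≤ k := by exact_mod_cast hk
  unfold inv1
  rw [div_lt_one (by positivity)]
  linarith

lemma integral_Ioo_congr {f g : ℝ → ℝ} (h : ∀ t ∈ Ioo (0 : ℝ) 1, f t = g t) :
    ∫ t in (0 : ℝ)..1, f t = ∫ t in (0 : ℝ)..1, g t := by
  rw [intervalIntegral.integral_of_le zero_le_one, intervalIntegral.integral_of_le zero_le_one,
    integral_Ioc_eq_integral_Ioo, integral_Ioc_eq_integral_Ioo]
  exact setIntegral_congr_fun measurableSet_Ioo h

lemma intA_eq {k : ℕ} (hk : 1 ≤ k) : intA k = -betaA (inv1 k) / 2 := by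
  have he := inv1_pos k
  have he1 := inv1_lt_one hk
  rw [← betaA_eq he he1, ← integral_sq_substitution, intA, ← intervalIntegral.integral_neg,
    ← intervalIntegral.integral_div]
  refine integral_Ioo_congr fun t ht => ?_
  have h1 : 0 < 1 - t ^ 2 := by nlinarith [ht.1, ht.2]
  have h2 : t ^ 2 - 1 ≠ 0 := by intro h; linarith
  have hk2 : (k : ℝ) * inv1 k = 1 - inv1 k := by linarith [inv1_mul k]
  change (t ^ k * (1 - t ^ 2)) ^ (inv1 k) / (t ^ 2 - 1) = _
  rw [Real.mul_rpow (pow_nonneg ht.1.le k) h1.le, ← Real.rpow_natCast t k, ← Real.rpow_mul ht.1.le, hk2,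
    Real.rpow_sub_one h1.ne', Real.rpow_sub ht.1, Real.rpow_one, ← Real.rpow_natCast t 2,
    ← Real.rpow_mul ht.1.le, Nat.cast_ofNat, mul_neg, mul_div_cancel₀ _ two_ne_zero,
    Real.rpow_neg ht.1.le, Real.rpow_ofNat, show 1 - t ^ 2 = -(t ^ 2 - 1) by ring]
  field_simp

lemma intB_eq {k : ℕ} (hk : 1 ≤ k) : intB k = -betaB (inv1 k) / 4 := by
  have he := inv1_pos k
  have he1 := inv1_lt_one hk
  have : ∫ t in (0 : ℝ)..1, (t ^ k * (1 - t ^ 2)) ^ (-(1 : ℝ) / (k + 1)) = betaB (inv1 k) / 2 := by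
    rw [← betaB_eq he he1, ← integral_sq_substitution (fun t => t ^ (inv1 k / 2 - 1) * _),
      ← intervalIntegral.integral_div]
    refine integral_Ioo_congr fun t ht => ?_
    have h1 : 0 < 1 - t ^ 2 := by nlinarith [ht.1, ht.2]
    have hk2 : (k : ℝ) * -inv1 k = inv1 k - 1 := by linarith [inv1_mul k]
    have hn : -(1 : ℝ) / (k + 1) = -inv1 k := by rw [inv1]; ring
    have h3 : (t ^ 2) ^ (inv1 k / 2 - 1) = t ^ (inv1 k - 1) / t := by
      rw [← Real.rpow_natCast t 2, ← Real.rpow_mul ht.1.le, ← Real.rpow_sub_one ht.1.ne']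
      congr 1
      push_cast
      ring
    rw [hn, Real.mul_rpow (pow_nonneg ht.1.le k) h1.le, ← Real.rpow_natCast t k,
      ← Real.rpow_mul ht.1.le, hk2, h3]
    have := ht.1.ne'
    field_simp
  rw [intB, this]; ring

lemma kappa_eq {k : ℕ} (hk : 1 ≤ k) (x : ℝ) :
    (4 * k + 3 - 2 * x ^ 2 - x ^ 4) / (4 * k) = kappa (inv1 k) x := by
  have : (1 : ℝ) ≤ k := by exact_mod_cast hk
  have h0 : (k : ℝ) ≠ 0 := by positivity
  have h1 : (k : ℝ) + 1 ≠ 0 := by positivity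
  have h2 : 1 - inv1 k = k / (k + 1) := by rw [inv1]; field_simp; ring
  rw [kappa, ratAlpha, h2, inv1]
  field_simp
  ring

lemma admissible_of_abs_lt (k : ℕ) (x : ℝ) (h : |x| < √(2 * √((k : ℝ) + 1) - 1)) :
    0 < 4 * (k : ℝ) + 3 - 2 * x ^ 2 - x ^ 4 := by
  have h1 : x ^ 2 < 2 * √((k : ℝ) + 1) - 1 := by
    rw [← sq_abs]; exact (Real.lt_sqrt (abs_nonneg x)).1 h
  have h2 : √((k : ℝ) + 1) ^ 2 = k + 1 := Real.sq_sqrt (by positivity)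
  nlinarith [sq_nonneg x, Real.sqrt_nonneg ((k : ℝ) + 1)]

lemma constC_pos {k : ℕ} (hk : 1 ≤ k) {x : ℝ} (hx : 0 < 4 * (k : ℝ) + 3 - 2 * x ^ 2 - x ^ 4) :
    0 < constC k x := by
  have hk' : (1 : ℝ) ≤ k := by exact_mod_cast hk
  have hA := betaA_pos (inv1_pos k) (inv1_lt_one hk)
  have hB := betaB_pos (inv1_pos k) (inv1_lt_one hk)
  rw [constC, intA_eq hk, intB_eq hk]
  refine mul_pos (Real.sqrt_pos.2 (by positivity)) (Real.sqrt_pos.2 ?_)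
  have : -betaA (inv1 k) / 2 / (-betaB (inv1 k) / 4) = 2 * betaA (inv1 k) / betaB (inv1 k) := by
    field_simp; ring
  rw [this]
  positivity

lemma constC_sq {k : ℕ} (hk : 1 ≤ k) {x : ℝ} (hx : 0 < 4 * (k : ℝ) + 3 - 2 * x ^ 2 - x ^ 4) :
    constC k x ^ 2 = kappa (inv1 k) x * (2 * betaA (inv1 k) / betaB (inv1 k)) := by
  have hk' : (1 : ℝ) ≤ k := by exact_mod_cast hk
  have hA := betaA_pos (inv1_pos k) (inv1_lt_one hk)
  have hB := betaB_pos (inv1_pos k) (inv1_lt_one hk)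
  have hq : intA k / intB k = 2 * betaA (inv1 k) / betaB (inv1 k) := by
    rw [intA_eq hk, intB_eq hk]; field_simp; ring
  rw [constC, mul_pow, Real.sq_sqrt (by positivity), Real.sq_sqrt (by rw [hq]; positivity),
    kappa_eq hk, hq]

/-- The constant `c (k, x)` solves the period problem `horiz_eq_of_mem_slitPlane`. -/
lemma constC_period {k : ℕ} (hk : 1 ≤ k) {x : ℝ} (hx : 0 < 4 * (k : ℝ) + 3 - 2 * x ^ 2 - x ^ 4) :
    constC k x ^ 2 * betaB (inv1 k) = 2 * kappa (inv1 k) x * betaA (inv1 k) := by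
  have hB := betaB_pos (inv1_pos k) (inv1_lt_one hk)
  rw [constC_sq hk hx]
  field_simp

end Constant

/-- The point of `ℝ³` with horizontal coordinates `x₁ - i x₂ = H` and height `h`. -/
def spacePoint (H : ℂ) (h : ℝ) : E3 := !₂[H.re, -H.im, h]

lemma continuous_spacePoint : Continuous fun q : ℂ × ℝ => spacePoint q.1 q.2 := by
  refine (PiLp.continuous_toLp 2 _).comp (continuous_pi fun i => ?_)
  fin_cases i <;> simp <;> fun_prop

/-- The real differential `ζ ↦ Re (Φ ζ)` with values in `ℝ³`, as a function of `Φ ∈ ℂ³`. -/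
def realForm : (Fin 3 → ℂ) →L[ℝ] ℂ →L[ℝ] E3 :=
  LinearMap.toContinuousLinearMap
    { toFun := fun Φ => LinearMap.toContinuousLinearMap
        { toFun := fun ζ => WithLp.toLp 2 fun j => (Φ j * ζ).re
          map_add' := fun a b => by ext j; simp [mul_add]
          map_smul' := fun r a => by ext j; simp; ring }
      map_add' := fun a b => by ext ζ j; simp [add_mul]
      map_smul' := fun r a => by ext ζ j; simp; ring }

lemma realForm_apply (Φ : Fin 3 → ℂ) (ζ : ℂ) (j : Fin 3) : realForm Φ ζ j = (Φ j * ζ).re := rfl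

/-- The three Weierstrass forms `(1 - g²) η`, `i (1 + g²) η`, `2 g η` with respect to `dz`, in terms
of `z` and `τ = w / z`. The case `c = τ = 1` is the limit `k → ∞`. -/
def modelForm (x c : ℝ) (z τ : ℂ) : Fin 3 → ℂ :=
  ![τ * (z * (z ^ 2 - x ^ 2) ^ 2 / (z ^ 2 - 1) ^ 3) - c ^ 2 / τ * (1 / (z * (z ^ 2 - 1))),
    I * (τ * (z * (z ^ 2 - x ^ 2) ^ 2 / (z ^ 2 - 1) ^ 3) + c ^ 2 / τ * (1 / (z * (z ^ 2 - 1)))),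
    2 * c * (z ^ 2 - x ^ 2) / (z ^ 2 - 1) ^ 2]

/-- The height `Re ∫ 2 g η` in closed form. -/
def height (x c : ℝ) (z : ℂ) : ℝ :=
  c * ((1 + x ^ 2) / 2 * (Real.log ‖z - 1‖ - Real.log ‖z + 1‖) -
    (1 - x ^ 2) * (z / (z ^ 2 - 1)).re)

section FDeriv

variable {E : Type*} [NormedAddCommGroup E] [NormedSpace ℝ E]

lemma hasFDerivAt_log_norm {f : E → ℂ} {f' : E →L[ℝ] ℂ} {t : E} (hf : HasFDerivAt f f' t)
    (h0 : f t ≠ 0) :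
    HasFDerivAt (fun s => Real.log ‖f s‖) (reCLM.comp ((1 / f t) • f')) t := by
  have hd : HasDerivAt (fun y : ℂ => Complex.log (y / f t)) (1 / f t) (f t) := by
    have h1 : f t / f t ∈ slitPlane := by rw [div_self h0]; exact one_mem_slitPlane
    refine (((hasDerivAt_id (f t)).div_const (f t)).clog h1).congr_deriv ?_
    simp [h0]
  have h2 := (reCLM.hasFDerivAt.comp t (hasFDerivAt_comp_of_hasDerivAt hd hf)).add_const
    (Real.log ‖f t‖)
  refine h2.congr_of_eventuallyEq ?_
  filter_upwards [hf.continuousAt.eventually_ne h0] with s hs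
  have : ‖f t‖ ≠ 0 := norm_ne_zero_iff.2 h0
  have hs' : ‖f s‖ ≠ 0 := norm_ne_zero_iff.2 hs
  simp [Complex.log_re, Real.log_div hs' this]

lemma hasFDerivAt_height (x c : ℝ) {z : E → ℂ} {z' : E →L[ℝ] ℂ} {t : E} (hz : HasFDerivAt z z' t)
    (h1 : z t ≠ 1) (h2 : z t ≠ -1) :
    HasFDerivAt (fun s => height x c (z s))
      (reCLM.comp ((2 * c * (z t ^ 2 - x ^ 2) / (z t ^ 2 - 1) ^ 2) • z')) t := by
  have h1' : z t - 1 ≠ 0 := sub_ne_zero.2 h1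
  have h2' : z t + 1 ≠ 0 := by rwa [← sub_neg_eq_add, sub_ne_zero]
  have h3 : z t ^ 2 - 1 ≠ 0 := by
    have : z t ^ 2 - 1 = (z t - 1) * (z t + 1) := by ring
    rw [this]; exact mul_ne_zero h1' h2'
  have a1 := hasFDerivAt_log_norm (hz.sub_const 1) h1'
  have a2 := hasFDerivAt_log_norm (hz.add_const 1) h2'
  have a3 := reCLM.hasFDerivAt.comp t (hasFDerivAt_comp_of_hasDerivAt
    ((hasDerivAt_id (z t)).div (((hasDerivAt_id (z t)).pow 2).sub_const 1) h3) hz)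
  have := (((a1.sub a2).const_mul ((1 + x ^ 2) / 2)).sub (a3.const_mul (1 - x ^ 2))).const_mul c
  refine this.congr_fderiv ?_
  ext h
  have key : 2 * c * (z t ^ 2 - x ^ 2) / (z t ^ 2 - 1) ^ 2 * z' h =
      (c : ℝ) * ((((1 + x ^ 2) / 2 : ℝ) : ℂ) * (1 / (z t - 1) * z' h - 1 / (z t + 1) * z' h) -
        ((1 - x ^ 2 : ℝ) : ℂ) * (((z t ^ 2 - 1) - z t * (2 * z t)) / (z t ^ 2 - 1) ^ 2 * z' h)) := by
    push_cast
    have e1 : 1 / (z t - 1) - 1 / (z t + 1) = 2 * (z t ^ 2 - 1) / (z t ^ 2 - 1) ^ 2 := by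
      field_simp; ring
    rw [← sub_mul, e1]
    ring
  simp only [ContinuousLinearMap.comp_apply, smul_apply, reCLM_apply, smul_eq_mul, sub_apply]
  rw [key, re_ofReal_mul, sub_re, re_ofReal_mul, re_ofReal_mul, sub_re]
  simp

lemma hasFDerivAt_spacePoint {H : E → ℂ} {h : E → ℝ} {A B C : ℂ} {z' : E →L[ℝ] ℂ} {t : E}
    (hH : HasFDerivAt H (A • z' - (conjCLE : ℂ →L[ℝ] ℂ).comp (B • z')) t)
    (hh : HasFDerivAt h (reCLM.comp (C • z')) t) :
    HasFDerivAt (fun s => spacePoint (H s) (h s))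
      ((realForm ![A - B, I * (A + B), C]).comp z') t := by
  rw [← hasFDerivWithinAt_univ, hasFDerivWithinAt_euclidean]
  intro i
  rw [hasFDerivWithinAt_univ]
  fin_cases i
  · refine (reCLM.hasFDerivAt.comp t hH).congr_fderiv ?_
    ext s
    simp [realForm_apply]
    ring
  · refine (imCLM.hasFDerivAt.comp t hH).neg.congr_fderiv ?_
    ext s
    simp [realForm_apply]
    ring
  · refine hh.congr_fderiv ?_
    ext s
    simp [realForm_apply]

end FDeriv

/-! ### The surfaces off the branch point -/

/-- The surface `Σ_{k,x}`, translated by `-C` in the direction of `x₁`. -/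
def sigmaMap (k : ℕ) (x C : ℝ) (p : ℂ × ℂ) : E3 :=
  spacePoint (horiz (inv1 k) x (constC k x ^ 2) (p.1 ^ 2) (p.2 / p.1) - C)
    (height x (constC k x) p.1)

lemma curveM_ratio_pow {k : ℕ} {p : ℂ × ℂ} (hp : p ∈ curveM k) (h0 : p.1 ≠ 0) :
    (p.2 / p.1) ^ (k + 1) = (p.1 ^ 2 - 1) / p.1 := by
  rw [div_pow, hp.1]
  field_simp
  ring

lemma sq_sub_one_ne_zero {z : ℂ} (h1 : z ≠ 1) (h2 : z ≠ -1) : z ^ 2 - 1 ≠ 0 := by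
  have : z ^ 2 - 1 = (z - 1) * (z - -1) := by ring
  rw [this]
  exact mul_ne_zero (sub_ne_zero.2 h1) (sub_ne_zero.2 h2)

lemma exp_logModulus_sq {z : ℂ} (h0 : z ≠ 0) (h3 : z ^ 2 - 1 ≠ 0) :
    Real.exp (logModulus (z ^ 2)) = ‖z ^ 2 - 1‖ / ‖z‖ := by
  have hz : 0 < ‖z‖ := norm_pos_iff.2 h0
  rw [logModulus, norm_pow, Real.log_pow, Nat.cast_ofNat, mul_div_cancel_left₀ _ two_ne_zero,
    Real.exp_sub, Real.exp_log (norm_pos_iff.2 h3), Real.exp_log hz]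

lemma norm_ratio {k : ℕ} {z τ : ℂ} (h0 : z ≠ 0) (h3 : z ^ 2 - 1 ≠ 0)
    (h : τ ^ (k + 1) = (z ^ 2 - 1) / z) : ‖τ‖ = Real.exp (inv1 k * logModulus (z ^ 2)) := by
  refine (pow_left_inj₀ (norm_nonneg _) (Real.exp_pos _).le (Nat.succ_ne_zero k)).1 ?_
  rw [← norm_pow, ← Real.exp_nat_mul, ← mul_assoc]
  have : ((k + 1 : ℕ) : ℝ) * inv1 k = 1 := by push_cast; linarith [inv1_mul k]
  rw [Nat.succ_eq_add_one, this, one_mul, exp_logModulus_sq h0 h3, h, norm_div]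

lemma etaCoeff_sq (x : ℝ) (z τ : ℂ) : etaCoeff x (z ^ 2) τ * (2 * z) =
    τ * (z * (z ^ 2 - x ^ 2) ^ 2 / (z ^ 2 - 1) ^ 3) := by
  rw [etaCoeff]; field_simp

lemma gaussCoeff_sq {c2 : ℝ} {z τ : ℂ} (h0 : z ≠ 0) : gaussCoeff c2 (z ^ 2) τ * (2 * z) =
    c2 / τ * (1 / (z * (z ^ 2 - 1))) := by
  rw [gaussCoeff]; field_simp

lemma logSlope_sq {z : ℂ} (h0 : z ≠ 0) (h3 : z ^ 2 - 1 ≠ 0) :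
    logSlope (z ^ 2) * (2 * z) = (z ^ 2 + 1) / (z * (z ^ 2 - 1)) := by
  rw [logSlope]; field_simp; ring

section FDeriv

variable {E : Type*} [NormedAddCommGroup E] [NormedSpace ℝ E]

/-- The differential of the coordinates in terms of a local solution `τ` of `dτ = e τ du`, where `v = z²`. -/
lemma hasFDerivAt_horiz_height {e x c : ℝ} (he : 0 < e) (he1 : e < 1)
    (hc : c ^ 2 * betaB e = 2 * kappa e x * betaA e) (C : ℝ) {z τ : E → ℂ} {z' : E →L[ℝ] ℂ} {t : E}
    (hz : HasFDerivAt z z' t)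
    (hτ : HasFDerivAt τ ((e * τ t * ((z t ^ 2 + 1) / (z t * (z t ^ 2 - 1)))) • z') t)
    (hmod : ∀ᶠ s in 𝓝 t, ‖τ s‖ = Real.exp (e * logModulus (z s ^ 2)))
    (h0 : z t ≠ 0) (h1 : z t ≠ 1) (h2 : z t ≠ -1) :
    HasFDerivAt (fun s => spacePoint (horiz e x (c ^ 2) (z s ^ 2) (τ s) - C) (height x c (z s)))
      ((realForm (modelForm x c (z t) (τ t))).comp z') t := by
  have h3 := sq_sub_one_ne_zero h1 h2
  have hτ0 : τ t ≠ 0 := by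
    rw [← norm_ne_zero_iff, hmod.self_of_nhds]; exact (Real.exp_pos _).ne'
  have hv : HasFDerivAt (fun s => z s ^ 2) ((2 * z t) • z') t :=
    hasFDerivAt_comp_of_hasDerivAt (by simpa using hasDerivAt_pow 2 (z t)) hz
  have hτ' : HasFDerivAt τ ((e * logSlope (z t ^ 2) * τ t) • ((2 * z t) • z')) t := by
    refine hτ.congr_fderiv ?_
    rw [smul_smul]
    congr 1
    linear_combination (-(e : ℂ) * τ t) * logSlope_sq h0 h3
  have hH := (hasFDerivAt_horiz he he1 hc hv hτ' hmod (pow_ne_zero 2 h0)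
    (sub_ne_zero.1 h3)).sub_const (C : ℂ)
  rw [horizForm, smul_smul, smul_smul] at hH
  refine (hasFDerivAt_spacePoint hH (hasFDerivAt_height x c hz h1 h2)).congr_fderiv ?_
  congr 2
  rw [modelForm, etaCoeff_sq, gaussCoeff_sq h0]
  push_cast
  rfl

theorem hasFDerivAt_sigmaMap {k : ℕ} (hk : 1 ≤ k) {x : ℝ}
    (hx : 0 < 4 * (k : ℝ) + 3 - 2 * x ^ 2 - x ^ 4) (C : ℝ) {z w : E → ℂ} {z' : E →L[ℝ] ℂ} {t : E}
    (hz : HasFDerivAt z z' t) (hw : DifferentiableAt ℝ w t)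
    (hM : ∀ᶠ s in 𝓝 t, (z s, w s) ∈ curveM k) (h0 : z t ≠ 0) :
    HasFDerivAt (fun s => sigmaMap k x C (z s, w s))
      ((realForm (modelForm x (constC k x) (z t) (w t / z t))).comp z') t := by
  obtain ⟨-, h1, h2⟩ := hM.self_of_nhds
  have h3 := sq_sub_one_ne_zero h1 h2
  have hev : ∀ᶠ s in 𝓝 t, (w s / z s) ^ (k + 1) = (z s ^ 2 - 1) / z s := by
    filter_upwards [hM, hz.continuousAt.eventually_ne h0] with s hs hs0
    exact curveM_ratio_pow hs hs0
  have hmod : ∀ᶠ s in 𝓝 t, ‖w s / z s‖ = Real.exp (inv1 k * logModulus (z s ^ 2)) := by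
    filter_upwards [hM, hz.continuousAt.eventually_ne h0, hev] with s hs hs0 hs'
    exact norm_ratio hs0 (sq_sub_one_ne_zero hs.2.1 hs.2.2) hs'
  refine hasFDerivAt_horiz_height (inv1_pos k) (inv1_lt_one hk) (constC_period hk hx) C hz ?_ hmod
    h0 h1 h2
  have hinv := hasFDerivAt_comp_of_hasDerivAt (hasDerivAt_inv h0) hz
  have hd : DifferentiableAt ℝ (fun s => w s / z s) t := by
    simp only [div_eq_mul_inv]; exact hw.mul hinv.differentiableAt
  have hτ := hd.hasFDerivAt
  set τ := fun s => w s / z s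
  set τ' := fderiv ℝ τ t
  have hτ0 : τ t ≠ 0 := by
    rw [← norm_ne_zero_iff, hmod.self_of_nhds]; exact (Real.exp_pos _).ne'
  refine hτ.congr_fderiv ?_
  have d1 := hasFDerivAt_comp_of_hasDerivAt (hasDerivAt_pow (k + 1) (τ t)) hτ
  have d2 := hasFDerivAt_comp_of_hasDerivAt
    ((((hasDerivAt_id (z t)).pow 2).sub_const 1).div (hasDerivAt_id (z t)) h0) hz
  have huniq := d1.unique (d2.congr_of_eventuallyEq hev)
  ext s
  have hs := congrArg (fun L => L s) huniq
  have hpow := hev.self_of_nhds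
  simp only [smul_apply, smul_eq_mul, Nat.add_sub_cancel, id, Pi.pow_apply] at hs
  change τ t ^ (k + 1) = _ at hpow
  have hk1 : (inv1 k : ℂ) * ((k : ℂ) + 1) = 1 := by exact_mod_cast inv1_mul k
  rw [smul_apply, smul_eq_mul]
  change τ' s = inv1 k * τ t * _ * _
  have hk2 : ((k : ℂ) + 1) ≠ 0 := right_ne_zero_of_mul_eq_one hk1
  have hτk : τ t ^ (k + 1) ≠ 0 := pow_ne_zero _ hτ0
  have : ((k : ℂ) + 1) * τ t ^ (k + 1) * τ' s =
      ((k : ℂ) + 1) * τ t ^ (k + 1) * (inv1 k * τ t * ((z t ^ 2 + 1) / (z t * (z t ^ 2 - 1))) * z' s) := by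
    have e1 : ((k : ℂ) + 1) * τ t ^ (k + 1) * τ' s = τ t * (((k + 1 : ℕ) : ℂ) * τ t ^ k * τ' s) := by
      push_cast; ring
    have e2 : ((k : ℂ) + 1) * τ t ^ (k + 1) *
        (inv1 k * τ t * ((z t ^ 2 + 1) / (z t * (z t ^ 2 - 1))) * z' s) =
        (inv1 k * ((k : ℂ) + 1)) * τ t ^ (k + 1) * τ t * ((z t ^ 2 + 1) / (z t * (z t ^ 2 - 1))) * z' s := by
      ring
    rw [e1, hs, e2, hk1, hpow]
    field_simp
    push_cast
    ring
  exact mul_left_cancel₀ (mul_ne_zero hk2 hτk) this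

end FDeriv

lemma weierstrassForm_sigma {k : ℕ} {x : ℝ} {p : ℂ × ℂ} (hp : p ∈ curveM k) (h0 : p.1 ≠ 0)
    (hx : p.1 ^ 2 ≠ (x : ℂ) ^ 2) (j : Fin 3) :
    weierstrassForm (gaussSigma k x) (etaSigma k x) j p = modelForm x (constC k x) p.1 (p.2 / p.1) j := by
  have h3 := sq_sub_one_ne_zero hp.2.1 hp.2.2
  have hτ := curveM_ratio_pow hp h0
  have hx' : p.1 ^ 2 - (x : ℂ) ^ 2 ≠ 0 := sub_ne_zero.2 hx
  have hτ0 : p.2 / p.1 ≠ 0 := by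
    intro h
    rw [h, zero_pow (Nat.succ_ne_zero k)] at hτ
    exact div_ne_zero h3 h0 hτ.symm
  have hw0 : p.2 ≠ 0 := fun h => hτ0 (by rw [h, zero_div])
  have e1 : (p.1 / p.2) ^ k = p.2 / (p.1 ^ 2 - 1) := by
    have := hp.1
    rw [div_pow, div_eq_div_iff (pow_ne_zero k hw0) h3, ← this]; ring
  have a1 : etaSigma k x p = p.2 / p.1 * (p.1 * (p.1 ^ 2 - x ^ 2) ^ 2 / (p.1 ^ 2 - 1) ^ 3) := by
    rw [etaSigma, e1]; field_simp
  have a2 : gaussSigma k x p ^ 2 * etaSigma k x p =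
      (constC k x : ℂ) ^ 2 / (p.2 / p.1) * (1 / (p.1 * (p.1 ^ 2 - 1))) := by
    rw [gaussSigma, etaSigma, e1]; field_simp
  have a3 : gaussSigma k x p * etaSigma k x p =
      (constC k x : ℂ) * (p.1 ^ 2 - x ^ 2) / (p.1 ^ 2 - 1) ^ 2 := by
    rw [gaussSigma, etaSigma, e1]; field_simp
  fin_cases j
  · simp only [weierstrassForm, modelForm, Fin.zero_eta, Matrix.cons_val_zero]
    rw [sub_mul, a2, a1]; ring
  · simp only [weierstrassForm, modelForm, Fin.mk_one, Matrix.cons_val_one, Matrix.cons_val_zero]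
    rw [mul_assoc, add_mul, a2, a1]; ring
  · simp only [weierstrassForm, modelForm, Fin.reduceFinMk, Matrix.cons_val]
    rw [mul_assoc, a3]; ring

/-- A map that is differentiable along curves with the Weierstrass forms as differential is a
Weierstrass map. -/
lemma isWeierstrassMap_of_hasDerivAt {M P : Set (ℂ × ℂ)} {g η : ℂ × ℂ → ℂ} {X : ℂ × ℂ → E3}
    (F : ℂ × ℂ → Fin 3 → ℂ) (hX : ContinuousOn X M) (hF : ContinuousOn F (M \ P))
    (hform : ∀ p ∈ M \ P, ∀ j, weierstrassForm g η j p = F p j)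
    (hd : ∀ (γ : ℝ → ℂ × ℂ) (t : ℝ), DifferentiableAt ℝ γ t → (∀ᶠ s in 𝓝 t, γ s ∈ M \ P) →
      HasFDerivAt (fun s => X (γ s)) ((realForm (F (γ t))).comp (fderiv ℝ (fun s => (γ s).1) t)) t) :
    IsWeierstrassMap M P g η X := by
  refine ⟨hX, fun γ hγ hM j => ?_⟩
  have hγ1 : ContDiff ℝ 1 (fun s => (γ s).1) := contDiff_fst.comp hγ
  have hint : ∀ t ∈ Icc (0 : ℝ) 1, (weierstrassForm g η j (γ t) * deriv (fun s => (γ s).1) t) =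
      F (γ t) j * deriv (fun s => (γ s).1) t := fun t ht => by rw [hform _ (hM t ht)]
  have hcont : ContinuousOn (fun t => F (γ t) j * deriv (fun s => (γ s).1) t) (Icc 0 1) := by
    refine ContinuousOn.mul ?_ (hγ1.continuous_deriv le_rfl).continuousOn
    exact (continuous_apply j).comp_continuousOn (hF.comp hγ.continuous.continuousOn hM)
  have hcX : ContinuousOn (fun t => X (γ t) j) (Icc 0 1) :=
    (EuclideanSpace.proj (𝕜 := ℝ) j).continuous.comp_continuousOn
      (hX.comp hγ.continuous.continuousOn fun t ht => (hM t ht).1)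
  have hder : ∀ t ∈ Ioo (0 : ℝ) 1, HasDerivAt (fun t => X (γ t) j)
      (F (γ t) j * deriv (fun s => (γ s).1) t).re t := by
    intro t ht
    have := hd γ t (hγ.differentiable one_ne_zero t) (by
      filter_upwards [Icc_mem_nhds ht.1 ht.2] with s hs using hM s hs)
    have h2 := ((EuclideanSpace.proj (𝕜 := ℝ) j).hasFDerivAt.comp t this).hasDerivAt
    refine h2.congr_deriv ?_
    simp only [ContinuousLinearMap.comp_apply, PiLp.proj_apply, realForm_apply]
    rfl
  have hcre : ContinuousOn (fun t => (F (γ t) j * deriv (fun s => (γ s).1) t).re) (Icc 0 1) :=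
    continuous_re.comp_continuousOn hcont
  rw [intervalIntegral.integral_congr (g := fun t => F (γ t) j * deriv (fun s => (γ s).1) t)
    (by rw [uIcc_of_le zero_le_one]; exact hint)]
  have hII : IntervalIntegrable (fun t => F (γ t) j * deriv (fun s => (γ s).1) t) volume 0 1 :=
    hcont.intervalIntegrable_of_Icc zero_le_one
  rw [← intervalIntegral.integral_eq_sub_of_hasDerivAt_of_le zero_le_one hcX hder
    (hcre.intervalIntegrable_of_Icc zero_le_one)]
  exact (reCLM.intervalIntegral_comp_comm hII)

/-! ### Continuity at the branch point -/

lemma continuousAt_ratPart (e x : ℝ) {v : ℂ} (h : v ≠ 1) : ContinuousAt (ratPart e x) v :=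
  (hasDerivAt_ratPart e x (sub_ne_zero.2 h)).continuousAt

lemma continuousAt_primEta (e x : ℝ) {P : ℂ → ℂ} {q : ℂ × ℂ} (h : q.1 ≠ 1)
    (hP : ContinuousAt P q.1) : ContinuousAt (fun q : ℂ × ℂ => primEta e x P q.1 q.2) q := by
  have h1 : ContinuousAt (fun q : ℂ × ℂ => ratPart e x q.1) q :=
    ContinuousAt.comp (f := Prod.fst) (continuousAt_ratPart e x h) continuousAt_fst
  have h2 : ContinuousAt (fun q : ℂ × ℂ => P q.1) q :=
    ContinuousAt.comp (f := Prod.fst) hP continuousAt_fst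
  exact continuousAt_snd.mul (h1.add (continuousAt_const.mul h2))

lemma continuousAt_primGauss (e c2 : ℝ) {Q : ℂ → ℂ} {q : ℂ × ℂ} (h : q.2 ≠ 0)
    (hQ : ContinuousAt Q q.1) : ContinuousAt (fun q : ℂ × ℂ => primGauss e c2 Q q.1 q.2) q := by
  have h2 : ContinuousAt (fun q : ℂ × ℂ => Q q.1) q :=
    ContinuousAt.comp (f := Prod.fst) hQ continuousAt_fst
  exact (continuousAt_const.div continuousAt_snd h).neg.mul (continuousAt_const.add (h2.div_const _))

/-- The horizontal coordinate is continuous on the set of pairs `(v, τ)` with the correct modulus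
of `τ`. -/
lemma continuousWithinAt_horiz {e x c2 : ℝ} (he : 0 < e) (he1 : e < 1)
    (hc : c2 * betaB e = 2 * kappa e x * betaA e) {q : ℂ × ℂ} (h1 : q.1 ≠ 1) (h2 : q.2 ≠ 0)
    {s : Set (ℂ × ℂ)} (hq : q ∈ s) (hs : ∀ q ∈ s, ‖q.2‖ = Real.exp (e * logModulus q.1)) :
    ContinuousWithinAt (fun q : ℂ × ℂ => horiz e x c2 q.1 q.2) s q := by
  by_cases h : 1 - q.1 ∈ slitPlane
  · have hev : ∀ᶠ r : ℂ × ℂ in 𝓝 q, 1 - r.1 ∈ slitPlane :=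
      (continuousAt_const.sub continuousAt_fst).eventually_mem (isOpen_slitPlane.mem_nhds h)
    refine ContinuousAt.continuousWithinAt (ContinuousAt.congr ?_ (hev.mono fun r hr => (if_pos hr).symm))
    exact (continuousAt_primEta e x h1 (continuousAt_solP0 (by linarith) h)).sub
      (continuous_conj.continuousAt.comp (continuousAt_primGauss e c2 h2 (continuousAt_solQ0 he h)))
  · have h' := mem_slitPlane_of_one_sub_notMem h
    have hev : ∀ᶠ r : ℂ × ℂ in 𝓝[s] q, r.1 ∈ slitPlane :=
      mem_nhdsWithin_of_mem_nhds (continuousAt_fst.eventually_mem (isOpen_slitPlane.mem_nhds h'))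
    refine ContinuousWithinAt.congr_of_eventuallyEq ?_
      ((hev.and self_mem_nhdsWithin).mono fun r hr =>
        horiz_eq_of_mem_slitPlane he he1 hc hr.1 (hs r hr.2))
      (horiz_eq_of_mem_slitPlane he he1 hc h' (hs q hq))
    refine ContinuousAt.continuousWithinAt ?_
    exact (continuousAt_primEta e x h1 (hasDerivAt_solP1 he h' h1).continuousAt).sub
      (continuous_conj.continuousAt.comp
        (continuousAt_primGauss e c2 h2 (hasDerivAt_solQ1 he1 h' h1).continuousAt))

lemma curveM_zero {k : ℕ} (hk : 1 ≤ k) {p : ℂ × ℂ} (hp : p ∈ curveM k) (h0 : p.1 = 0) : p = (0, 0) := by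
  have := hp.1
  rw [h0, zero_pow (by omega), zero_mul] at this
  exact Prod.ext h0 (eq_zero_of_pow_eq_zero this)

lemma curveM_inv_ratio {k : ℕ} {p : ℂ × ℂ} (hp : p ∈ curveM k) :
    ‖p.1 / p.2‖ = (‖p.1‖ / ‖p.1 ^ 2 - 1‖) ^ (inv1 k) := by
  by_cases h0 : p.1 = 0
  · rw [h0]; simp [Real.zero_rpow (inv1_pos k).ne']
  · have h3 := sq_sub_one_ne_zero hp.2.1 hp.2.2
    have h := norm_ratio h0 h3 (curveM_ratio_pow hp h0)
    rw [mul_comm, Real.exp_mul, exp_logModulus_sq h0 h3, norm_div] at h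
    rw [norm_div, ← inv_div, h, ← Real.inv_rpow (by positivity), inv_div]

/-- Near the branch point `(0, 0)` the horizontal coordinate tends to its value `0`. -/
lemma tendsto_horiz_zero {k : ℕ} (hk : 1 ≤ k) (x c2 : ℝ) :
    Tendsto (fun p : ℂ × ℂ => horiz (inv1 k) x c2 (p.1 ^ 2) (p.2 / p.1)) (𝓝[curveM k] (0, 0)) (𝓝 0) := by
  have he := inv1_pos k
  have he1 := inv1_lt_one hk
  have hv0 : (1 : ℂ) - 0 ∈ slitPlane := by simp
  have hfst : Tendsto (fun p : ℂ × ℂ => p.1 ^ 2) (𝓝[curveM k] (0, 0)) (𝓝 0) := by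
    refine Tendsto.mono_left ?_ nhdsWithin_le_nhds
    have : Continuous fun p : ℂ × ℂ => p.1 ^ 2 := by fun_prop
    simpa using this.tendsto (0, 0)
  have hzw : Tendsto (fun p : ℂ × ℂ => p.2 * p.1) (𝓝[curveM k] (0, 0)) (𝓝 0) := by
    refine Tendsto.mono_left ?_ nhdsWithin_le_nhds
    have : Continuous fun p : ℂ × ℂ => p.2 * p.1 := by fun_prop
    simpa using this.tendsto (0, 0)
  have hinv : Tendsto (fun p : ℂ × ℂ => p.1 / p.2) (𝓝[curveM k] (0, 0)) (𝓝 0) := by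
    rw [tendsto_zero_iff_norm_tendsto_zero]
    have hc : ContinuousAt (fun p : ℂ × ℂ => (‖p.1‖ / ‖p.1 ^ 2 - 1‖) ^ (inv1 k)) (0, 0) := by
      refine ContinuousAt.rpow_const (ContinuousAt.div (by fun_prop) (by fun_prop) (by simp))
        (Or.inr he.le)
    have := hc.tendsto.mono_left (nhdsWithin_le_nhds (s := curveM k))
    simp only [norm_zero, zero_div, Real.zero_rpow he.ne'] at this
    refine this.congr' ?_
    filter_upwards [self_mem_nhdsWithin] with p hp
    exact (curveM_inv_ratio hp).symm
  obtain ⟨W', hW, -⟩ := exists_hasDerivAt_incBeta (a := 1 - inv1 k / 2) (by linarith) (inv1 k - 1) hv0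
  set r : ℂ → ℂ := fun v => ratAlpha (inv1 k) x / (v - 1) + ratBeta (inv1 k) x / (v - 1) ^ 2 +
    kappa (inv1 k) x / 2 * (-(1 - v) ^ (-(inv1 k : ℂ)) * incBeta (1 - inv1 k / 2) (inv1 k - 1) v)
    with hr
  have hrc : ContinuousAt r 0 := by
    have hA := (hasDerivAt_cpow_const_div (hasDerivAt_one_sub 0) hv0 (-(inv1 k : ℂ))).continuousAt
    refine ((ContinuousAt.div (by fun_prop) (by fun_prop) (by simp)).add
      (ContinuousAt.div (by fun_prop) (by fun_prop) (by simp))).add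
      (continuousAt_const.mul (hA.neg.mul hW.continuousAt))
  have hF : Tendsto (fun p : ℂ × ℂ => p.2 * p.1 * r (p.1 ^ 2)) (𝓝[curveM k] (0, 0)) (𝓝 0) := by
    simpa using hzw.mul (hrc.tendsto.comp hfst)
  have hG : Tendsto (fun p : ℂ × ℂ => -(c2 * (p.1 / p.2)) *
      (1 / (2 * inv1 k) + solQ0 (inv1 k) (p.1 ^ 2) / 4)) (𝓝[curveM k] (0, 0)) (𝓝 0) := by
    have := ((tendsto_const_nhds (x := (c2 : ℂ))).mul hinv).neg.mul
      ((tendsto_const_nhds (x := (1 / (2 * inv1 k) : ℂ))).add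
        (((continuousAt_solQ0 he hv0).tendsto.comp hfst).div_const 4))
    simpa using this
  have := hF.sub ((continuous_conj.tendsto 0).comp hG)
  simp only [map_zero, sub_zero] at this
  refine this.congr' ?_
  filter_upwards [hfst.eventually (isOpen_one_sub_slitPlane.mem_nhds hv0)] with p hp
  rw [horiz, if_pos hp]
  have e2 : (c2 : ℂ) / (p.2 / p.1) = c2 * (p.1 / p.2) := by
    rw [div_eq_mul_inv (c2 : ℂ), inv_div]
  simp only [primEta, primGauss, ratPart, solP0, hr, Function.comp, e2]
  by_cases h0 : p.1 = 0
  · simp [h0]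
  · have e3 : p.2 * p.1 = p.2 / p.1 * p.1 ^ 2 := by field_simp
    rw [e3]
    ring

lemma continuousOn_sigmaMap {k : ℕ} (hk : 1 ≤ k) {x : ℝ}
    (hx : 0 < 4 * (k : ℝ) + 3 - 2 * x ^ 2 - x ^ 4) (C : ℝ) :
    ContinuousOn (sigmaMap k x C) (curveM k) := by
  have he := inv1_pos k
  have he1 := inv1_lt_one hk
  intro p hp
  have hH : ContinuousWithinAt
      (fun p : ℂ × ℂ => horiz (inv1 k) x (constC k x ^ 2) (p.1 ^ 2) (p.2 / p.1)) (curveM k) p := by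
    by_cases h0 : p.1 = 0
    · obtain rfl := curveM_zero hk hp h0
      have := tendsto_horiz_zero hk x (constC k x ^ 2)
      rw [ContinuousWithinAt]
      convert this using 2
      simp [horiz, primEta, primGauss]
    · have h3 := sq_sub_one_ne_zero hp.2.1 hp.2.2
      set m : ℂ × ℂ → ℂ × ℂ := fun p => (p.1 ^ 2, p.2 / p.1)
      set s : Set (ℂ × ℂ) := {q | ‖q.2‖ = Real.exp (inv1 k * logModulus q.1)}
      have hms : ∀ r ∈ curveM k, r.1 ≠ 0 → m r ∈ s := fun r hr hr0 =>
        norm_ratio hr0 (sq_sub_one_ne_zero hr.2.1 hr.2.2) (curveM_ratio_pow hr hr0)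
      have hτ0 : (m p).2 ≠ 0 := by
        rw [← norm_ne_zero_iff, hms p hp h0]; exact (Real.exp_pos _).ne'
      have hcw := continuousWithinAt_horiz he he1 (constC_period hk hx) (sub_ne_zero.1 h3) hτ0
        (hms p hp h0) (fun q hq => hq)
      have hm : ContinuousAt m p :=
        (continuousAt_fst.pow 2).prodMk (continuousAt_snd.div continuousAt_fst h0)
      have ht : Tendsto m (𝓝[curveM k] p) (𝓝[s] (m p)) := by
        refine tendsto_nhdsWithin_iff.2 ⟨hm.tendsto.mono_left nhdsWithin_le_nhds, ?_⟩
        filter_upwards [self_mem_nhdsWithin,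
          mem_nhdsWithin_of_mem_nhds (continuousAt_fst.eventually_ne h0)] with r hr hr0
        exact hms r hr hr0
      have hcomp := Tendsto.comp (y := 𝓝[s] (m p)) hcw ht
      rw [ContinuousWithinAt]
      exact hcomp
  have hh : ContinuousAt (fun p : ℂ × ℂ => height x (constC k x) p.1) p := by
    exact (hasFDerivAt_height (E := ℂ × ℂ) x (constC k x) (z := Prod.fst) hasFDerivAt_fst
      hp.2.1 hp.2.2).continuousAt
  exact continuous_spacePoint.continuousAt.comp_continuousWithinAt
    ((hH.sub continuousWithinAt_const).prodMk hh.continuousWithinAt)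

lemma continuousAt_modelForm (x c : ℝ) {q : ℂ × ℂ} (h0 : q.1 ≠ 0) (h3 : q.1 ^ 2 - 1 ≠ 0)
    (hτ : q.2 ≠ 0) : ContinuousAt (fun q : ℂ × ℂ => modelForm x c q.1 q.2) q := by
  have e1 : ContinuousAt (fun q : ℂ × ℂ => q.2 * (q.1 * (q.1 ^ 2 - x ^ 2) ^ 2 / (q.1 ^ 2 - 1) ^ 3)) q :=
    continuousAt_snd.mul (ContinuousAt.div (by fun_prop) (by fun_prop) (pow_ne_zero 3 h3))
  have e2 : ContinuousAt (fun q : ℂ × ℂ => (c : ℂ) ^ 2 / q.2 * (1 / (q.1 * (q.1 ^ 2 - 1)))) q :=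
    (continuousAt_const.div continuousAt_snd hτ).mul
      (continuousAt_const.div (by fun_prop) (mul_ne_zero h0 h3))
  have e3 : ContinuousAt (fun q : ℂ × ℂ => 2 * (c : ℂ) * (q.1 ^ 2 - x ^ 2) / (q.1 ^ 2 - 1) ^ 2) q :=
    ContinuousAt.div (by fun_prop) (by fun_prop) (pow_ne_zero 2 h3)
  refine continuousAt_pi.2 fun j => ?_
  fin_cases j
  · exact e1.sub e2
  · exact continuousAt_const.mul (e1.add e2)
  · exact e3

/-- Solution of the period problem: the Weierstrass map of `Σ_{k,x}` is well defined on `M_k`. -/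
theorem isSigma_sigmaMap {k : ℕ} (hk : 1 ≤ k) {x : ℝ}
    (hx : 0 < 4 * (k : ℝ) + 3 - 2 * x ^ 2 - x ^ 4) (C : ℝ) : IsSigma k x (sigmaMap k x C) := by
  refine isWeierstrassMap_of_hasDerivAt (fun p => modelForm x (constC k x) p.1 (p.2 / p.1))
    (continuousOn_sigmaMap hk hx C) ?_ ?_ ?_
  · rintro p ⟨hp, hP⟩
    have h0 : p.1 ≠ 0 := fun h => hP (Or.inl h)
    have h3 := sq_sub_one_ne_zero hp.2.1 hp.2.2
    have hτ0 : p.2 / p.1 ≠ 0 := by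
      rw [← norm_ne_zero_iff, norm_ratio h0 h3 (curveM_ratio_pow hp h0)]
      exact (Real.exp_pos _).ne'
    have hm : ContinuousAt (fun p : ℂ × ℂ => (p.1, p.2 / p.1)) p :=
      continuousAt_fst.prodMk (continuousAt_snd.div continuousAt_fst h0)
    exact (ContinuousAt.comp (f := fun p : ℂ × ℂ => (p.1, p.2 / p.1))
      (continuousAt_modelForm x (constC k x) (q := (p.1, p.2 / p.1)) h0 h3 hτ0) hm).continuousWithinAt
  · rintro p ⟨hp, hP⟩ j
    exact weierstrassForm_sigma hp (fun h => hP (Or.inl h)) (fun h => hP (Or.inr h)) j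
  · intro γ t hγ hM
    have hM' : ∀ᶠ s in 𝓝 t, ((γ s).1, (γ s).2) ∈ curveM k := hM.mono fun s hs => hs.1
    exact hasFDerivAt_sigmaMap hk hx C hγ.fst.hasFDerivAt hγ.snd hM'
      (fun h => hM.self_of_nhds.2 (Or.inl h))

/-! ### The limit surfaces -/

/-- The single valued part of the horizontal coordinate `X₁ - i X₂` of the limit surface, as a
function of `v = z²`; the full coordinate is obtained by adding `i Im u`. -/
def limitPart (x : ℝ) (v : ℂ) : ℂ :=
  ((Real.log ‖v‖ / 2 : ℝ) : ℂ) - ((1 - x ^ 2) / (v - 1) + (1 - x ^ 2) ^ 2 / (4 * (v - 1) ^ 2))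

/-- The limit surface, parametrized by `limitCurve`. -/
def limitMap (x : ℝ) (p : ℂ × ℂ) : E3 :=
  spacePoint (limitPart x (p.1 ^ 2) + I * (p.2.im : ℂ)) (height x 1 p.1)

section FDeriv

variable {E : Type*} [NormedAddCommGroup E] [NormedSpace ℝ E]

lemma hasFDerivAt_limitPart (x : ℝ) {v u : E → ℂ} {v' : E →L[ℝ] ℂ} {t : E}
    (hv : HasFDerivAt v v' t) (hu : HasFDerivAt u (logSlope (v t) • v') t)
    (h0 : v t ≠ 0) (h1 : v t ≠ 1) :
    HasFDerivAt (fun s => limitPart x (v s) + I * ((u s).im : ℂ)) (horizForm x 1 (v t) 1 v') t := by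
  have h1' : v t - 1 ≠ 0 := sub_ne_zero.2 h1
  have a1 := ofRealCLM.hasFDerivAt.comp t (((hasFDerivAt_log_norm hv h0).const_mul (1 / 2 : ℝ)))
  have a2 : HasDerivAt (fun v : ℂ => (1 - (x : ℂ) ^ 2) / (v - 1) + (1 - (x : ℂ) ^ 2) ^ 2 / (4 * (v - 1) ^ 2))
      (-(1 - (x : ℂ) ^ 2) / (v t - 1) ^ 2 - (1 - (x : ℂ) ^ 2) ^ 2 / (2 * (v t - 1) ^ 3)) (v t) := by
    have hs : HasDerivAt (fun v : ℂ => v - 1) 1 (v t) := (hasDerivAt_id _).sub_const 1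
    refine (((hasDerivAt_const _ (1 - (x : ℂ) ^ 2)).div hs h1').add
      ((hasDerivAt_const _ ((1 - (x : ℂ) ^ 2) ^ 2)).div ((hs.pow 2).const_mul 4)
        (mul_ne_zero (by norm_num) (pow_ne_zero 2 h1')))).congr_deriv ?_
    simp only [Pi.pow_apply]
    field_simp
    ring
  have a3 := (ofRealCLM.hasFDerivAt.comp t (imCLM.hasFDerivAt.comp t hu)).const_mul I
  have := ((a1.sub (hasFDerivAt_comp_of_hasDerivAt a2 hv)).add a3)
  have hfun : (fun s => limitPart x (v s) + I * ((u s).im : ℂ)) =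
      fun s => ((1 / 2 * Real.log ‖v s‖ : ℝ) : ℂ) - ((1 - (x : ℂ) ^ 2) / (v s - 1) +
        (1 - (x : ℂ) ^ 2) ^ 2 / (4 * (v s - 1) ^ 2)) + I * ((u s).im : ℂ) := by
    funext s; rw [limitPart]; push_cast; ring
  rw [hfun]
  refine this.congr_fderiv ?_
  ext h
  have hre : ∀ a : ℂ, ((a.re : ℝ) : ℂ) = (a + conj a) / 2 := fun a => by
    rw [add_conj]; push_cast; ring
  have him : ∀ a : ℂ, I * ((a.im : ℝ) : ℂ) = (a - conj a) / 2 := fun a => by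
    rw [sub_conj]; push_cast; ring
  simp only [add_apply, sub_apply, smul_apply, ContinuousLinearMap.comp_apply, smul_eq_mul, reCLM_apply,
    imCLM_apply, ofRealCLM_apply, horizForm, ContinuousLinearEquiv.coe_coe, conjCLE_apply]
  rw [him, ofReal_mul, hre]
  have e1 : etaCoeff x (v t) 1 = 1 / (2 * v t) / 2 + logSlope (v t) / 2 -
      (-(1 - (x : ℂ) ^ 2) / (v t - 1) ^ 2 - (1 - (x : ℂ) ^ 2) ^ 2 / (2 * (v t - 1) ^ 3)) := by
    rw [etaCoeff, logSlope]; field_simp; ring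
  have e2 : gaussCoeff 1 (v t) 1 = logSlope (v t) / 2 - 1 / (2 * v t) / 2 := by
    rw [gaussCoeff, logSlope]; push_cast; field_simp; ring
  rw [e1, e2]
  simp only [map_mul, map_sub, map_div₀, map_one, map_ofNat]
  push_cast
  field_simp
  ring

lemma hasFDerivAt_limitMap (x : ℝ) {z u : E → ℂ} {z' : E →L[ℝ] ℂ} {t : E}
    (hz : HasFDerivAt z z' t) (hu : DifferentiableAt ℝ u t)
    (hS : ∀ᶠ s in 𝓝 t, (z s, u s) ∈ limitCurve) :
    HasFDerivAt (fun s => limitMap x (z s, u s)) ((realForm (modelForm x 1 (z t) 1)).comp z') t := by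
  obtain ⟨h0, hexp⟩ := hS.self_of_nhds
  simp only at h0 hexp
  have h3 : z t ^ 2 - 1 ≠ 0 := by
    intro h; rw [h, zero_div] at hexp; exact exp_ne_zero _ hexp
  have h1 : z t ≠ 1 := by intro h; rw [h] at h3; norm_num at h3
  have h2 : z t ≠ -1 := by intro h; rw [h] at h3; norm_num at h3
  have hv : HasFDerivAt (fun s => z s ^ 2) ((2 * z t) • z') t :=
    hasFDerivAt_comp_of_hasDerivAt (by simpa using hasDerivAt_pow 2 (z t)) hz
  have hu' : HasFDerivAt u (logSlope (z t ^ 2) • ((2 * z t) • z')) t := by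
    refine hu.hasFDerivAt.congr_fderiv ?_
    have d1 := hasFDerivAt_comp_of_hasDerivAt (hasDerivAt_exp (u t)) hu.hasFDerivAt
    have d2 := hasFDerivAt_comp_of_hasDerivAt
      ((((hasDerivAt_id (z t)).pow 2).sub_const 1).div (hasDerivAt_id (z t)) h0) hz
    have huniq := d1.unique (d2.congr_of_eventuallyEq (hS.mono fun s hs => hs.2))
    ext s
    have hs := congrArg (fun L => L s) huniq
    simp only [smul_apply, smul_eq_mul, id, Pi.pow_apply, hexp] at hs
    rw [smul_smul, logSlope_sq h0 h3, smul_apply, smul_eq_mul]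
    field_simp at hs ⊢
    linear_combination hs
  have hH := hasFDerivAt_limitPart x hv hu' (pow_ne_zero 2 h0) (sub_ne_zero.1 h3)
  rw [horizForm, smul_smul, smul_smul] at hH
  refine (hasFDerivAt_spacePoint hH (hasFDerivAt_height x 1 hz h1 h2)).congr_fderiv ?_
  rw [modelForm, etaCoeff_sq, gaussCoeff_sq h0]
  push_cast
  simp

end FDeriv

lemma limitCurve_ne {p : ℂ × ℂ} (hp : p ∈ limitCurve) : p.1 ^ 2 - 1 ≠ 0 := by
  intro h
  have := hp.2
  rw [h, zero_div] at this
  exact exp_ne_zero _ this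

lemma limitCurve_ne_one {p : ℂ × ℂ} (hp : p ∈ limitCurve) : p.1 ≠ 1 ∧ p.1 ≠ -1 := by
  have := limitCurve_ne hp
  constructor <;> (intro h; rw [h] at this; norm_num at this)

lemma continuousOn_limitMap (x : ℝ) : ContinuousOn (limitMap x) limitCurve := by
  intro p hp
  refine ContinuousAt.continuousWithinAt ?_
  have h3 := limitCurve_ne hp
  have hh : ContinuousAt (fun p : ℂ × ℂ => height x 1 p.1) p :=
    (hasFDerivAt_height (E := ℂ × ℂ) x 1 (z := Prod.fst) hasFDerivAt_fst
      (limitCurve_ne_one hp).1 (limitCurve_ne_one hp).2).continuousAt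
  have hl : ContinuousAt (fun p : ℂ × ℂ => limitPart x (p.1 ^ 2)) p := by
    refine ContinuousAt.sub ?_ ?_
    · refine continuous_ofReal.continuousAt.comp (ContinuousAt.div_const ?_ 2)
      exact ContinuousAt.log (by fun_prop) (by simpa using hp.1)
    · have c1 : ContinuousAt (fun p : ℂ × ℂ => (1 - (x : ℂ) ^ 2) / (p.1 ^ 2 - 1)) p :=
        ContinuousAt.div (by fun_prop) (by fun_prop) h3
      have c2 : ContinuousAt (fun p : ℂ × ℂ => (1 - (x : ℂ) ^ 2) ^ 2 / (4 * (p.1 ^ 2 - 1) ^ 2)) p :=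
        ContinuousAt.div (by fun_prop) (by fun_prop) (mul_ne_zero (by norm_num) (pow_ne_zero 2 h3))
      exact c1.add c2
  have hu : ContinuousAt (fun p : ℂ × ℂ => I * (p.2.im : ℂ)) p := by fun_prop
  exact continuous_spacePoint.continuousAt.comp ((hl.add hu).prodMk hh)

lemma isWeierstrassMap_limitMap (x : ℝ) {P : Set (ℂ × ℂ)} {g η : ℂ × ℂ → ℂ}
    (hform : ∀ p ∈ limitCurve \ P, ∀ j, weierstrassForm g η j p = modelForm x 1 p.1 1 j) :
    IsWeierstrassMap limitCurve P g η (limitMap x) := by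
  refine isWeierstrassMap_of_hasDerivAt (fun p => modelForm x 1 p.1 1) (continuousOn_limitMap x)
    ?_ hform ?_
  · rintro p ⟨hp, -⟩
    exact (ContinuousAt.comp (f := fun p : ℂ × ℂ => (p.1, (1 : ℂ)))
      (continuousAt_modelForm x 1 (q := (p.1, 1)) hp.1 (limitCurve_ne (p := p) hp) one_ne_zero)
      (continuousAt_fst.prodMk continuousAt_const)).continuousWithinAt
  · intro γ t hγ hM
    have hM' : ∀ᶠ s in 𝓝 t, ((γ s).1, (γ s).2) ∈ limitCurve := hM.mono fun s hs => hs.1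
    exact hasFDerivAt_limitMap x hγ.fst.hasFDerivAt hγ.snd hM'

theorem isScherkEnneper_limitMap (x : ℝ) : IsScherkEnneper x (limitMap x) := by
  refine isWeierstrassMap_limitMap x ?_
  rintro p ⟨hp, hP⟩ j
  have h0 := hp.1
  have h3 := limitCurve_ne hp
  have hx : p.1 ^ 2 - (x : ℂ) ^ 2 ≠ 0 := sub_ne_zero.2 hP
  fin_cases j
  · simp only [weierstrassForm, modelForm, Fin.zero_eta, Matrix.cons_val_zero]
    push_cast; field_simp; 
  · simp only [weierstrassForm, modelForm, Fin.mk_one, Matrix.cons_val_one, Matrix.cons_val_zero]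
    push_cast; field_simp; 
  · simp only [weierstrassForm, modelForm, Fin.reduceFinMk, Matrix.cons_val]
    push_cast; field_simp; 

/-! ### Scherk's fifth surface -/

lemma norm_sub_one_sq (z : ℂ) : ‖z - 1‖ ^ 2 = ‖z‖ ^ 2 - 2 * z.re + 1 := by
  rw [← normSq_eq_norm_sq, ← normSq_eq_norm_sq, normSq_apply, normSq_apply]
  simp; ring

lemma norm_add_one_sq (z : ℂ) : ‖z + 1‖ ^ 2 = ‖z‖ ^ 2 + 2 * z.re + 1 := by
  rw [← normSq_eq_norm_sq, ← normSq_eq_norm_sq, normSq_apply, normSq_apply]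
  simp; ring

section Scherk

variable {x : ℝ}

lemma limitMap_of_sq_eq_one (hx : x ^ 2 = 1) (p : ℂ × ℂ) :
    limitMap x p = !₂[Real.log ‖p.1‖, -p.2.im, Real.log ‖p.1 - 1‖ - Real.log ‖p.1 + 1‖] := by
  have hx' : (x : ℂ) ^ 2 = 1 := by exact_mod_cast hx
  have e1 : limitPart x (p.1 ^ 2) + I * (p.2.im : ℂ) = (Real.log ‖p.1‖ : ℂ) + I * (p.2.im : ℂ) := by
    rw [limitPart, hx', norm_pow, Real.log_pow]
    simp
  have e2 : height x 1 p.1 = Real.log ‖p.1 - 1‖ - Real.log ‖p.1 + 1‖ := by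
    rw [height, hx]; ring
  rw [limitMap, e1, e2, spacePoint]
  ext i
  fin_cases i <;> simp

lemma limitCurve_exp_re {p : ℂ × ℂ} (hp : p ∈ limitCurve) :
    Real.exp p.2.re * Real.cos p.2.im = p.1.re - p.1.re / ‖p.1‖ ^ 2 ∧
    Real.exp p.2.re * Real.sin p.2.im = p.1.im + p.1.im / ‖p.1‖ ^ 2 ∧
    Real.exp p.2.re = ‖p.1 - 1‖ * ‖p.1 + 1‖ / ‖p.1‖ := by
  have h := hp.2
  have h0 := hp.1
  have h' : exp p.2 = p.1 - p.1⁻¹ := by rw [h]; field_simp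
  refine ⟨?_, ?_, ?_⟩
  · have := congrArg re h'
    rw [exp_re] at this
    rw [this, sub_re, inv_re, normSq_eq_norm_sq]
  · have := congrArg im h'
    rw [exp_im] at this
    rw [this, sub_im, inv_im, normSq_eq_norm_sq]
    ring
  · rw [← norm_exp, h, norm_div, ← norm_mul]
    congr 2
    ring

lemma limitMap_mapsTo_scherk (hx : x ^ 2 = 1) : MapsTo (limitMap x) limitCurve scherkFifth := by
  intro p hp
  obtain ⟨h1, -, h3⟩ := limitCurve_exp_re hp
  have hm := norm_sub_one_sq p.1
  have hq := norm_add_one_sq p.1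
  have hr : 0 < ‖p.1‖ := norm_pos_iff.2 hp.1
  have ha : 0 < ‖p.1 - 1‖ := norm_pos_iff.2 (sub_ne_zero.2 (limitCurve_ne_one hp).1)
  have hb : 0 < ‖p.1 + 1‖ := norm_pos_iff.2 (by
    rw [← sub_neg_eq_add]; exact sub_ne_zero.2 (limitCurve_ne_one hp).2)
  rw [limitMap_of_sq_eq_one hx]
  change Real.cos (-p.2.im) + Real.sinh (Real.log ‖p.1‖) *
    Real.sinh (Real.log ‖p.1 - 1‖ - Real.log ‖p.1 + 1‖) = 0
  rw [← Real.log_div ha.ne' hb.ne', Real.sinh_log hr, Real.sinh_log (by positivity), Real.cos_neg]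
  rw [h3] at h1
  set r := ‖p.1‖
  set a := ‖p.1 - 1‖
  set b := ‖p.1 + 1‖
  have hc : Real.cos p.2.im = (p.1.re - p.1.re / r ^ 2) * r / (a * b) := by
    rw [← h1]; field_simp
  rw [hc]
  field_simp
  have : b ^ 2 - a ^ 2 = 4 * p.1.re := by rw [hm, hq]; ring
  linear_combination (-(r ^ 2 - 1)) * this

lemma limitMap_injOn (hx : x ^ 2 = 1) : InjOn (limitMap x) limitCurve := by
  intro p hp p' hp' h
  rw [limitMap_of_sq_eq_one hx, limitMap_of_sq_eq_one hx] at h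
  have g0 : Real.log ‖p.1‖ = Real.log ‖p'.1‖ := congrArg (fun q : E3 => q 0) h
  have g1 : -p.2.im = -p'.2.im := congrArg (fun q : E3 => q 1) h
  have g2 : Real.log ‖p.1 - 1‖ - Real.log ‖p.1 + 1‖ = Real.log ‖p'.1 - 1‖ - Real.log ‖p'.1 + 1‖ :=
    congrArg (fun q : E3 => q 2) h
  have pos : ∀ p ∈ limitCurve, 0 < ‖p.1‖ ∧ 0 < ‖p.1 - 1‖ ∧ 0 < ‖p.1 + 1‖ := fun p hp =>
    ⟨norm_pos_iff.2 hp.1, norm_pos_iff.2 (sub_ne_zero.2 (limitCurve_ne_one hp).1),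
      norm_pos_iff.2 (by rw [← sub_neg_eq_add]; exact sub_ne_zero.2 (limitCurve_ne_one hp).2)⟩
  obtain ⟨hr, ha, hb⟩ := pos p hp
  obtain ⟨hr', ha', hb'⟩ := pos p' hp'
  have k0 : ‖p.1‖ = ‖p'.1‖ := Real.log_injOn_pos hr hr' g0
  have k2 : ‖p.1 - 1‖ / ‖p.1 + 1‖ = ‖p'.1 - 1‖ / ‖p'.1 + 1‖ := by
    refine Real.log_injOn_pos (div_pos ha hb) (div_pos ha' hb') ?_
    rw [Real.log_div ha.ne' hb.ne', Real.log_div ha'.ne' hb'.ne', g2]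
  have hre : p.1.re = p'.1.re := by
    have k3 : ‖p.1 - 1‖ ^ 2 * ‖p'.1 + 1‖ ^ 2 = ‖p'.1 - 1‖ ^ 2 * ‖p.1 + 1‖ ^ 2 := by
      rw [div_eq_div_iff hb.ne' hb'.ne'] at k2
      rw [← mul_pow, k2, mul_pow]
    rw [norm_sub_one_sq, norm_sub_one_sq, norm_add_one_sq, norm_add_one_sq, k0] at k3
    have : (p.1.re - p'.1.re) * (‖p'.1‖ ^ 2 + 1) = 0 := by linear_combination (-1 / 4) * k3
    have h2 : ‖p'.1‖ ^ 2 + 1 ≠ 0 := by positivity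
    exact sub_eq_zero.1 ((mul_eq_zero.1 this).resolve_right h2)
  have hab : ‖p.1 - 1‖ = ‖p'.1 - 1‖ := by
    refine (pow_left_inj₀ ha.le ha'.le two_ne_zero).1 ?_
    rw [norm_sub_one_sq, norm_sub_one_sq, k0, hre]
  have hab' : ‖p.1 + 1‖ = ‖p'.1 + 1‖ := by
    refine (pow_left_inj₀ hb.le hb'.le two_ne_zero).1 ?_
    rw [norm_add_one_sq, norm_add_one_sq, k0, hre]
  obtain ⟨-, h2, h3⟩ := limitCurve_exp_re hp
  obtain ⟨-, h2', h3'⟩ := limitCurve_exp_re hp'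
  have hE : Real.exp p.2.re = Real.exp p'.2.re := by rw [h3, h3', k0, hab, hab']
  have him : p.2.im = p'.2.im := neg_injective g1
  have hzim : p.1.im = p'.1.im := by
    have : p.1.im + p.1.im / ‖p'.1‖ ^ 2 = p'.1.im + p'.1.im / ‖p'.1‖ ^ 2 := by
      rw [← h2', ← hE, ← him, h2, k0]
    field_simp at this
    exact this
  exact Prod.ext (Complex.ext hre hzim) (Complex.ext (Real.exp_injective hE) him)

lemma scherk_surjOn (hx : x ^ 2 = 1) : SurjOn (limitMap x) limitCurve scherkFifth := by
  intro q hq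
  have hq' : Real.cos (q 1) + Real.sinh (q 0) * Real.sinh (q 2) = 0 := hq
  set a := q 0 with ha
  set b := q 1 with hb
  set c := q 2 with hc
  have hch : 0 < Real.cosh c := Real.cosh_pos c
  have hah : 0 < Real.cosh a := Real.cosh_pos a
  have hcc := Real.cosh_sq c
  have hcc' := Real.cosh_sq a
  have hsb := Real.sin_sq_add_cos_sq b
  -- `z = e^a (X + i Y)` with `X² + Y² = 1`
  set X := -(Real.sinh c * Real.cosh a) / Real.cosh c with hX
  set Y := -Real.sin b / Real.cosh c with hY
  have hXY : X ^ 2 + Y ^ 2 = 1 := by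
    rw [hX, hY]
    field_simp
    have hcos : Real.cos b = -(Real.sinh a * Real.sinh c) := by linarith
    rw [hcos] at hsb
    linear_combination hsb + Real.sinh c ^ 2 * hcc' - hcc
  set z : ℂ := ⟨Real.exp a * X, Real.exp a * Y⟩ with hz
  have hzn2 : ‖z‖ ^ 2 = Real.exp a ^ 2 := by
    rw [← normSq_eq_norm_sq, normSq_apply]
    simp only [hz]
    linear_combination Real.exp a ^ 2 * hXY
  have hzn : ‖z‖ = Real.exp a :=
    (pow_left_inj₀ (norm_nonneg _) (Real.exp_pos a).le two_ne_zero).1 hzn2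
  have hz0 : z ≠ 0 := norm_ne_zero_iff.1 (by rw [hzn]; exact (Real.exp_pos a).ne')
  set u : ℂ := ⟨Real.log (2 * Real.cosh a / Real.cosh c), -b⟩ with hu
  have hea : Real.exp a * Real.exp (-a) = 1 := by rw [← Real.exp_add]; simp
  have hup : 0 < 2 * Real.cosh a / Real.cosh c := by positivity
  have hs : (z, u) ∈ limitCurve := by
    refine ⟨hz0, ?_⟩
    have h' : (z ^ 2 - 1) / z = z - z⁻¹ := by field_simp
    change exp u = (z ^ 2 - 1) / z
    rw [h']
    have hcos : Real.cos b = -(Real.sinh a * Real.sinh c) := by linarith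
    have hinv : ∀ y : ℝ, Real.exp a * y / Real.exp a ^ 2 = Real.exp (-a) * y := by
      intro y; rw [Real.exp_neg]; field_simp
    refine Complex.ext ?_ ?_
    · rw [exp_re, sub_re, inv_re, normSq_eq_norm_sq, hzn2]
      simp only [hz, hu]
      rw [hinv, Real.exp_log hup, Real.cos_neg, hcos]
      have : Real.exp a * X - Real.exp (-a) * X = 2 * Real.sinh a * X := by
        rw [Real.sinh_eq]; ring
      rw [this, hX]
      field_simp
    · rw [exp_im, sub_im, inv_im, normSq_eq_norm_sq, hzn2]
      simp only [hz, hu]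
      rw [neg_div, hinv, Real.exp_log hup, Real.sin_neg]
      have : Real.exp a * Y - -(Real.exp (-a) * Y) = 2 * Real.cosh a * Y := by
        rw [Real.cosh_eq]; ring
      rw [this, hY]
      field_simp
  refine ⟨(z, u), hs, ?_⟩
  have hn1 : ‖z - 1‖ ^ 2 = 2 * Real.exp a * Real.cosh a * Real.exp c / Real.cosh c := by
    rw [norm_sub_one_sq, hzn2]
    simp only [hz]
    rw [hX, ← Real.cosh_add_sinh c]
    field_simp
    rw [Real.cosh_eq a]
    linear_combination (-Real.cosh c) * hea
  have hn2 : ‖z + 1‖ ^ 2 = 2 * Real.exp a * Real.cosh a * Real.exp (-c) / Real.cosh c := by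
    rw [norm_add_one_sq, hzn2]
    simp only [hz]
    rw [hX, ← Real.cosh_sub_sinh c]
    field_simp
    rw [Real.cosh_eq a]
    linear_combination (-Real.cosh c) * hea
  have hlog : Real.log ‖z - 1‖ - Real.log ‖z + 1‖ = c := by
    have e1 : 2 * Real.log ‖z - 1‖ = Real.log (2 * Real.exp a * Real.cosh a / Real.cosh c) + c := by
      have := Real.log_pow ‖z - 1‖ 2
      rw [hn1, mul_div_right_comm, Real.log_mul (by positivity) (Real.exp_pos _).ne',
        Real.log_exp] at this
      push_cast at this
      linarith
    have e2 : 2 * Real.log ‖z + 1‖ = Real.log (2 * Real.exp a * Real.cosh a / Real.cosh c) - c := by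
      have := Real.log_pow ‖z + 1‖ 2
      rw [hn2, mul_div_right_comm, Real.log_mul (by positivity) (Real.exp_pos _).ne',
        Real.log_exp] at this
      push_cast at this
      linarith
    linarith
  rw [limitMap_of_sq_eq_one hx]
  ext i
  fin_cases i
  · change Real.log ‖z‖ = q 0
    rw [hzn, Real.log_exp]
  · change -u.im = q 1
    simp [hu, hb]
  · exact hlog

theorem isScherkFifth_limitMap (hx : x ^ 2 = 1) : IsScherkFifth (limitMap x) := by
  refine ⟨isWeierstrassMap_limitMap x ?_, limitMap_mapsTo_scherk hx, limitMap_injOn hx,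
    scherk_surjOn hx⟩
  rintro p ⟨hp, -⟩ j
  have h0 := hp.1
  have h3 := limitCurve_ne hp
  have hx' : (x : ℂ) ^ 2 = 1 := by exact_mod_cast hx
  fin_cases j
  · simp only [weierstrassForm, modelForm, Fin.zero_eta, Matrix.cons_val_zero, hx']
    push_cast; field_simp; try ring
  · simp only [weierstrassForm, modelForm, Fin.mk_one, Matrix.cons_val_one, Matrix.cons_val_zero, hx']
    push_cast; field_simp; try ring
  · simp only [weierstrassForm, modelForm, Fin.reduceFinMk, Matrix.cons_val, hx']
    push_cast; field_simp; try ring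

end Scherk

/-! ### Asymptotics of the constants -/

section Asymptotics

variable {ι : Type*} {l : Filter ι} {a b e : ι → ℝ}

lemma tendsto_const_rpow_one (hb : Tendsto b l (𝓝 0)) (s : ℝ) (hs : 0 < s) :
    Tendsto (fun i => s ^ b i) l (𝓝 1) := by
  have := (Real.continuousAt_const_rpow (b := 0) hs.ne').tendsto.comp hb
  rwa [Real.rpow_zero] at this

lemma tendsto_mul_realIncBeta_half (ha : Tendsto a l (𝓝 0)) (ha0 : ∀ᶠ i in l, 0 < a i)
    (hb : Tendsto b l (𝓝 0)) :
    Tendsto (fun i => a i * realIncBeta (a i) (b i) (1 / 2)) l (𝓝 1) := by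
  have h1 := tendsto_const_rpow_one ha (1 / 2) (by norm_num)
  have hb' : Tendsto (fun i => |b i|) l (𝓝 0) := by simpa using hb.abs
  have h2 := tendsto_const_rpow_one hb' 2 (by norm_num)
  have h3 := tendsto_const_rpow_one (by simpa using hb'.neg : Tendsto (fun i => -|b i|) l (𝓝 0)) 2
    (by norm_num)
  have h12 := h1.mul h2
  have h13 := h1.mul h3
  rw [mul_one] at h12 h13
  refine tendsto_of_tendsto_of_tendsto_of_le_of_le' h13 h12 ?_ ?_
  · filter_upwards [ha0] with i hi
    have := mul_le_mul_of_nonneg_left (realIncBeta_half_bounds hi (b i)).1 hi.le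
    rwa [mul_div_cancel₀ _ hi.ne'] at this
  · filter_upwards [ha0] with i hi
    have := mul_le_mul_of_nonneg_left (realIncBeta_half_bounds hi (b i)).2 hi.le
    rwa [mul_div_cancel₀ _ hi.ne'] at this

lemma tendsto_mul_realIncBeta_half_zero (he : Tendsto e l (𝓝 0)) (he0 : ∀ᶠ i in l, 0 < e i)
    (ha : Tendsto a l (𝓝 1)) (hb : Tendsto b l (𝓝 (-1))) :
    Tendsto (fun i => e i * realIncBeta (a i) (b i) (1 / 2)) l (𝓝 0) := by
  have hu : Tendsto (fun i => e i * ((1 / 2) ^ a i * 2 ^ |b i| / a i)) l (𝓝 0) := by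
    have h1 := (Real.continuousAt_const_rpow (a := (1 / 2 : ℝ)) (b := 1) (by norm_num)).tendsto.comp ha
    have h2 := (Real.continuousAt_const_rpow (a := (2 : ℝ)) (b := |-1|) (by norm_num)).tendsto.comp hb.abs
    have := he.mul ((h1.mul h2).div ha one_ne_zero)
    simpa using this
  refine tendsto_of_tendsto_of_tendsto_of_le_of_le' tendsto_const_nhds hu ?_ ?_
  · filter_upwards [he0, ha.eventually_const_lt one_pos] with i hi hi'
    refine mul_nonneg hi.le (le_trans ?_ (realIncBeta_half_bounds hi' (b i)).1)
    positivity
  · filter_upwards [he0, ha.eventually_const_lt one_pos] with i hi hi'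
    exact mul_le_mul_of_nonneg_left (realIncBeta_half_bounds hi' (b i)).2 hi.le

lemma tendsto_mul_betaA (he : Tendsto e l (𝓝 0)) (he0 : ∀ᶠ i in l, 0 < e i) :
    Tendsto (fun i => e i * betaA (e i)) l (𝓝 1) := by
  have h1 := tendsto_mul_realIncBeta_half_zero he he0 (a := fun i => 1 - e i / 2)
    (b := fun i => e i - 1) (by simpa using (he.div_const 2).const_sub 1) (by simpa using he.sub_const 1)
  have h2 := tendsto_mul_realIncBeta_half he he0 (b := fun i => -(e i / 2))
    (by simpa using (he.div_const 2).neg)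
  have := h1.add h2
  rw [zero_add] at this
  refine this.congr fun i => ?_
  rw [betaA]; ring

lemma tendsto_mul_realIncBeta_two (he : Tendsto e l (𝓝 0)) (he0 : ∀ᶠ i in l, 0 < e i) :
    Tendsto (fun i => e i * realIncBeta (e i / 2) (-e i) (1 / 2)) l (𝓝 2) := by
  have h2 := (tendsto_mul_realIncBeta_half (a := fun i => e i / 2) (b := fun i => -e i)
    (by simpa using he.div_const 2) (he0.mono fun i hi => by linarith) (by simpa using he.neg)).const_mul 2
  rw [mul_one] at h2
  refine h2.congr fun i => ?_
  ring

lemma tendsto_mul_betaB (he : Tendsto e l (𝓝 0)) (he0 : ∀ᶠ i in l, 0 < e i) :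
    Tendsto (fun i => e i * betaB (e i)) l (𝓝 2) := by
  have h1 := tendsto_mul_realIncBeta_half_zero he he0 (a := fun i => 1 - e i)
    (b := fun i => e i / 2 - 1) (by simpa using he.const_sub 1) (by simpa using (he.div_const 2).sub_const 1)
  have := (tendsto_mul_realIncBeta_two he he0).add h1
  rw [add_zero] at this
  refine this.congr fun i => ?_
  rw [betaB]; ring

lemma tendsto_ratAlpha (he : Tendsto e l (𝓝 0)) (x : ℝ) :
    Tendsto (fun i => ratAlpha (e i) x) l (𝓝 (-((1 - x ^ 2) - (1 - x ^ 2) ^ 2 / 4))) := by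
  have := (tendsto_const_nhds (x := -((1 - x ^ 2) - (1 - x ^ 2) ^ 2 / 4))).div
    (he.const_sub 1) (by norm_num)
  rwa [sub_zero, div_one] at this

lemma tendsto_ratBeta (he : Tendsto e l (𝓝 0)) (x : ℝ) :
    Tendsto (fun i => ratBeta (e i) x) l (𝓝 (-(1 - x ^ 2) ^ 2 / 4)) := by
  have := (tendsto_const_nhds (x := -(1 - x ^ 2) ^ 2)).div
    ((he.const_sub 2).const_mul 2) (by norm_num)
  rwa [sub_zero, show (2 : ℝ) * 2 = 4 by norm_num] at this

lemma tendsto_kappa (he : Tendsto e l (𝓝 0)) (x : ℝ) :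
    Tendsto (fun i => kappa (e i) x) l (𝓝 1) := by
  have := (he.mul (tendsto_ratAlpha he x)).const_sub 1
  rwa [zero_mul, sub_zero] at this

end Asymptotics

lemma tendsto_inv1 : Tendsto inv1 atTop (𝓝 0) := tendsto_one_div_add_atTop_nhds_zero_nat

lemma eventually_admissible (x : ℝ) :
    ∀ᶠ k : ℕ in atTop, 1 ≤ k ∧ 0 < 4 * (k : ℝ) + 3 - 2 * x ^ 2 - x ^ 4 := by
  have h := tendsto_natCast_atTop_atTop (R := ℝ)
  filter_upwards [eventually_ge_atTop 1, h.eventually_gt_atTop (2 * x ^ 2 + x ^ 4)] with k h1 h2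
  have : (0 : ℝ) ≤ k := by positivity
  exact ⟨h1, by linarith⟩

lemma tendsto_constC_sq (x : ℝ) : Tendsto (fun k => constC k x ^ 2) atTop (𝓝 1) := by
  have hA := tendsto_mul_betaA tendsto_inv1 (Eventually.of_forall inv1_pos)
  have hB := tendsto_mul_betaB tendsto_inv1 (Eventually.of_forall inv1_pos)
  have := (tendsto_kappa tendsto_inv1 x).mul ((hA.const_mul 2).div hB two_ne_zero)
  have h1 : (1 : ℝ) * (2 * 1 / 2) = 1 := by norm_num
  rw [h1] at this
  refine this.congr' ?_
  filter_upwards [eventually_admissible x] with k hk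
  rw [constC_sq hk.1 hk.2]
  have := (inv1_pos k).ne'
  simp only [Pi.div_apply]
  rw [← mul_div_mul_left (2 * betaA (inv1 k)) _ this]
  congr 2
  ring

lemma tendsto_constC (x : ℝ) : Tendsto (fun k => constC k x) atTop (𝓝 1) := by
  have := (tendsto_constC_sq x).sqrt
  rw [Real.sqrt_one] at this
  refine this.congr fun k => Real.sqrt_sq ?_
  exact mul_nonneg (Real.sqrt_nonneg _) (Real.sqrt_nonneg _)

/-- The real value at `v = 1/2` of the horizontal coordinate, for positive `τ`. -/
def halfValue (e x c2 : ℝ) : ℝ :=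
  Real.exp (e * logModulus (1 / 2)) * (-ratAlpha e x + 2 * ratBeta e x + kappa e x / 2 *
    -((1 / 2) ^ (-(e / 2)) * realIncBeta (1 - e / 2) (e - 1) (1 / 2))) +
  c2 / Real.exp (e * logModulus (1 / 2)) *
    (1 / (2 * e) + (1 / 2) ^ (e / 2) * realIncBeta (e / 2) (-e) (1 / 2) / 4)

lemma horiz_half (e x c2 : ℝ) :
    horiz e x c2 (1 / 2) (Real.exp (e * logModulus (1 / 2))) = halfValue e x c2 := by
  rw [horiz, if_pos half_mem_doublySlit.2, primEta, primGauss, ratPart, solP0_half, solQ0_half]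
  have h : ∀ r s : ℝ, (r : ℂ) - conj (s : ℂ) = ((r - s : ℝ) : ℂ) := fun r s => by
    rw [conj_ofReal]; push_cast; rfl
  have e1 : (1 / 2 : ℂ) * (ratAlpha e x / (1 / 2 - 1) + ratBeta e x / (1 / 2 - 1) ^ 2) =
      ((-ratAlpha e x + 2 * ratBeta e x : ℝ) : ℂ) := by
    push_cast; ring
  rw [e1]
  have e2 := h (Real.exp (e * logModulus (1 / 2)) * (-ratAlpha e x + 2 * ratBeta e x + kappa e x / 2 *
    -((1 / 2) ^ (-(e / 2)) * realIncBeta (1 - e / 2) (e - 1) (1 / 2))))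
    (-(c2 / Real.exp (e * logModulus (1 / 2))) *
    (1 / (2 * e) + (1 / 2) ^ (e / 2) * realIncBeta (e / 2) (-e) (1 / 2) / 4))
  rw [neg_mul, sub_neg_eq_add] at e2
  rw [halfValue, ← e2]
  push_cast
  ring_nf

/-- The translation in the direction of `x₁` that normalizes `Σ_{k,x}`: with it the horizontal
coordinates of `Σ_{k,x}` and of the limit surface agree at the point where `z² = 1/2` and `u` is
real. -/
def shift (x : ℝ) (k : ℕ) : ℝ :=
  halfValue (inv1 k) x (constC k x ^ 2) -
    (Real.log (1 / 2) / 2 + 2 * (1 - x ^ 2) - (1 - x ^ 2) ^ 2)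

lemma limitPart_half (x : ℝ) : limitPart x (1 / 2) =
    ((Real.log (1 / 2) / 2 + 2 * (1 - x ^ 2) - (1 - x ^ 2) ^ 2 : ℝ) : ℂ) := by
  have : ‖(1 / 2 : ℂ)‖ = 1 / 2 := by simp
  rw [limitPart, this]
  push_cast
  ring

/-- The axis of rotation of the translated surfaces recedes like `k + 1`: the contributions `1/2` of
the elementary term and `1/2` of the beta integral of `Q` add up to `1`. -/
lemma tendsto_mul_shift (x : ℝ) : Tendsto (fun k => inv1 k * shift x k) atTop (𝓝 1) := by
  have he := tendsto_inv1
  have he0 : ∀ᶠ k in atTop, 0 < inv1 k := Eventually.of_forall inv1_pos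
  have hm : Tendsto (fun k => Real.exp (inv1 k * logModulus (1 / 2))) atTop (𝓝 1) := by
    have := (Real.continuous_exp.tendsto _).comp (he.mul_const (logModulus (1 / 2)))
    rwa [zero_mul, Real.exp_zero] at this
  have hp : Tendsto (fun k => (1 / 2 : ℝ) ^ (-(inv1 k / 2))) atTop (𝓝 1) :=
    tendsto_const_rpow_one (by simpa using (he.div_const 2).neg) _ (by norm_num)
  have hp' : Tendsto (fun k => (1 / 2 : ℝ) ^ (inv1 k / 2)) atTop (𝓝 1) :=
    tendsto_const_rpow_one (by simpa using (he.div_const 2)) _ (by norm_num)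
  have h1 := tendsto_mul_realIncBeta_half_zero he he0 (a := fun i => 1 - inv1 i / 2)
    (b := fun i => inv1 i - 1) (by simpa using (he.div_const 2).const_sub 1) (by simpa using he.sub_const 1)
  have h2 := tendsto_mul_realIncBeta_two he he0
  have t1 := hm.mul (((he.mul (tendsto_ratAlpha he x)).neg.add
    ((he.mul (tendsto_ratBeta he x)).const_mul 2)).add
    (((tendsto_kappa he x).div_const 2).mul (hp.mul h1).neg))
  have t2 := ((tendsto_constC_sq x).div hm one_ne_zero).mul
    ((tendsto_const_nhds (x := (1 / 2 : ℝ))).add ((hp'.mul h2).div_const 4))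
  have t3 := he.mul_const (Real.log (1 / 2) / 2 + 2 * (1 - x ^ 2) - (1 - x ^ 2) ^ 2)
  have := (t1.add t2).sub t3
  have hlim : (1 * (-(0 * -((1 - x ^ 2) - (1 - x ^ 2) ^ 2 / 4)) +
      2 * (0 * (-(1 - x ^ 2) ^ 2 / 4)) + 1 / 2 * -(1 * 0)) + 1 / 1 * (1 / 2 + 1 * 2 / 4) -
      0 * (Real.log (1 / 2) / 2 + 2 * (1 - x ^ 2) - (1 - x ^ 2) ^ 2) : ℝ) = 1 := by ring
  rw [hlim] at this
  refine this.congr fun k => ?_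
  have hk := (inv1_pos k).ne'
  rw [shift, halfValue]
  simp only [Pi.div_apply]
  field_simp

/-! ### Convergence of the horizontal coordinate -/

/-- A family depending continuously on a convergent parameter converges locally uniformly. -/
lemma tendstoLocallyUniformlyOn_of_continuousAt {A α F : Type*} [TopologicalSpace A]
    [TopologicalSpace α] [PseudoMetricSpace F] {f : A × α → F} {p : ℕ → A} {p₀ : A}
    (hp : Tendsto p atTop (𝓝 p₀)) {s : Set α} (hf : ∀ z ∈ s, ContinuousAt f (p₀, z)) :
    TendstoLocallyUniformlyOn (fun k z => f (p k, z)) (fun z => f (p₀, z)) atTop s := by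
  rw [Metric.tendstoLocallyUniformlyOn_iff]
  intro ε hε z hz
  have h := Metric.tendsto_nhds.1 (hf z hz) (ε / 2) (by positivity)
  rw [nhds_prod_eq] at h
  obtain ⟨pa, ha, pb, hb, hab⟩ := eventually_prod_iff.1 h
  refine ⟨{y | pb y}, mem_nhdsWithin_of_mem_nhds hb, ?_⟩
  filter_upwards [hp.eventually ha] with k hk y hy
  have h1 := hab hk hy
  have h2 := hab ha.self_of_nhds hy
  calc dist (f (p₀, y)) (f (p k, y)) ≤ dist (f (p₀, y)) (f (p₀, z)) + dist (f (p k, y)) (f (p₀, z)) :=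
        dist_triangle_right _ _ _
    _ < ε := by linarith

/-- The mean value inequality: on a ball, convergence at one point and uniform convergence of the
differentials imply uniform convergence. -/
lemma tendstoUniformlyOn_ball_of_fderiv {F : Type*} [NormedAddCommGroup F] [NormedSpace ℝ F]
    {f : ℕ → ℂ → F} {f' : ℕ → ℂ → ℂ →L[ℝ] F} {z₀ z₁ : ℂ} {r : ℝ} (hz : z₁ ∈ Metric.ball z₀ r)
    (hf : ∀ᶠ k in atTop, ∀ z ∈ Metric.ball z₀ r, HasFDerivAt (f k) (f' k z) z)
    (hf' : TendstoUniformlyOn f' 0 atTop (Metric.ball z₀ r))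
    (h₁ : Tendsto (fun k => f k z₁) atTop (𝓝 0)) :
    TendstoUniformlyOn f 0 atTop (Metric.ball z₀ r) := by
  have hr : 0 < r := lt_of_le_of_lt dist_nonneg hz
  rw [Metric.tendstoUniformlyOn_iff] at hf' ⊢
  intro ε hε
  have hε' : 0 < ε / (4 * r) := by positivity
  filter_upwards [hf, hf' _ hε', Metric.tendsto_nhds.1 h₁ (ε / 2) (by positivity)] with k hk hk' hk1 z hzb
  have hle : ∀ y ∈ Metric.ball z₀ r, ‖f' k y‖ ≤ ε / (4 * r) := fun y hy => by
    have := hk' y hy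
    rw [Pi.zero_apply, dist_zero_left] at this
    exact this.le
  have := (convex_ball z₀ r).norm_image_sub_le_of_norm_hasFDerivWithin_le
    (fun y hy => (hk y hy).hasFDerivWithinAt) hle hz hzb
  have hd : ‖z - z₁‖ < 2 * r := by
    rw [← dist_eq_norm]
    calc dist z z₁ ≤ dist z z₀ + dist z₁ z₀ := dist_triangle_right _ _ _
      _ < 2 * r := by
        have h1 := Metric.mem_ball.1 hz
        have h2 := Metric.mem_ball.1 hzb
        linarith
  rw [Pi.zero_apply, dist_zero_left]
  rw [dist_zero_right] at hk1
  have h3 : ε / (4 * r) * ‖z - z₁‖ ≤ ε / 2 := by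
    calc ε / (4 * r) * ‖z - z₁‖ ≤ ε / (4 * r) * (2 * r) := by gcongr
      _ = ε / 2 := by field_simp; norm_num
  calc ‖f k z‖ ≤ ‖f k z - f k z₁‖ + ‖f k z₁‖ := by simpa using norm_add_le (f k z - f k z₁) (f k z₁)
    _ < ε := by linarith

/-- Rotation by a small angle `e s` about a point at distance about `1 / e` is close to the
translation by `s`, uniformly for bounded `s`. -/
lemma eventually_rotation_close {e C : ℕ → ℝ} (he : Tendsto e atTop (𝓝 0))
    (hC : Tendsto (fun k => e k * C k) atTop (𝓝 1)) (M : ℝ) {ε : ℝ} (hε : 0 < ε) :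
    ∀ᶠ k in atTop, ∀ s : ℝ, |s| ≤ M → ‖(exp (I * (e k * s : ℝ)) - 1) * (C k : ℂ) - I * s‖ ≤ ε := by
  have h1 : Tendsto (fun k => |e k| * |M|) atTop (𝓝 0) := by
    simpa using he.abs.mul_const |M|
  have h2 : Tendsto (fun k => |e k * C k| * |e k| * M ^ 2 + |M| * |e k * C k - 1|) atTop (𝓝 0) := by
    have := ((hC.abs.mul he.abs).mul_const (M ^ 2)).add ((hC.sub_const 1).abs.const_mul |M|)
    simpa using this
  filter_upwards [h1.eventually_le_const one_pos, h2.eventually_le_const hε] with k hk hk' s hs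
  have hs' : |s| ≤ |M| := hs.trans (le_abs_self M)
  have hn : ‖I * ((e k * s : ℝ) : ℂ)‖ = |e k| * |s| := by
    rw [norm_mul, norm_I, one_mul, norm_real, Real.norm_eq_abs, abs_mul]
  have hle : ‖I * ((e k * s : ℝ) : ℂ)‖ ≤ 1 := by
    rw [hn]
    exact (mul_le_mul_of_nonneg_left hs' (abs_nonneg _)).trans hk
  have h3 := norm_exp_sub_one_sub_id_le hle
  have e1 : (exp (I * (e k * s : ℝ)) - 1) * (C k : ℂ) - I * s =
      (exp (I * (e k * s : ℝ)) - 1 - I * (e k * s : ℝ)) * (C k : ℂ) +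
        I * s * ((e k * C k - 1 : ℝ) : ℂ) := by
    push_cast; ring
  rw [e1]
  refine (norm_add_le _ _).trans (le_trans ?_ hk')
  refine add_le_add ?_ ?_
  · rw [norm_mul, norm_real, Real.norm_eq_abs]
    refine (mul_le_mul_of_nonneg_right h3 (abs_nonneg _)).trans ?_
    rw [hn, abs_mul]
    have hsq : |s| ^ 2 ≤ M ^ 2 := by
      rw [← sq_abs M]; exact pow_le_pow_left₀ (abs_nonneg s) hs' 2
    have : (|e k| * |s|) ^ 2 * |C k| = |e k| * |C k| * |e k| * |s| ^ 2 := by ring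
    rw [this]
    gcongr
  · rw [norm_mul, norm_mul, norm_I, one_mul, norm_real, norm_real, Real.norm_eq_abs,
      Real.norm_eq_abs]
    gcongr

/-- The horizontal coordinate for real `u`, that is, for `τ = |τ|`, translated by `-shift`: a single
valued function of `v`. -/
def reducedHoriz (x : ℝ) (k : ℕ) (v : ℂ) : ℂ :=
  horiz (inv1 k) x (constC k x ^ 2) v (Real.exp (inv1 k * logModulus v)) - shift x k

/-- Increasing `Im u` rotates the translated surface about the vertical axis with
horizontal coordinate `-shift`. -/
lemma horiz_sub_shift (x : ℝ) (k : ℕ) {v u : ℂ} (hu : u.re = logModulus v) :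
    horiz (inv1 k) x (constC k x ^ 2) v (exp (inv1 k * u)) - shift x k =
      exp (I * (inv1 k * u.im : ℝ)) * reducedHoriz x k v +
        (exp (I * (inv1 k * u.im : ℝ)) - 1) * shift x k := by
  have h : exp (inv1 k * u) = exp (I * (inv1 k * u.im : ℝ)) * (Real.exp (inv1 k * logModulus v) : ℂ) := by
    rw [ofReal_exp, ← exp_add, ← hu]
    congr 1
    conv_lhs => rw [← re_add_im u]
    push_cast
    ring
  rw [h, horiz_rotate _ _ _ _ _ _ (by rw [mul_comm, norm_exp_ofReal_mul_I]), reducedHoriz]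
  ring

lemma tendsto_horiz_of_tendsto {x : ℝ} {v u : ℂ} (hu : u.re = logModulus v)
    (h : Tendsto (fun k => reducedHoriz x k v) atTop (𝓝 (limitPart x v))) :
    Tendsto (fun k => horiz (inv1 k) x (constC k x ^ 2) v (exp (inv1 k * u)) - shift x k) atTop
      (𝓝 (limitPart x v + I * (u.im : ℂ))) := by
  have h1 : Tendsto (fun k => exp (I * (inv1 k * u.im : ℝ))) atTop (𝓝 1) := by
    have hc : Continuous fun t : ℝ => exp (I * (t * u.im : ℝ)) := by fun_prop
    have := (hc.tendsto 0).comp tendsto_inv1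
    simpa [Function.comp_def] using this
  have h2 : Tendsto (fun k => (exp (I * (inv1 k * u.im : ℝ)) - 1) * (shift x k : ℂ)) atTop
      (𝓝 (I * (u.im : ℂ))) := by
    rw [Metric.tendsto_nhds]
    intro ε hε
    filter_upwards [eventually_rotation_close tendsto_inv1 (tendsto_mul_shift x) |u.im|
      (half_pos hε)] with k hk
    rw [dist_eq_norm]
    linarith [hk u.im le_rfl]
  have := (h1.mul h).add h2
  rw [one_mul] at this
  exact this.congr fun k => (horiz_sub_shift x k hu).symm

/-- Near each point of `ℂ \ {0, 1}` there is a branch of `u`. -/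
lemma exists_localBranch {v₀ : ℂ} (h0 : v₀ ≠ 0) (h1 : v₀ ≠ 1) :
    ∃ r > 0, ∃ u : ℂ → ℂ, (∀ v ∈ Metric.ball v₀ r, v ≠ 0 ∧ v ≠ 1 ∧ HasDerivAt u (logSlope v) v ∧
      (u v).re = logModulus v) := by
  have h1' : v₀ - 1 ≠ 0 := sub_ne_zero.2 h1
  set r := min ‖v₀‖ ‖v₀ - 1‖ with hr
  have hrpos : 0 < r := lt_min (norm_pos_iff.2 h0) (norm_pos_iff.2 h1')
  refine ⟨r, hrpos, fun v => Complex.log ((v - 1) / (v₀ - 1)) - Complex.log (v / v₀) / 2 +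
    (logModulus v₀ : ℂ), fun v hv => ?_⟩
  have hv' : ‖v - v₀‖ < r := by rwa [← dist_eq_norm]
  have s0 : v / v₀ ∈ slitPlane := by
    have : ‖v / v₀ - 1‖ < 1 := by
      have : v / v₀ - 1 = (v - v₀) / v₀ := by field_simp
      rw [this, norm_div, div_lt_one (norm_pos_iff.2 h0)]
      exact hv'.trans_le (min_le_left _ _)
    simpa using mem_slitPlane_of_norm_lt_one this
  have s1 : (v - 1) / (v₀ - 1) ∈ slitPlane := by
    have : ‖(v - 1) / (v₀ - 1) - 1‖ < 1 := by
      have : (v - 1) / (v₀ - 1) - 1 = (v - v₀) / (v₀ - 1) := by field_simp; ring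
      rw [this, norm_div, div_lt_one (norm_pos_iff.2 h1')]
      exact hv'.trans_le (min_le_right _ _)
    simpa using mem_slitPlane_of_norm_lt_one this
  have hv0 : v ≠ 0 := by rintro rfl; simp at s0
  have hv1 : v ≠ 1 := by rintro rfl; simp at s1
  have hv1' : v - 1 ≠ 0 := sub_ne_zero.2 hv1
  refine ⟨hv0, hv1, ?_, ?_⟩
  · have d0 := ((hasDerivAt_id v).div_const v₀).clog s0
    have d1 := (((hasDerivAt_id v).sub_const 1).div_const (v₀ - 1)).clog s1
    refine ((d1.sub (d0.div_const 2)).add_const (logModulus v₀ : ℂ)).congr_deriv ?_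
    simp only [id, logSlope]
    field_simp
  · have n0 : ‖v‖ ≠ 0 := norm_ne_zero_iff.2 hv0
    have n1 : ‖v - 1‖ ≠ 0 := norm_ne_zero_iff.2 hv1'
    have n0' : ‖v₀‖ ≠ 0 := norm_ne_zero_iff.2 h0
    have n1' : ‖v₀ - 1‖ ≠ 0 := norm_ne_zero_iff.2 h1'
    have : (Complex.log (v / v₀) / 2).re = Real.log ‖v / v₀‖ / 2 := by
      rw [← log_re]; simp
    rw [add_re, sub_re, this, log_re, ofReal_re, norm_div, norm_div, Real.log_div n0 n0',
      Real.log_div n1 n1', logModulus, logModulus]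
    ring

/-- Local form of the convergence: convergence at one point spreads to a ball. -/
lemma exists_ball_tendstoUniformlyOn (x : ℝ) {v₀ : ℂ} (h0 : v₀ ≠ 0) (h1 : v₀ ≠ 1) :
    ∃ r > 0, (∀ v ∈ Metric.ball v₀ r, v ≠ 0 ∧ v ≠ 1) ∧ ∀ v₁ ∈ Metric.ball v₀ r,
      Tendsto (fun k => reducedHoriz x k v₁) atTop (𝓝 (limitPart x v₁)) →
      TendstoUniformlyOn (reducedHoriz x) (limitPart x) atTop (Metric.ball v₀ r) := by
  obtain ⟨R, hR, u, hu⟩ := exists_localBranch h0 h1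
  set r := R / 2
  have hr : 0 < r := by positivity
  have hsub : Metric.closedBall v₀ r ⊆ Metric.ball v₀ R :=
    Metric.closedBall_subset_ball (by simp only [r]; linarith)
  have hsub' : Metric.ball v₀ r ⊆ Metric.ball v₀ R := Metric.ball_subset_closedBall.trans hsub
  refine ⟨r, hr, fun v hv => ⟨(hu v (hsub' hv)).1, (hu v (hsub' hv)).2.1⟩, fun v₁ hv₁ hlim => ?_⟩
  have huc : ∀ v ∈ Metric.ball v₀ R, ContinuousAt u v := fun v hv => (hu v hv).2.2.1.continuousAt
  -- the difference of the two horizontal coordinates along the local branch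
  set G : ℕ → ℂ → ℂ := fun k v => (horiz (inv1 k) x (constC k x ^ 2) v (exp (inv1 k * u v)) - shift x k) -
    (limitPart x v + I * ((u v).im : ℂ)) with hG
  set G' : ℕ → ℂ → ℂ →L[ℝ] ℂ := fun k v =>
    horizForm x (constC k x ^ 2) v (exp (inv1 k * u v)) (ContinuousLinearMap.id ℝ ℂ) -
      horizForm x 1 v 1 (ContinuousLinearMap.id ℝ ℂ) with hG'
  have hder : ∀ᶠ k in atTop, ∀ v ∈ Metric.ball v₀ r, HasFDerivAt (G k) (G' k v) v := by
    filter_upwards [eventually_admissible x] with k hk v hv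
    obtain ⟨hv0, hv1, hud, hure⟩ := hu v (hsub' hv)
    have hid : HasFDerivAt (fun v : ℂ => v) (ContinuousLinearMap.id ℝ ℂ) v := hasFDerivAt_id v
    have hτ := hasFDerivAt_comp_of_hasDerivAt (hud.const_mul (inv1 k : ℂ)).cexp hid
    have hmod : ∀ᶠ s in 𝓝 v, ‖exp (inv1 k * u s)‖ = Real.exp (inv1 k * logModulus s) := by
      filter_upwards [Metric.isOpen_ball.mem_nhds (hsub' hv)] with s hs
      rw [norm_exp, re_ofReal_mul, (hu s hs).2.2.2]
    refine ((hasFDerivAt_horiz (inv1_pos k) (inv1_lt_one hk.1) (constC_period hk.1 hk.2) hid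
      (hτ.congr_fderiv ?_) hmod hv0 hv1).sub_const _).sub
      (hasFDerivAt_limitPart x hid (hasFDerivAt_comp_of_hasDerivAt hud hid) hv0 hv1)
    congr 1
    ring
  have hder' : TendstoUniformlyOn G' 0 atTop (Metric.ball v₀ r) := by
    have hp : Tendsto (fun k => (inv1 k, constC k x)) atTop (𝓝 (0, 1)) :=
      tendsto_inv1.prodMk_nhds (tendsto_constC x)
    have hloc : TendstoLocallyUniformlyOn (fun k v => (etaCoeff x v (exp (inv1 k * u v)),
        gaussCoeff (constC k x ^ 2) v (exp (inv1 k * u v))))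
        (fun v => (etaCoeff x v 1, gaussCoeff 1 v 1)) atTop (Metric.closedBall v₀ r) := by
      have := tendstoLocallyUniformlyOn_of_continuousAt hp (s := Metric.closedBall v₀ r)
        (f := fun q : (ℝ × ℝ) × ℂ => (etaCoeff x q.2 (exp (q.1.1 * u q.2)),
          gaussCoeff (q.1.2 ^ 2) q.2 (exp (q.1.1 * u q.2)))) (fun v hv => ?_)
      · simpa using this
      · obtain ⟨hv0, hv1, -, -⟩ := hu v (hsub hv)
        have hv1' : v - 1 ≠ 0 := sub_ne_zero.2 hv1
        have hcu : ContinuousAt (fun q : (ℝ × ℝ) × ℂ => u q.2) ((0, 1), v) :=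
          ContinuousAt.comp (f := Prod.snd) (huc v (hsub hv)) continuousAt_snd
        have hτ : ContinuousAt (fun q : (ℝ × ℝ) × ℂ => exp (q.1.1 * u q.2)) ((0, 1), v) := by
          refine ContinuousAt.cexp (ContinuousAt.mul ?_ hcu)
          fun_prop
        refine ContinuousAt.prodMk ?_ ?_
        · unfold etaCoeff
          exact (hτ.mul (by fun_prop)).div (by fun_prop)
            (mul_ne_zero two_ne_zero (pow_ne_zero 3 hv1'))
        · unfold gaussCoeff
          refine ContinuousAt.div (by fun_prop) ?_ ?_
          · exact ((continuousAt_const.mul hτ).mul continuousAt_snd).mul (by fun_prop)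
          · exact mul_ne_zero (mul_ne_zero (mul_ne_zero two_ne_zero (exp_ne_zero _)) hv0) hv1'
    have hunif := ((tendstoLocallyUniformlyOn_iff_tendstoUniformlyOn_of_compact
      (isCompact_closedBall v₀ r)).1 hloc).mono Metric.ball_subset_closedBall
    rw [Metric.tendstoUniformlyOn_iff] at hunif ⊢
    intro ε hε
    filter_upwards [hunif (ε / 2) (by positivity)] with k hk v hv
    have := hk v hv
    rw [Prod.dist_eq, max_lt_iff, dist_eq_norm, dist_eq_norm] at this
    rw [Pi.zero_apply, dist_zero_left]
    have hb : ‖G' k v‖ ≤ ‖etaCoeff x v (exp (inv1 k * u v)) - etaCoeff x v 1‖ +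
        ‖gaussCoeff (constC k x ^ 2) v (exp (inv1 k * u v)) - gaussCoeff 1 v 1‖ := by
      refine ContinuousLinearMap.opNorm_le_bound _ (by positivity) fun h => ?_
      have : G' k v h = (etaCoeff x v (exp (inv1 k * u v)) - etaCoeff x v 1) * h -
          conj ((gaussCoeff (constC k x ^ 2) v (exp (inv1 k * u v)) - gaussCoeff 1 v 1) * h) := by
        simp [hG', horizForm]; ring
      rw [this, add_mul, ← norm_mul, ← norm_mul]
      refine (norm_sub_le _ _).trans ?_
      rw [norm_conj]
    rw [norm_sub_rev, norm_sub_rev (gaussCoeff 1 v 1)] at this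
    linarith [this.1, this.2]
  have hG1 : Tendsto (fun k => G k v₁) atTop (𝓝 0) := by
    have := (tendsto_horiz_of_tendsto (hu v₁ (hsub' hv₁)).2.2.2 hlim).sub_const
      (limitPart x v₁ + I * ((u v₁).im : ℂ))
    rwa [sub_self] at this
  have hGu := tendstoUniformlyOn_ball_of_fderiv hv₁ hder hder' hG1
  -- undo the rotation by the bounded angle `Im u`
  obtain ⟨M, hM⟩ := (isCompact_closedBall v₀ r).exists_bound_of_continuousOn
    (f := u) (fun v hv => (huc v (hsub hv)).continuousWithinAt)
  obtain ⟨N, hN⟩ := (isCompact_closedBall v₀ r).exists_bound_of_continuousOn (f := limitPart x)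
    (fun v hv => by
      obtain ⟨hv0, hv1, hud, -⟩ := hu v (hsub hv)
      have hid : HasFDerivAt (fun v : ℂ => v) (ContinuousLinearMap.id ℝ ℂ) v := hasFDerivAt_id v
      have c1 := (hasFDerivAt_limitPart x hid (hasFDerivAt_comp_of_hasDerivAt hud hid) hv0 hv1).continuousAt
      have c2 : ContinuousAt (fun v => I * ((u v).im : ℂ)) v :=
        continuousAt_const.mul (continuous_ofReal.continuousAt.comp
          (continuous_im.continuousAt.comp (huc v (hsub hv))))
      have := c1.sub c2
      simp only [Pi.sub_def, add_sub_cancel_right] at this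
      exact this.continuousWithinAt)
  rw [Metric.tendstoUniformlyOn_iff] at hGu ⊢
  intro ε hε
  have hrot := eventually_rotation_close tendsto_inv1 (tendsto_mul_shift x) M
    (ε := ε / 4) (by positivity)
  have hrot' := eventually_rotation_close (C := fun k => 1 / inv1 k) tendsto_inv1
    (by refine tendsto_const_nhds.congr fun k => ?_
        have := (inv1_pos k).ne'; field_simp) M one_pos
  have hsmall : Tendsto (fun k => inv1 k * ((1 + M) * N)) atTop (𝓝 0) := by
    simpa using tendsto_inv1.mul_const ((1 + M) * N)
  filter_upwards [hGu (ε / 4) (by positivity), hrot, hrot',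
    hsmall.eventually_le_const (show 0 < ε / 4 by positivity)] with k k1 k2 k3 k4 v hv
  have hvc := Metric.ball_subset_closedBall hv
  have hs : |(u v).im| ≤ M := (abs_im_le_norm _).trans (hM v hvc)
  have k1' := k1 v hv
  rw [Pi.zero_apply, dist_zero_left] at k1'
  have k2' := k2 _ hs
  have k3' := k3 _ hs
  set ζ := exp (I * (inv1 k * (u v).im : ℝ)) with hζ
  have hζn : ‖ζ‖ = 1 := by rw [hζ, mul_comm, norm_exp_ofReal_mul_I]
  have hid : ζ * (limitPart x v - reducedHoriz x k v) =
      ((ζ - 1) * shift x k - I * ((u v).im : ℂ)) + (ζ - 1) * limitPart x v - G k v := by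
    simp only [hG]
    rw [horiz_sub_shift x k (hu v (hsub' hv)).2.2.2, ← hζ]
    ring
  have hpos := inv1_pos k
  have hζ1 : ‖ζ - 1‖ ≤ inv1 k * (1 + M) := by
    have e1 : ζ - 1 = inv1 k * (((ζ - 1) * ((1 / inv1 k : ℝ) : ℂ) - I * (u v).im) + I * (u v).im) := by
      have : (inv1 k : ℂ) ≠ 0 := by exact_mod_cast hpos.ne'
      push_cast
      field_simp
      ring
    rw [e1, norm_mul, norm_real, Real.norm_of_nonneg hpos.le]
    refine mul_le_mul_of_nonneg_left ((norm_add_le _ _).trans (add_le_add k3' ?_)) hpos.le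
    rw [norm_mul, norm_I, one_mul, norm_real]
    exact hs
  have hN' := hN v hvc
  calc dist (limitPart x v) (reducedHoriz x k v)
      = ‖ζ * (limitPart x v - reducedHoriz x k v)‖ := by rw [norm_mul, hζn, one_mul, dist_eq_norm]
    _ ≤ ‖(ζ - 1) * shift x k - I * ((u v).im : ℂ)‖ + ‖(ζ - 1) * limitPart x v‖ + ‖G k v‖ := by
        rw [hid]
        exact (norm_sub_le _ _).trans (add_le_add_left (norm_add_le _ _) _)
    _ ≤ ε / 4 + inv1 k * ((1 + M) * N) + ε / 4 := by
        refine add_le_add (add_le_add k2' ?_) k1'.le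
        rw [norm_mul, ← mul_assoc]
        exact mul_le_mul hζ1 hN' (norm_nonneg _) ((norm_nonneg _).trans hζ1)
    _ < ε := by linarith

/-- The reduced horizontal coordinates converge at every point of `ℂ \ {0, 1}`, because they
converge at `1/2` and this set is connected. -/
lemma tendsto_reducedHoriz (x : ℝ) {v : ℂ} (h0 : v ≠ 0) (h1 : v ≠ 1) :
    Tendsto (fun k => reducedHoriz x k v) atTop (𝓝 (limitPart x v)) := by
  have hconn : IsPreconnected ({0, 1}ᶜ : Set ℂ) :=
    (Set.Countable.isConnected_compl_of_one_lt_rank (by simp [rank_real_complex])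
      ((Set.toFinite {0, 1}).countable)).isPreconnected
  have hmem : ∀ {v : ℂ}, v ∈ ({0, 1}ᶜ : Set ℂ) ↔ v ≠ 0 ∧ v ≠ 1 := by
    intro v; simp
  have key := hconn.induction₂' (fun v w : ℂ =>
    Tendsto (fun k => reducedHoriz x k v) atTop (𝓝 (limitPart x v)) →
    Tendsto (fun k => reducedHoriz x k w) atTop (𝓝 (limitPart x w))) ?_ ?_
    (hmem.2 (show (1 / 2 : ℂ) ≠ 0 ∧ (1 / 2 : ℂ) ≠ 1 by constructor <;> norm_num)) (hmem.2 ⟨h0, h1⟩)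
  · refine key (tendsto_const_nhds.congr fun k => ?_)
    rw [reducedHoriz, horiz_half, limitPart_half, shift]
    push_cast
    ring
  · intro v hv
    obtain ⟨r, hr, hb, hball⟩ := exists_ball_tendstoUniformlyOn x (hmem.1 hv).1 (hmem.1 hv).2
    filter_upwards [mem_nhdsWithin_of_mem_nhds (Metric.ball_mem_nhds v hr)] with w hw
    exact ⟨fun h => (hball v (Metric.mem_ball_self hr) h).tendsto_at hw,
      fun h => (hball w hw h).tendsto_at (Metric.mem_ball_self hr)⟩
  · intro a b c _ _ _ hab hbc h
    exact hbc (hab h)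

lemma tendstoLocallyUniformlyOn_reducedHoriz (x : ℝ) :
    TendstoLocallyUniformlyOn (reducedHoriz x) (limitPart x) atTop ({0, 1}ᶜ : Set ℂ) := by
  refine tendstoLocallyUniformlyOn_of_forall_exists_nhds fun v hv => ?_
  have hv' : v ≠ 0 ∧ v ≠ 1 := by simpa using hv
  obtain ⟨r, hr, hb, hball⟩ := exists_ball_tendstoUniformlyOn x hv'.1 hv'.2
  exact ⟨_, mem_nhdsWithin_of_mem_nhds (Metric.ball_mem_nhds v hr),
    hball v (Metric.mem_ball_self hr) (tendsto_reducedHoriz x hv'.1 hv'.2)⟩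

/-! ### Smooth convergence in the coordinate `z` -/

section SmoothConvergence

variable {F G : Type*} [NormedAddCommGroup F] [NormedSpace ℝ F] [NormedAddCommGroup G]
  [NormedSpace ℝ G] {U : Set ℂ}

lemma _root_.TendstoLocallyUniformlyOn.congr_eventually {α β : Type*} [TopologicalSpace α]
    [UniformSpace β] {f g : ℕ → α → β} {f₀ g₀ : α → β} {s : Set α}
    (h : TendstoLocallyUniformlyOn f f₀ atTop s) (hfg : ∀ᶠ k in atTop, EqOn (f k) (g k) s)
    (h₀ : EqOn f₀ g₀ s) : TendstoLocallyUniformlyOn g g₀ atTop s := by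
  intro V hV x hx
  obtain ⟨t, ht, h'⟩ := h V hV x hx
  refine ⟨t ∩ s, inter_mem ht self_mem_nhdsWithin, ?_⟩
  filter_upwards [h', hfg] with k hk hk' y hy
  rw [← h₀ hy.2, ← hk' hy.2]
  exact hk y hy.1

/-- One step of the induction on the order of differentiation, for functions whose differentials
are `L ∘ g k`. -/
lemma tendsto_iteratedFDeriv_succ (hU : IsOpen U) (L : F →L[ℝ] ℂ →L[ℝ] G) {f : ℕ → ℂ → G} {f₀ : ℂ → G}
    {g : ℕ → ℂ → F} {g₀ : ℂ → F}
    (hf : ∀ᶠ k in atTop, ∀ z ∈ U, HasFDerivAt (f k) (L (g k z)) z)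
    (hf₀ : ∀ z ∈ U, HasFDerivAt f₀ (L (g₀ z)) z)
    (hg : ∀ k, ContDiffOn ℝ ∞ (g k) U) (hg₀ : ContDiffOn ℝ ∞ g₀ U) (n : ℕ)
    (h : TendstoLocallyUniformlyOn (fun k => iteratedFDeriv ℝ n (g k)) (iteratedFDeriv ℝ n g₀)
      atTop U) :
    TendstoLocallyUniformlyOn (fun k => iteratedFDeriv ℝ (n + 1) (f k)) (iteratedFDeriv ℝ (n + 1) f₀)
      atTop U := by
  have key : ∀ (f : ℂ → G) (g : ℂ → F), (∀ z ∈ U, HasFDerivAt f (L (g z)) z) →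
      ContDiffOn ℝ ∞ g U → ∀ z ∈ U, (continuousMultilinearCurryRightEquiv' ℝ n ℂ G).symm
        (L.compContinuousMultilinearMap (iteratedFDeriv ℝ n g z)) = iteratedFDeriv ℝ (n + 1) f z := by
    intro f g hf hg z hz
    have hev : (fun y => fderiv ℝ f y) =ᶠ[𝓝 z] fun y => L (g y) := by
      filter_upwards [hU.mem_nhds hz] with y hy using (hf y hy).fderiv
    rw [iteratedFDeriv_succ_eq_comp_right, Function.comp_apply, (hev.iteratedFDeriv ℝ n).self_of_nhds]
    have := L.iteratedFDeriv_comp_left (hg.contDiffAt (hU.mem_nhds hz)) (i := n)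
      (by exact_mod_cast le_top)
    rw [← this]
    rfl
  have hL : UniformContinuous fun m : ContinuousMultilinearMap ℝ (fun _ : Fin n => ℂ) F =>
      L.compContinuousMultilinearMap m := by
    refine (?_ : LipschitzWith ‖L‖₊ fun m : ContinuousMultilinearMap ℝ (fun _ : Fin n => ℂ) F =>
      L.compContinuousMultilinearMap m).uniformContinuous
    refine LipschitzWith.of_dist_le_mul fun m m' => ?_
    rw [dist_eq_norm, dist_eq_norm, coe_nnnorm]
    have : L.compContinuousMultilinearMap m - L.compContinuousMultilinearMap m' =
        L.compContinuousMultilinearMap (m - m') := by ext; simp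
    rw [this]
    exact L.norm_compContinuousMultilinearMap_le _
  have huc : UniformContinuous fun m : ContinuousMultilinearMap ℝ (fun _ : Fin n => ℂ) F =>
      (continuousMultilinearCurryRightEquiv' ℝ n ℂ G).symm (L.compContinuousMultilinearMap m) :=
    (continuousMultilinearCurryRightEquiv' ℝ n ℂ G).symm.isometry.uniformContinuous.comp hL
  refine (huc.comp_tendstoLocallyUniformlyOn h).congr_eventually ?_ ?_
  · filter_upwards [hf] with k hk z hz using key _ _ hk (hg k) z hz
  · exact fun z hz => key _ _ hf₀ hg₀ z hz

lemma tendsto_iteratedFDeriv_zero {f : ℕ → ℂ → G} {f₀ : ℂ → G}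
    (h : TendstoLocallyUniformlyOn f f₀ atTop U) :
    TendstoLocallyUniformlyOn (fun k => iteratedFDeriv ℝ 0 (f k)) (iteratedFDeriv ℝ 0 f₀) atTop U :=
  (continuousMultilinearCurryFin0 ℝ ℂ G).symm.isometry.uniformContinuous.comp_tendstoLocallyUniformlyOn h

lemma contDiffOn_real_of_holomorphic {H : Type*} [NormedAddCommGroup H] [NormedSpace ℂ H]
    [CompleteSpace H] (hU : IsOpen U) {g : ℂ → H} (hg : DifferentiableOn ℂ g U) :
    ContDiffOn ℝ ∞ g U :=
  (hg.contDiffOn hU (n := ∞)).restrict_scalars ℝ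

/-- Locally uniform limits of holomorphic functions are limits with all real derivatives. -/
lemma tendsto_iteratedFDeriv_of_holomorphic {H : Type*} [NormedAddCommGroup H] [NormedSpace ℂ H]
    [CompleteSpace H] (hU : IsOpen U) (n : ℕ) : ∀ {g : ℕ → ℂ → H} {g₀ : ℂ → H},
    (∀ k, DifferentiableOn ℂ (g k) U) → DifferentiableOn ℂ g₀ U →
    TendstoLocallyUniformlyOn g g₀ atTop U →
    TendstoLocallyUniformlyOn (fun k => iteratedFDeriv ℝ n (g k)) (iteratedFDeriv ℝ n g₀) atTop U := by
  set L : H →L[ℝ] ℂ →L[ℝ] H :=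
    ((ContinuousLinearMap.lsmul ℝ ℂ : ℂ →L[ℝ] H →L[ℝ] H)).flip with hL
  have hder : ∀ g : ℂ → H, DifferentiableOn ℂ g U → ∀ z ∈ U, HasFDerivAt g (L (deriv g z)) z := by
    intro g hg z hz
    refine ((hg.differentiableAt (hU.mem_nhds hz)).hasDerivAt.hasFDerivAt.restrictScalars ℝ).congr_fderiv ?_
    ext h
    simp [hL]
  induction n with
  | zero => exact fun _ _ h => tendsto_iteratedFDeriv_zero h
  | succ n ih =>
    intro g g₀ hg hg₀ h
    refine tendsto_iteratedFDeriv_succ hU L (Eventually.of_forall fun k => hder _ (hg k)) (hder _ hg₀)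
      (fun k => contDiffOn_real_of_holomorphic hU ((hg k).deriv hU))
      (contDiffOn_real_of_holomorphic hU (hg₀.deriv hU)) n
      (ih (fun k => (hg k).deriv hU) (hg₀.deriv hU) (h.deriv (Eventually.of_forall hg) hU))

/-- A function whose differential is the real part of a holomorphic form is smooth. -/
lemma contDiffOn_of_hasFDerivAt (hU : IsOpen U) (L : F →L[ℝ] ℂ →L[ℝ] G) {f : ℂ → G} {g : ℂ → F}
    (hf : ∀ z ∈ U, HasFDerivAt f (L (g z)) z) (hg : ContDiffOn ℝ ∞ g U) : ContDiffOn ℝ ∞ f U := by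
  rw [contDiffOn_infty_iff_fderiv_of_isOpen hU]
  refine ⟨fun z hz => (hf z hz).differentiableAt.differentiableWithinAt, ?_⟩
  exact (L.contDiff.comp_contDiffOn hg).congr fun z hz => (hf z hz).fderiv

end SmoothConvergence

lemma sheetMap_mapsTo (k : ℕ) : MapsTo (sheetMap k) limitCurve (curveM k) := by
  intro p hp
  refine ⟨?_, (limitCurve_ne_one hp).1, (limitCurve_ne_one hp).2⟩
  have hk : ((k : ℂ) + 1) ≠ 0 := by exact_mod_cast Nat.succ_ne_zero k
  have h0 := hp.1
  simp only [sheetMap]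
  rw [mul_pow, ← exp_nat_mul]
  have : ((k + 1 : ℕ) : ℂ) * (p.2 / (k + 1)) = p.2 := by push_cast; field_simp
  rw [this, hp.2]
  field_simp
  ring

lemma sheetMap_eventually_injOn {K : Set (ℂ × ℂ)} (hK : IsCompact K) :
    ∀ᶠ k in atTop, InjOn (sheetMap k) (K ∩ limitCurve) := by
  obtain ⟨M, hM⟩ := hK.exists_bound_of_continuousOn (f := fun p : ℂ × ℂ => p.2) (by fun_prop)
  have h := tendsto_natCast_atTop_atTop (R := ℝ)
  filter_upwards [h.eventually_gt_atTop M] with k hk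
  intro p hp q hq hpq
  have h1 : p.1 = q.1 := congrArg Prod.fst (a₁ := sheetMap k p) (a₂ := sheetMap k q) hpq
  have h2 : p.1 * exp (p.2 / (k + 1)) = q.1 * exp (q.2 / (k + 1)) :=
    congrArg Prod.snd (a₁ := sheetMap k p) (a₂ := sheetMap k q) hpq
  rw [← h1] at h2
  have h3 := mul_left_cancel₀ hp.2.1 h2
  have hk0 : (0 : ℝ) < (k : ℝ) + 1 := by positivity
  have him : ∀ r ∈ K, |(r.2 / ((k : ℂ) + 1)).im| < Real.pi := by
    intro r hr
    have e : (r.2 / ((k : ℂ) + 1)).im = r.2.im / ((k : ℝ) + 1) := by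
      have : ((k : ℂ) + 1) = (((k : ℝ) + 1 : ℝ) : ℂ) := by push_cast; rfl
      rw [this, div_ofReal_im]
    rw [e, abs_div, abs_of_pos hk0, div_lt_iff₀ hk0]
    have h4 := (abs_im_le_norm r.2).trans (hM r hr)
    nlinarith [Real.pi_gt_three]
  have h5 := exp_inj_of_neg_pi_lt_of_le_pi (abs_lt.1 (him p hp.1)).1 (abs_lt.1 (him p hp.1)).2.le
    (abs_lt.1 (him q hq.1)).1 (abs_lt.1 (him q hq.1)).2.le h3
  refine Prod.ext h1 ?_
  have hk' : ((k : ℂ) + 1) ≠ 0 := by exact_mod_cast Nat.succ_ne_zero k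
  exact (div_left_inj' hk').1 h5

lemma div_eq_inv1_mul (k : ℕ) (u : ℂ) : u / ((k : ℂ) + 1) = inv1 k * u := by
  rw [inv1]; push_cast; ring

lemma limitCurve_re {p : ℂ × ℂ} (hp : p ∈ limitCurve) : p.2.re = logModulus (p.1 ^ 2) := by
  have h := hp.2
  apply Real.exp_injective
  rw [exp_logModulus_sq hp.1 (limitCurve_ne hp), ← norm_exp, h, norm_div]

/-- The translated surface `Σ_{k,x}`. -/
def normalizedSigma (x : ℝ) (k : ℕ) : ℂ × ℂ → E3 := sigmaMap k x (shift x k)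

lemma normalizedSigma_sheetMap (x : ℝ) (k : ℕ) {p : ℂ × ℂ} (hp : p.1 ≠ 0) :
    normalizedSigma x k (sheetMap k p) =
      spacePoint (horiz (inv1 k) x (constC k x ^ 2) (p.1 ^ 2) (exp (inv1 k * p.2)) - shift x k)
        (height x (constC k x) p.1) := by
  rw [normalizedSigma, sigmaMap, sheetMap, mul_div_cancel_left₀ _ hp, div_eq_inv1_mul]

lemma tendsto_normalizedSigma (x : ℝ) {p : ℂ × ℂ} (hp : p ∈ limitCurve) :
    Tendsto (fun k => normalizedSigma x k (sheetMap k p)) atTop (𝓝 (limitMap x p)) := by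
  have h3 := limitCurve_ne hp
  have hH := tendsto_horiz_of_tendsto (limitCurve_re hp)
    (tendsto_reducedHoriz x (pow_ne_zero 2 hp.1) (sub_ne_zero.1 h3))
  have hh : Tendsto (fun k => height x (constC k x) p.1) atTop (𝓝 (height x 1 p.1)) :=
    (tendsto_constC x).mul_const _
  refine ((continuous_spacePoint.tendsto _).comp (hH.prodMk_nhds hh)).congr fun k => ?_
  rw [normalizedSigma_sheetMap x k hp.1]
  rfl

lemma differentiableOn_modelForm (x c e : ℝ) {U : Set ℂ} {s : ℂ → ℂ} (hs : DifferentiableOn ℂ s U)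
    (hS : ∀ z ∈ U, (z, s z) ∈ limitCurve) :
    DifferentiableOn ℂ (fun z => modelForm x c z (exp (e * s z))) U := by
  intro z hz
  have h0 : z ≠ 0 := (hS z hz).1
  have h3 : z ^ 2 - 1 ≠ 0 := limitCurve_ne (hS z hz)
  have hτ : DifferentiableWithinAt ℂ (fun z => exp (e * s z)) U z := ((hs z hz).const_mul _).cexp
  have e1 : DifferentiableWithinAt ℂ (fun z => exp (e * s z) *
      (z * (z ^ 2 - (x : ℂ) ^ 2) ^ 2 / (z ^ 2 - 1) ^ 3)) U z :=
    hτ.mul (DifferentiableWithinAt.div (by fun_prop) (by fun_prop) (pow_ne_zero 3 h3))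
  have e2 : DifferentiableWithinAt ℂ (fun z => (c : ℂ) ^ 2 / exp (e * s z) *
      (1 / (z * (z ^ 2 - 1)))) U z :=
    (DifferentiableWithinAt.div (differentiableWithinAt_const _) hτ (exp_ne_zero _)).mul
      (DifferentiableWithinAt.div (differentiableWithinAt_const _) (by fun_prop) (mul_ne_zero h0 h3))
  have e3 : DifferentiableWithinAt ℂ (fun z => 2 * (c : ℂ) * (z ^ 2 - (x : ℂ) ^ 2) / (z ^ 2 - 1) ^ 2) U z :=
    DifferentiableWithinAt.div (by fun_prop) (by fun_prop) (pow_ne_zero 2 h3)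
  rw [differentiableWithinAt_pi]
  intro j
  fin_cases j
  · exact e1.sub e2
  · exact (e1.add e2).const_mul I
  · exact e3

section Section

variable {U : Set ℂ} {s : ℂ → ℂ}

lemma hasFDerivAt_limitMap_section (x : ℝ) (hU : IsOpen U) (hs : DifferentiableOn ℂ s U)
    (hS : ∀ z ∈ U, (z, s z) ∈ limitCurve) {z : ℂ} (hz : z ∈ U) :
    HasFDerivAt (fun z => limitMap x (z, s z)) (realForm (modelForm x 1 z (exp ((0 : ℝ) * s z)))) z := by
  have hd := ((hs.differentiableAt (hU.mem_nhds hz)).restrictScalars ℝ)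
  have := hasFDerivAt_limitMap x (hasFDerivAt_id (𝕜 := ℝ) z) hd
    (by filter_upwards [hU.mem_nhds hz] with y hy using hS y hy)
  refine this.congr_fderiv ?_
  simp

lemma hasFDerivAt_sigma_section {x : ℝ} {k : ℕ} (hk : 1 ≤ k)
    (hx : 0 < 4 * (k : ℝ) + 3 - 2 * x ^ 2 - x ^ 4) (hU : IsOpen U) (hs : DifferentiableOn ℂ s U)
    (hS : ∀ z ∈ U, (z, s z) ∈ limitCurve) {z : ℂ} (hz : z ∈ U) :
    HasFDerivAt (fun z => normalizedSigma x k (sheetMap k (z, s z)))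
      (realForm (modelForm x (constC k x) z (exp (inv1 k * s z)))) z := by
  have hd : DifferentiableAt ℂ (fun z => z * exp (s z / (k + 1))) z :=
    differentiableAt_id.mul (((hs.differentiableAt (hU.mem_nhds hz)).div_const _).cexp)
  have := hasFDerivAt_sigmaMap hk hx (shift x k) (hasFDerivAt_id (𝕜 := ℝ) z)
    (hd.restrictScalars ℝ)
    (by filter_upwards [hU.mem_nhds hz] with y hy using sheetMap_mapsTo k (hS y hy)) (hS z hz).1
  refine this.congr_fderiv ?_
  have e : z * exp (s z / (k + 1)) / z = exp (inv1 k * s z) := by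
    rw [mul_div_cancel_left₀ _ (hS z hz).1, div_eq_inv1_mul]
  simp only [id, e]
  rfl

/-- Convergence with all derivatives along a holomorphic section `z ↦ (z, s z)` of the limit curve:
the differentials are real parts of holomorphic forms that converge locally uniformly. -/
theorem smooth_convergence_section (x : ℝ) (hU : IsOpen U) (hs : DifferentiableOn ℂ s U)
    (hS : ∀ z ∈ U, (z, s z) ∈ limitCurve) :
    ContDiffOn ℝ ∞ (fun z => limitMap x (z, s z)) U ∧
    (∀ᶠ k in atTop, ContDiffOn ℝ ∞ (fun z => normalizedSigma x k (sheetMap k (z, s z))) U) ∧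
    ∀ n : ℕ, TendstoLocallyUniformlyOn
      (fun k => iteratedFDeriv ℝ n (fun z => normalizedSigma x k (sheetMap k (z, s z))))
      (iteratedFDeriv ℝ n (fun z => limitMap x (z, s z))) atTop U := by
  have hΦ (c e : ℝ) := differentiableOn_modelForm x c e hs hS
  have hΦc (c e : ℝ) := contDiffOn_real_of_holomorphic hU (hΦ c e)
  have hY : ∀ z ∈ U, HasFDerivAt (fun z => limitMap x (z, s z))
      (realForm (modelForm x 1 z (exp ((0 : ℝ) * s z)))) z :=
    fun z hz => hasFDerivAt_limitMap_section x hU hs hS hz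
  have hX : ∀ᶠ k in atTop, ∀ z ∈ U, HasFDerivAt
      (fun z => normalizedSigma x k (sheetMap k (z, s z)))
      (realForm (modelForm x (constC k x) z (exp (inv1 k * s z)))) z := by
    filter_upwards [eventually_admissible x] with k hk z hz
    exact hasFDerivAt_sigma_section hk.1 hk.2 hU hs hS hz
  have hconv : TendstoLocallyUniformlyOn (fun k z => modelForm x (constC k x) z (exp (inv1 k * s z)))
      (fun z => modelForm x 1 z (exp ((0 : ℝ) * s z))) atTop U := by
    have hp : Tendsto (fun k => (inv1 k, constC k x)) atTop (𝓝 (0, 1)) :=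
      tendsto_inv1.prodMk_nhds (tendsto_constC x)
    refine tendstoLocallyUniformlyOn_of_continuousAt hp
      (f := fun q : (ℝ × ℝ) × ℂ => modelForm x q.1.2 q.2 (exp (q.1.1 * s q.2))) fun z hz => ?_
    have h0 : z ≠ 0 := (hS z hz).1
    have h3 : z ^ 2 - 1 ≠ 0 := limitCurve_ne (hS z hz)
    have hsc : ContinuousAt (fun q : (ℝ × ℝ) × ℂ => s q.2) ((0, 1), z) :=
      ContinuousAt.comp (f := Prod.snd)
        (hs.differentiableAt (hU.mem_nhds hz)).continuousAt continuousAt_snd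
    have hτ : ContinuousAt (fun q : (ℝ × ℝ) × ℂ => exp (q.1.1 * s q.2)) ((0, 1), z) := by
      refine ContinuousAt.cexp (ContinuousAt.mul ?_ hsc)
      fun_prop
    have hτ0 : exp (((0 : ℝ) : ℂ) * s z) ≠ 0 := exp_ne_zero _
    have e1 : ContinuousAt (fun q : (ℝ × ℝ) × ℂ => exp (q.1.1 * s q.2) *
        (q.2 * (q.2 ^ 2 - (x : ℂ) ^ 2) ^ 2 / (q.2 ^ 2 - 1) ^ 3)) ((0, 1), z) :=
      hτ.mul (ContinuousAt.div (by fun_prop) (by fun_prop) (pow_ne_zero 3 h3))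
    have e2 : ContinuousAt (fun q : (ℝ × ℝ) × ℂ => (q.1.2 : ℂ) ^ 2 / exp (q.1.1 * s q.2) *
        (1 / (q.2 * (q.2 ^ 2 - 1)))) ((0, 1), z) :=
      (ContinuousAt.div (by fun_prop) hτ hτ0).mul
        (ContinuousAt.div (by fun_prop) (by fun_prop) (mul_ne_zero h0 h3))
    have e3 : ContinuousAt (fun q : (ℝ × ℝ) × ℂ => 2 * (q.1.2 : ℂ) * (q.2 ^ 2 - (x : ℂ) ^ 2) /
        (q.2 ^ 2 - 1) ^ 2) ((0, 1), z) :=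
      ContinuousAt.div (by fun_prop) (by fun_prop) (pow_ne_zero 2 h3)
    refine continuousAt_pi.2 fun j => ?_
    fin_cases j
    · exact e1.sub e2
    · exact continuousAt_const.mul (e1.add e2)
    · exact e3
  refine ⟨contDiffOn_of_hasFDerivAt hU realForm hY (hΦc 1 0), ?_, fun n => ?_⟩
  · filter_upwards [hX] with k hk
    exact contDiffOn_of_hasFDerivAt hU realForm hk (hΦc _ _)
  · cases n with
    | succ n =>
      exact tendsto_iteratedFDeriv_succ hU realForm hX hY (fun k => hΦc _ _) (hΦc 1 0) n
        (tendsto_iteratedFDeriv_of_holomorphic hU n (fun k => hΦ _ _) (hΦ 1 0) hconv)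
    | zero =>
      refine tendsto_iteratedFDeriv_zero (tendstoLocallyUniformlyOn_of_forall_exists_nhds fun z₀ hz₀ => ?_)
      obtain ⟨r, hr, hrU⟩ := Metric.nhds_basis_closedBall.mem_iff.1 (hU.mem_nhds hz₀)
      refine ⟨Metric.ball z₀ r, mem_nhdsWithin_of_mem_nhds (Metric.ball_mem_nhds z₀ hr), ?_⟩
      have hbU : Metric.ball z₀ r ⊆ U := Metric.ball_subset_closedBall.trans hrU
      have hdu : TendstoUniformlyOn (fun k z => realForm (modelForm x (constC k x) z (exp (inv1 k * s z))) -
          realForm (modelForm x 1 z (exp ((0 : ℝ) * s z)))) 0 atTop (Metric.ball z₀ r) := by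
        have h1 := ((tendstoLocallyUniformlyOn_iff_tendstoUniformlyOn_of_compact
          (isCompact_closedBall z₀ r)).1 (hconv.mono hrU)).mono Metric.ball_subset_closedBall
        have h2 := realForm.uniformContinuous.comp_tendstoUniformlyOn h1
        rw [Metric.tendstoUniformlyOn_iff] at h2 ⊢
        intro ε hε
        filter_upwards [h2 ε hε] with k hk z hz
        rw [Pi.zero_apply, dist_zero_left, ← dist_eq_norm, dist_comm]
        exact hk z hz
      have h0 : Tendsto (fun k => normalizedSigma x k (sheetMap k (z₀, s z₀)) - limitMap x (z₀, s z₀))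
          atTop (𝓝 0) := by
        simpa using (tendsto_normalizedSigma x (hS z₀ hz₀)).sub_const (limitMap x (z₀, s z₀))
      have h4 := tendstoUniformlyOn_ball_of_fderiv (f := fun k z =>
        normalizedSigma x k (sheetMap k (z, s z)) - limitMap x (z, s z)) (Metric.mem_ball_self hr)
        (by filter_upwards [hX] with k hk z hz using (hk z (hbU hz)).sub (hY z (hbU hz))) hdu h0
      rw [Metric.tendstoUniformlyOn_iff] at h4 ⊢
      intro ε hε
      filter_upwards [h4 ε hε] with k hk z hz
      have := hk z hz
      rwa [Pi.zero_apply, dist_zero_left, ← dist_eq_norm, dist_comm] at this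

end Section

/-! ### Uniform expansions at `v = ∞`, `0` and `1` -/

lemma exists_forall_norm_sub_le_mul_norm {f : ℂ → ℂ} (hf : DifferentiableOn ℂ f (Metric.ball 0 1)) :
    ∃ M, 0 ≤ M ∧ ∀ s : ℂ, ‖s‖ ≤ 1 / 2 → ‖f s - f 0‖ ≤ M * ‖s‖ := by
  have hsub : Metric.closedBall (0 : ℂ) (1 / 2) ⊆ Metric.ball 0 1 :=
    Metric.closedBall_subset_ball (by norm_num)
  have hc : ContinuousOn (deriv f) (Metric.closedBall (0 : ℂ) (1 / 2)) :=
    ((hf.deriv Metric.isOpen_ball).continuousOn).mono hsub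
  obtain ⟨M, hM⟩ := (isCompact_closedBall (0 : ℂ) (1 / 2)).exists_bound_of_continuousOn hc
  have h0 : (0 : ℂ) ∈ Metric.closedBall (0 : ℂ) (1 / 2) := Metric.mem_closedBall_self (by norm_num)
  refine ⟨M, (norm_nonneg _).trans (hM 0 h0), fun s hs => ?_⟩
  have := (convex_closedBall (0 : ℂ) (1 / 2)).norm_image_sub_le_of_norm_deriv_le
    (fun z hz => hf.differentiableAt (Metric.isOpen_ball.mem_nhds (hsub hz))) hM h0
    (by simpa using hs)
  simpa using this

/-- The bound is uniform in the exponent `b` of the factor `(1 + s) ^ b`. -/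
lemma exists_forall_norm_cpow_mul_sub_le {f : ℂ → ℂ} (hf : DifferentiableOn ℂ f (Metric.ball 0 1)) :
    ∃ M, 0 ≤ M ∧ ∀ (b : ℝ) (s : ℂ), |b| ≤ 1 → ‖s‖ ≤ 1 / 2 →
      ‖exp (b * log (1 + s)) * f s - f 0‖ ≤ M * ‖s‖ := by
  obtain ⟨M, hM0, hM⟩ := exists_forall_norm_sub_le_mul_norm hf
  refine ⟨3 * M + 3 * ‖f 0‖, by positivity, fun b s hb hs => ?_⟩
  have h1 : ‖(b : ℂ) * log (1 + s)‖ ≤ 3 / 2 * ‖s‖ := by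
    rw [norm_mul, norm_real, Real.norm_eq_abs]
    calc |b| * ‖log (1 + s)‖ ≤ 1 * (3 / 2 * ‖s‖) :=
          mul_le_mul hb (norm_log_one_add_half_le_self hs) (norm_nonneg _) zero_le_one
      _ = _ := one_mul _
  have h2 : ‖exp (b * log (1 + s)) - 1‖ ≤ 3 * ‖s‖ := by
    have := norm_exp_sub_one_le (x := (b : ℂ) * log (1 + s)) (by linarith)
    linarith
  have h3 : ‖exp (b * log (1 + s))‖ ≤ 3 := by
    have := norm_add_le (exp (b * log (1 + s)) - 1) 1
    rw [sub_add_cancel, norm_one] at this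
    linarith
  have e : exp (b * log (1 + s)) * f s - f 0 = exp (b * log (1 + s)) * (f s - f 0) +
      (exp (b * log (1 + s)) - 1) * f 0 := by ring
  rw [e]
  refine (norm_add_le _ _).trans ?_
  rw [norm_mul, norm_mul]
  have := mul_le_mul h3 (hM s hs) (norm_nonneg _) (by norm_num)
  have := mul_le_mul_of_nonneg_right h2 (norm_nonneg (f 0))
  linarith

lemma one_add_ne_zero_of_mem_ball {s : ℂ} (hs : s ∈ Metric.ball (0 : ℂ) 1) : 1 + s ≠ 0 :=
  slitPlane_ne_zero (mem_slitPlane_of_norm_lt_one (by simpa using hs))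

lemma exists_forall_norm_cpow_div_sub_le (p : ℂ → ℂ) (hp : Differentiable ℂ p) (n : ℕ) :
    ∃ M, 0 ≤ M ∧ ∀ (b : ℝ) (s : ℂ), |b| ≤ 1 → ‖s‖ ≤ 1 / 2 →
      ‖exp (b * log (1 + s)) * (p s / (1 + s) ^ n) - p 0‖ ≤ M * ‖s‖ := by
  have hd : DifferentiableOn ℂ (fun s : ℂ => p s / (1 + s) ^ n) (Metric.ball 0 1) :=
    hp.differentiableOn.div (by fun_prop) fun s hs => pow_ne_zero n (one_add_ne_zero_of_mem_ball hs)
  obtain ⟨M, hM, h⟩ := exists_forall_norm_cpow_mul_sub_le hd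
  refine ⟨M, hM, fun b s hb hs => ?_⟩
  have := h b s hb hs
  rwa [add_zero, one_pow, div_one] at this

lemma hasDerivAt_horiz_ray {e x c2 : ℝ} (he : 0 < e) (he1 : e < 1)
    (hc : c2 * betaB e = 2 * kappa e x * betaA e) {v l : ℝ → ℂ} {ζ : ℂ} {t : ℝ}
    (hv : HasDerivAt v ζ t) (hl : HasDerivAt l (logSlope (v t) * ζ) t)
    (hre : ∀ᶠ s in 𝓝 t, (l s).re = logModulus (v s)) (h0 : v t ≠ 0) (h1 : v t ≠ 1) :
    HasDerivAt (fun s => horiz e x c2 (v s) (exp (e * l s)))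
      (etaCoeff x (v t) (exp (e * l t)) * ζ - conj (gaussCoeff c2 (v t) (exp (e * l t)) * ζ)) t := by
  have hτ : HasFDerivAt (fun s => exp (e * l s)) ((e * logSlope (v t) * exp (e * l t)) •
      (ContinuousLinearMap.toSpanSingleton ℝ ζ)) t := by
    refine ((hl.const_mul (e : ℂ)).cexp.hasFDerivAt).congr_fderiv ?_
    ext
    simp
    ring
  have hmod : ∀ᶠ s in 𝓝 t, ‖exp (e * l s)‖ = Real.exp (e * logModulus (v s)) := by
    filter_upwards [hre] with s hs
    rw [norm_exp, re_ofReal_mul, hs]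
  have := (hasFDerivAt_horiz he he1 hc hv.hasFDerivAt hτ hmod h0 h1).hasDerivAt
  refine this.congr_deriv ?_
  simp [horizForm]

lemma norm_image_sub_le_of_norm_deriv_le {f f' : ℝ → ℂ} {B B' : ℝ → ℝ} {a b : ℝ} (hab : a ≤ b)
    (hf : ∀ t ∈ Icc a b, HasDerivAt f (f' t) t) (hB : ∀ t ∈ Icc a b, HasDerivAt B (B' t) t)
    (h : ∀ t ∈ Icc a b, ‖f' t‖ ≤ B' t) : ‖f b - f a‖ ≤ B b - B a := by
  refine image_norm_le_of_norm_deriv_right_le_deriv_boundary' (f := fun t => f t - f a)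
    (f' := f') (B := fun t => B t - B a) (B' := B') (a := a) (b := b) ?_ ?_ ?_ ?_ ?_ ?_
    (right_mem_Icc.2 hab)
  · exact fun t ht => ((hf t ht).continuousAt.sub continuousAt_const).continuousWithinAt
  · exact fun t ht => ((hf t (Ico_subset_Icc_self ht)).sub_const _).hasDerivWithinAt
  · simp
  · exact fun t ht => ((hB t ht).continuousAt.sub continuousAt_const).continuousWithinAt
  · exact fun t ht => ((hB t (Ico_subset_Icc_self ht)).sub_const _).hasDerivWithinAt
  · exact fun t ht => h t (Ico_subset_Icc_self ht)

lemma exp_mul_log_add {t : ℝ} (ht : 0 < t) (e b : ℝ) (y : ℂ) :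
    exp (e * ((b * Real.log t : ℝ) + y)) = ((t ^ (e * b) : ℝ) : ℂ) * exp (e * y) := by
  rw [mul_add, exp_add, Real.rpow_def_of_pos ht, ofReal_exp]
  congr 2
  push_cast
  ring

lemma hasDerivAt_mul_log {t : ℝ} (ht : t ≠ 0) (b : ℝ) :
    HasDerivAt (fun t : ℝ => ((b * Real.log t : ℝ) : ℂ)) ((b / t : ℝ) : ℂ) t := by
  have := ((Real.hasDerivAt_log ht).const_mul b).ofReal_comp
  rwa [← div_eq_mul_inv] at this

lemma hasDerivAt_ofReal_mul (ζ : ℂ) (t : ℝ) : HasDerivAt (fun t : ℝ => (t : ℂ) * ζ) ζ t := by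
  simpa using (ofRealCLM.hasDerivAt (x := t)).mul_const ζ

lemma norm_ofReal_mul_of_pos {t : ℝ} (ht : 0 < t) {ζ : ℂ} (hζ : ‖ζ‖ = 1) : ‖(t : ℂ) * ζ‖ = t := by
  rw [norm_mul, hζ, mul_one, norm_real, Real.norm_of_nonneg ht.le]

/-- A branch of `u = log (v - 1) - log v / 2` along the ray `v = t ζ`, `t ≥ 2`. -/
def logAtInfinity (ζ : ℂ) (t : ℝ) : ℂ :=
  ((1 / 2 * Real.log t : ℝ) : ℂ) + log (1 + -((t : ℂ) * ζ)⁻¹)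

/-- A branch of `u` along the ray `v = t ζ`, `t ≤ 1 / 2`, rotated by a constant. -/
def logAtZero (ζ : ℂ) (t : ℝ) : ℂ :=
  ((-(1 / 2) * Real.log t : ℝ) : ℂ) + log (1 + -((t : ℂ) * ζ))

/-- A branch of `u` along the ray `v = 1 + t ζ`, `t ≤ 1 / 2`, rotated by a constant. -/
def logAtOne (ζ : ℂ) (t : ℝ) : ℂ :=
  ((1 * Real.log t : ℝ) : ℂ) + -(1 / 2) * log (1 + (t : ℂ) * ζ)

section Ends

variable {ζ : ℂ} {t : ℝ}

lemma logAtInfinity_re (hζ : ‖ζ‖ = 1) (ht : 1 < t) :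
    (logAtInfinity ζ t).re = logModulus ((t : ℂ) * ζ) := by
  have hn := norm_ofReal_mul_of_pos (by linarith : 0 < t) hζ
  have h0 : (t : ℂ) * ζ ≠ 0 := by rw [← norm_ne_zero_iff, hn]; linarith
  have e : (t : ℂ) * ζ - 1 = (t : ℂ) * ζ * (1 + -((t : ℂ) * ζ)⁻¹) := by
    rw [mul_add, mul_neg, mul_inv_cancel₀ h0]; ring
  have h1 : 1 + -((t : ℂ) * ζ)⁻¹ ≠ 0 := by
    refine one_add_ne_zero_of_mem_ball ?_
    rw [mem_ball_zero_iff, norm_neg, norm_inv, hn]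
    exact inv_lt_one_of_one_lt₀ ht
  rw [logAtInfinity, add_re, ofReal_re, log_re, logModulus, e, norm_mul,
    Real.log_mul (norm_ne_zero_iff.2 h0) (norm_ne_zero_iff.2 h1), hn]
  ring

lemma logAtZero_re (hζ : ‖ζ‖ = 1) (ht : 0 < t) :
    (logAtZero ζ t).re = logModulus ((t : ℂ) * ζ) := by
  rw [logAtZero, add_re, ofReal_re, log_re, logModulus, norm_ofReal_mul_of_pos ht hζ, ← norm_neg]
  ring_nf

lemma logAtOne_re (hζ : ‖ζ‖ = 1) (ht : 0 < t) :
    (logAtOne ζ t).re = logModulus (1 + (t : ℂ) * ζ) := by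
  have : (-(1 / 2) : ℂ) = ((-(1 / 2) : ℝ) : ℂ) := by push_cast; rfl
  rw [logAtOne, add_re, ofReal_re, this, re_ofReal_mul, log_re, logModulus, add_sub_cancel_left,
    norm_ofReal_mul_of_pos ht hζ]
  ring

lemma hasDerivAt_logAtInfinity (hζ : ‖ζ‖ = 1) (ht : 2 ≤ t) :
    HasDerivAt (logAtInfinity ζ) (logSlope ((t : ℂ) * ζ) * ζ) t := by
  have hn := norm_ofReal_mul_of_pos (by linarith : 0 < t) hζ
  have h0 : (t : ℂ) * ζ ≠ 0 := by rw [← norm_ne_zero_iff, hn]; linarith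
  have hζ0 : ζ ≠ 0 := right_ne_zero_of_mul h0
  have ht0 : (t : ℂ) ≠ 0 := left_ne_zero_of_mul h0
  have hs : 1 + -((t : ℂ) * ζ)⁻¹ ∈ slitPlane := by
    refine mem_slitPlane_of_norm_lt_one ?_
    rw [norm_neg, norm_inv, hn]
    exact inv_lt_one_of_one_lt₀ (by linarith)
  have h1 : (t : ℂ) * ζ - 1 ≠ 0 := by
    have := slitPlane_ne_zero hs
    contrapose! this
    rw [sub_eq_zero.1 this]
    norm_num
  have h2 := slitPlane_ne_zero hs
  refine ((hasDerivAt_mul_log (by linarith) (1 / 2)).add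
    ((((hasDerivAt_ofReal_mul ζ t).inv h0).neg.const_add 1).clog_real hs)).congr_deriv ?_
  have e : (1 + -((t : ℂ) * ζ)⁻¹) = ((t : ℂ) * ζ - 1) / ((t : ℂ) * ζ) := by field_simp; ring
  simp only [Pi.neg_apply, Pi.inv_apply]
  rw [e, logSlope]
  push_cast
  field_simp
  ring

lemma hasDerivAt_logAtZero (hζ : ‖ζ‖ = 1) (ht : 0 < t) (ht' : t ≤ 1 / 2) :
    HasDerivAt (logAtZero ζ) (logSlope ((t : ℂ) * ζ) * ζ) t := by
  have hn := norm_ofReal_mul_of_pos ht hζ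
  have h0 : (t : ℂ) * ζ ≠ 0 := by rw [← norm_ne_zero_iff, hn]; exact ht.ne'
  have hζ0 : ζ ≠ 0 := right_ne_zero_of_mul h0
  have ht0 : (t : ℂ) ≠ 0 := left_ne_zero_of_mul h0
  have hs : 1 + -((t : ℂ) * ζ) ∈ slitPlane := by
    refine mem_slitPlane_of_norm_lt_one ?_
    rw [norm_neg, hn]
    linarith
  have h2 := slitPlane_ne_zero hs
  have h1 : (t : ℂ) * ζ - 1 ≠ 0 := by
    contrapose! h2
    rw [sub_eq_zero.1 h2]
    norm_num
  refine ((hasDerivAt_mul_log ht.ne' (-(1 / 2))).add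
    (((hasDerivAt_ofReal_mul ζ t).neg.const_add 1).clog_real hs)).congr_deriv ?_
  have e : (1 + -((t : ℂ) * ζ)) = -((t : ℂ) * ζ - 1) := by ring
  simp only [Pi.neg_apply]
  rw [e, logSlope]
  push_cast
  field_simp
  ring

lemma hasDerivAt_logAtOne (hζ : ‖ζ‖ = 1) (ht : 0 < t) (ht' : t ≤ 1 / 2) :
    HasDerivAt (logAtOne ζ) (logSlope (1 + (t : ℂ) * ζ) * ζ) t := by
  have hn := norm_ofReal_mul_of_pos ht hζ
  have h0 : (t : ℂ) * ζ ≠ 0 := by rw [← norm_ne_zero_iff, hn]; exact ht.ne'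
  have hζ0 : ζ ≠ 0 := right_ne_zero_of_mul h0
  have ht0 : (t : ℂ) ≠ 0 := left_ne_zero_of_mul h0
  have hs : 1 + (t : ℂ) * ζ ∈ slitPlane := by
    refine mem_slitPlane_of_norm_lt_one ?_
    rw [hn]
    linarith
  have h2 := slitPlane_ne_zero hs
  refine ((hasDerivAt_mul_log ht.ne' 1).add
    ((((hasDerivAt_ofReal_mul ζ t).const_add 1).clog_real hs).const_mul _)).congr_deriv ?_
  rw [logSlope, add_sub_cancel_left]
  push_cast
  field_simp
  ring

/-- Along rays towards `v = ∞` the horizontal coordinate grows like `|v| ^ (e / 2) / e` up to a bounded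
amount, uniformly in `e`. -/
lemma exists_horiz_sub_le_atInfinity (x : ℝ) : ∃ M, 0 ≤ M ∧ ∀ e c2 : ℝ, 0 < e → e < 1 → 0 ≤ c2 →
    c2 ≤ 2 → c2 * betaB e = 2 * kappa e x * betaA e → ∀ ζ : ℂ, ‖ζ‖ = 1 → ∀ t : ℝ, 2 ≤ t →
    ‖horiz e x c2 (t * ζ) (exp (e * logAtInfinity ζ t)) -
      horiz e x c2 ((2 : ℝ) * ζ) (exp (e * logAtInfinity ζ 2)) -
      ((t ^ (e / 2) / e - 2 ^ (e / 2) / e : ℝ) : ℂ)‖ ≤ M := by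
  obtain ⟨M₁, hM₁, h₁⟩ := exists_forall_norm_cpow_div_sub_le (fun s => (1 + x ^ 2 * s) ^ 2)
    (by fun_prop) 3
  obtain ⟨M₂, hM₂, h₂⟩ := exists_forall_norm_cpow_div_sub_le (fun _ => 1) (by fun_prop) 1
  set M := M₁ + M₂ + 1 with hM
  refine ⟨2 * M, by positivity, fun e c2 he he1 hc0 hc2 hc ζ hζ T hT => ?_⟩
  have key := norm_image_sub_le_of_norm_deriv_le (a := 2) (b := T)
    (f := fun t => horiz e x c2 (t * ζ) (exp (e * logAtInfinity ζ t)) - ((t ^ (e / 2) / e : ℝ) : ℂ))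
    (f' := fun t => etaCoeff x (t * ζ) (exp (e * logAtInfinity ζ t)) * ζ -
      conj (gaussCoeff c2 (t * ζ) (exp (e * logAtInfinity ζ t)) * ζ) -
      ((e / 2 * t ^ (e / 2 - 1) / e : ℝ) : ℂ))
    (B := fun t => M * (t ^ (-3 / 2 + 1 : ℝ) / (-3 / 2 + 1))) (B' := fun t => M * t ^ (-3 / 2 : ℝ)) hT ?_ ?_ ?_
  · have e1 : horiz e x c2 (T * ζ) (exp (e * logAtInfinity ζ T)) -
      horiz e x c2 ((2 : ℝ) * ζ) (exp (e * logAtInfinity ζ 2)) -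
      ((T ^ (e / 2) / e - 2 ^ (e / 2) / e : ℝ) : ℂ) =
      horiz e x c2 (T * ζ) (exp (e * logAtInfinity ζ T)) - ((T ^ (e / 2) / e : ℝ) : ℂ) -
      (horiz e x c2 ((2 : ℝ) * ζ) (exp (e * logAtInfinity ζ 2)) - ((2 ^ (e / 2) / e : ℝ) : ℂ)) := by
      push_cast; ring
    rw [e1]
    refine key.trans ?_
    have h3 : (0 : ℝ) ≤ T ^ (-3 / 2 + 1 : ℝ) := by positivity
    have h4 : (2 : ℝ) ^ (-3 / 2 + 1 : ℝ) ≤ 1 :=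
      Real.rpow_le_one_of_one_le_of_nonpos (by norm_num) (by norm_num)
    have hM0 : 0 ≤ M := by positivity
    have h5 := mul_nonneg hM0 h3
    have h6 := mul_le_mul_of_nonneg_left h4 hM0
    generalize T ^ (-3 / 2 + 1 : ℝ) = a at *
    generalize (2 : ℝ) ^ (-3 / 2 + 1 : ℝ) = b at *
    have h7 (y : ℝ) : M * (y / (-3 / 2 + 1)) = -(2 * (M * y)) := by
      rw [show (-3 / 2 + 1 : ℝ) = -(1 / 2) by norm_num]; ring
    rw [h7, h7]
    linarith
  · intro t ht
    have ht0 : 0 < t := by linarith [ht.1]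
    have hn := norm_ofReal_mul_of_pos ht0 hζ
    refine (hasDerivAt_horiz_ray he he1 hc (hasDerivAt_ofReal_mul ζ t)
      (hasDerivAt_logAtInfinity hζ ht.1) ?_ ?_ ?_).sub
      (((Real.hasDerivAt_rpow_const (Or.inl ht0.ne')).div_const e).ofReal_comp)
    · filter_upwards [lt_mem_nhds (by linarith [ht.1] : 1 < t)] with s hs using logAtInfinity_re hζ hs
    · rw [← norm_ne_zero_iff, hn]; exact ht0.ne'
    · intro h; rw [h, norm_one] at hn; linarith [ht.1]
  · intro t ht
    have ht0 : 0 < t := by linarith [ht.1]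
    refine ((Real.hasDerivAt_rpow_const (p := -3 / 2 + 1) (Or.inl ht0.ne')).div_const _ |>.const_mul M).congr_deriv ?_
    norm_num
  · intro t ht
    have ht2 := ht.1
    have ht0 : 0 < t := by linarith
    have hn := norm_ofReal_mul_of_pos ht0 hζ
    have hv : (t : ℂ) * ζ ≠ 0 := by rw [← norm_ne_zero_iff, hn]; exact ht0.ne'
    have hζ0 : ζ ≠ 0 := right_ne_zero_of_mul hv
    have ht0' : (t : ℂ) ≠ 0 := left_ne_zero_of_mul hv
    set s : ℂ := -((t : ℂ) * ζ)⁻¹ with hs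
    have hsn : ‖s‖ = t⁻¹ := by rw [hs, norm_neg, norm_inv, hn]
    have hsn' : ‖s‖ ≤ 1 / 2 := by rw [hsn, one_div]; exact inv_anti₀ two_pos ht2
    have hs1 : 1 + s ≠ 0 := one_add_ne_zero_of_mem_ball (by rw [mem_ball_zero_iff]; linarith)
    have g₁ := h₁ e s (by rw [abs_of_pos he]; exact he1.le) hsn'
    have g₂ := h₂ (-e) s (by rw [abs_neg, abs_of_pos he]; exact he1.le) hsn'
    have hτ : exp (e * logAtInfinity ζ t) = ((t ^ (e / 2) : ℝ) : ℂ) * exp (e * log (1 + s)) := by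
      rw [logAtInfinity, exp_mul_log_add ht0, mul_one_div]
    set E := exp (e * log (1 + s)) with hE
    have hE0 : E ≠ 0 := exp_ne_zero _
    have hE' : exp ((-e : ℝ) * log (1 + s)) = E⁻¹ := by rw [hE, ← exp_neg]; push_cast; ring_nf
    rw [hE'] at g₂
    set P := t ^ (e / 2) with hP
    have hP1 : 1 ≤ P := Real.one_le_rpow (by linarith) (by linarith)
    have hP0 : (P : ℂ) ≠ 0 := by exact_mod_cast (by linarith : P ≠ 0)
    have hPt : P ≤ t ^ (1 / 2 : ℝ) := Real.rpow_le_rpow_of_exponent_le (by linarith) (by linarith)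
    have hQ : t ^ (-3 / 2 : ℝ) = t ^ (1 / 2 : ℝ) / t ^ 2 := by
      rw [← Real.rpow_natCast t 2, ← Real.rpow_sub ht0]; norm_num
    have hd : t ^ (e / 2 - 1) = P / t := by rw [hP, Real.rpow_sub_one ht0.ne']
    have e1 : etaCoeff x (t * ζ) (P * E) * ζ - ((e / 2 * t ^ (e / 2 - 1) / e : ℝ) : ℂ) =
        ((P / (2 * t) : ℝ) : ℂ) * (E * ((1 + x ^ 2 * s) ^ 2 / (1 + s) ^ 3) - (1 + x ^ 2 * 0) ^ 2) := by
      have a1 : (t : ℂ) * ζ - x ^ 2 = t * ζ * (1 + x ^ 2 * s) := by rw [hs]; field_simp; ring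
      have a2 : (t : ℂ) * ζ - 1 = t * ζ * (1 + s) := by rw [hs]; field_simp; ring
      have he0 : (e : ℂ) ≠ 0 := by exact_mod_cast he.ne'
      rw [etaCoeff, hd, a1, a2]
      push_cast
      field_simp
      ring
    have e2 : gaussCoeff c2 (t * ζ) (P * E) * ζ =
        ((c2 / (2 * P * t) : ℝ) : ℂ) * (t * ζ)⁻¹ * (E⁻¹ * (1 / (1 + s) ^ 1)) := by
      have a2 : (t : ℂ) * ζ - 1 = t * ζ * (1 + s) := by rw [hs]; field_simp; ring
      rw [gaussCoeff, a2]
      push_cast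
      field_simp
    rw [hτ]
    have b1 : ‖etaCoeff x (t * ζ) (P * E) * ζ - ((e / 2 * t ^ (e / 2 - 1) / e : ℝ) : ℂ)‖ ≤
        M₁ * (P / t ^ 2) := by
      rw [e1, norm_mul, norm_real, Real.norm_of_nonneg (by positivity)]
      refine (mul_le_mul_of_nonneg_left g₁ (by positivity)).trans ?_
      rw [hsn]
      have : 0 ≤ M₁ * (P / t ^ 2) := by positivity
      have e3 : P / (2 * t) * (M₁ * t⁻¹) = M₁ * (P / t ^ 2) / 2 := by field_simp
      rw [e3]; linarith
    have b2 : ‖gaussCoeff c2 (t * ζ) (P * E) * ζ‖ ≤ (1 + M₂) * (P / t ^ 2) := by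
      have g₃ : ‖E⁻¹ * (1 / (1 + s) ^ 1)‖ ≤ 1 + M₂ := by
        have := norm_add_le (E⁻¹ * (1 / (1 + s) ^ 1) - 1) 1
        rw [sub_add_cancel, norm_one] at this
        have h7 : M₂ * ‖s‖ ≤ M₂ * 1 := mul_le_mul_of_nonneg_left (by linarith) hM₂
        linarith
      rw [e2, norm_mul, norm_mul, norm_inv, hn, norm_real, Real.norm_of_nonneg (by positivity),
        mul_comm (1 + M₂)]
      refine mul_le_mul ?_ g₃ (norm_nonneg _) (by positivity)
      rw [div_mul_eq_mul_div, div_le_div_iff₀ (by positivity) (by positivity)]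
      have : c2 * t⁻¹ * t ^ 2 = c2 * t := by field_simp
      rw [this]
      have : c2 * t ≤ 2 * t := mul_le_mul_of_nonneg_right hc2 ht0.le
      have h8 : 1 * t ≤ (P * P) * t := mul_le_mul_of_nonneg_right (by nlinarith) ht0.le
      linarith
    have e4 : etaCoeff x (t * ζ) (P * E) * ζ - conj (gaussCoeff c2 (t * ζ) (P * E) * ζ) -
        ((e / 2 * t ^ (e / 2 - 1) / e : ℝ) : ℂ) = etaCoeff x (t * ζ) (P * E) * ζ -
        ((e / 2 * t ^ (e / 2 - 1) / e : ℝ) : ℂ) - conj (gaussCoeff c2 (t * ζ) (P * E) * ζ) := by ring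
    rw [e4]
    refine (norm_sub_le _ _).trans ?_
    rw [norm_conj, hQ]
    have h9 : P / t ^ 2 ≤ t ^ (1 / 2 : ℝ) / t ^ 2 := div_le_div_of_nonneg_right hPt (by positivity)
    have h10 : M * (P / t ^ 2) ≤ M * (t ^ (1 / 2 : ℝ) / t ^ 2) :=
      mul_le_mul_of_nonneg_left h9 (by positivity)
    rw [hM] at h10 ⊢
    linarith

/-- Along rays towards `v = 0` the horizontal coordinate changes like `c2 * |v| ^ (e / 2) / e` up to a
bounded amount, uniformly in `e`. -/
lemma exists_horiz_sub_le_atZero (x : ℝ) : ∃ M, 0 ≤ M ∧ ∀ e c2 : ℝ, 0 < e → e < 1 → 0 ≤ c2 →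
    c2 ≤ 2 → c2 * betaB e = 2 * kappa e x * betaA e → ∀ ζ : ℂ, ‖ζ‖ = 1 → ∀ t : ℝ, 0 < t → t ≤ 1 / 2 →
    ‖horiz e x c2 ((1 / 2 : ℝ) * ζ) (exp (e * logAtZero ζ (1 / 2))) -
      horiz e x c2 (t * ζ) (exp (e * logAtZero ζ t)) -
      ((c2 * ((1 / 2) ^ (e / 2) / e) - c2 * (t ^ (e / 2) / e) : ℝ) : ℂ)‖ ≤ M := by
  obtain ⟨M₁, hM₁, h₁⟩ := exists_forall_norm_cpow_div_sub_le (fun s => (s + x ^ 2) ^ 2 / 2)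
    (by fun_prop) 3
  obtain ⟨M₂, hM₂, h₂⟩ := exists_forall_norm_cpow_div_sub_le (fun _ => 1) (by fun_prop) 1
  set M := M₁ + x ^ 4 + M₂ with hM
  refine ⟨2 * M, by positivity, fun e c2 he he1 hc0 hc2 hc ζ hζ T hT hT' => ?_⟩
  have key := norm_image_sub_le_of_norm_deriv_le (a := T) (b := 1 / 2)
    (f := fun t => horiz e x c2 (t * ζ) (exp (e * logAtZero ζ t)) -
      ((c2 * (t ^ (e / 2) / e) : ℝ) : ℂ))
    (f' := fun t => etaCoeff x (t * ζ) (exp (e * logAtZero ζ t)) * ζ -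
      conj (gaussCoeff c2 (t * ζ) (exp (e * logAtZero ζ t)) * ζ) -
      ((c2 * (e / 2 * t ^ (e / 2 - 1) / e) : ℝ) : ℂ))
    (B := fun t => M * (t ^ (-1 / 2 + 1 : ℝ) / (-1 / 2 + 1))) (B' := fun t => M * t ^ (-1 / 2 : ℝ)) hT' ?_ ?_ ?_
  · have e1 : horiz e x c2 ((1 / 2 : ℝ) * ζ) (exp (e * logAtZero ζ (1 / 2))) -
      horiz e x c2 (T * ζ) (exp (e * logAtZero ζ T)) -
      ((c2 * ((1 / 2) ^ (e / 2) / e) - c2 * (T ^ (e / 2) / e) : ℝ) : ℂ) =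
      horiz e x c2 ((1 / 2 : ℝ) * ζ) (exp (e * logAtZero ζ (1 / 2))) -
        ((c2 * ((1 / 2) ^ (e / 2) / e) : ℝ) : ℂ) -
      (horiz e x c2 (T * ζ) (exp (e * logAtZero ζ T)) - ((c2 * (T ^ (e / 2) / e) : ℝ) : ℂ)) := by
      push_cast; ring
    rw [e1]
    refine key.trans ?_
    have h3 : (0 : ℝ) ≤ T ^ (-1 / 2 + 1 : ℝ) := by positivity
    have h4 : (1 / 2 : ℝ) ^ (-1 / 2 + 1 : ℝ) ≤ 1 :=
      Real.rpow_le_one (by norm_num) (by norm_num) (by norm_num)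
    have hM0 : 0 ≤ M := by positivity
    have h5 := mul_nonneg hM0 h3
    have h6 := mul_le_mul_of_nonneg_left h4 hM0
    generalize T ^ (-1 / 2 + 1 : ℝ) = a at *
    generalize (1 / 2 : ℝ) ^ (-1 / 2 + 1 : ℝ) = b at *
    have h7 (y : ℝ) : M * (y / (-1 / 2 + 1)) = 2 * (M * y) := by
      rw [show (-1 / 2 + 1 : ℝ) = 1 / 2 by norm_num]; ring
    rw [h7, h7]
    linarith
  · intro t ht
    have ht0 : 0 < t := by linarith [ht.1]
    have hn := norm_ofReal_mul_of_pos ht0 hζ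
    refine (hasDerivAt_horiz_ray he he1 hc (hasDerivAt_ofReal_mul ζ t)
      (hasDerivAt_logAtZero hζ ht0 ht.2) ?_ ?_ ?_).sub
      ((((Real.hasDerivAt_rpow_const (Or.inl ht0.ne')).div_const e).const_mul c2).ofReal_comp)
    · filter_upwards [lt_mem_nhds ht0] with s hs using logAtZero_re hζ hs
    · rw [← norm_ne_zero_iff, hn]; exact ht0.ne'
    · intro h; rw [h, norm_one] at hn; linarith [ht.2]
  · intro t ht
    have ht0 : 0 < t := by linarith [ht.1]
    refine ((Real.hasDerivAt_rpow_const (p := -1 / 2 + 1) (Or.inl ht0.ne')).div_const _ |>.const_mul M).congr_deriv ?_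
    norm_num
  · intro t ht
    have ht2 := ht.2
    have ht0 : 0 < t := by linarith [ht.1]
    have hn := norm_ofReal_mul_of_pos ht0 hζ
    have hv : (t : ℂ) * ζ ≠ 0 := by rw [← norm_ne_zero_iff, hn]; exact ht0.ne'
    have hζ0 : ζ ≠ 0 := right_ne_zero_of_mul hv
    have ht0' : (t : ℂ) ≠ 0 := left_ne_zero_of_mul hv
    set s : ℂ := -((t : ℂ) * ζ) with hs
    have hsn : ‖s‖ = t := by rw [hs, norm_neg, hn]
    have hsn' : ‖s‖ ≤ 1 / 2 := by rw [hsn]; exact ht2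
    have hs1 : 1 + s ≠ 0 := one_add_ne_zero_of_mem_ball (by rw [mem_ball_zero_iff]; linarith)
    have g₁ := h₁ e s (by rw [abs_of_pos he]; exact he1.le) hsn'
    have g₂ := h₂ (-e) s (by rw [abs_neg, abs_of_pos he]; exact he1.le) hsn'
    have hτ : exp (e * logAtZero ζ t) = (((t ^ (e / 2))⁻¹ : ℝ) : ℂ) * exp (e * log (1 + s)) := by
      rw [logAtZero, exp_mul_log_add ht0, ← Real.rpow_neg ht0.le]
      congr 4
      ring
    set E := exp (e * log (1 + s)) with hE
    have hE0 : E ≠ 0 := exp_ne_zero _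
    have hE' : exp ((-e : ℝ) * log (1 + s)) = E⁻¹ := by rw [hE, ← exp_neg]; push_cast; ring_nf
    rw [hE'] at g₂
    set Q := t ^ (-1 / 2 : ℝ) with hQ
    have hQ1 : 1 ≤ Q := Real.one_le_rpow_of_pos_of_le_one_of_nonpos ht0 (by linarith) (by norm_num)
    have hd : t ^ (e / 2 - 1) = t ^ (e / 2) / t := by rw [Real.rpow_sub_one ht0.ne']
    have hPQ : (t ^ (e / 2))⁻¹ ≤ Q := by
      rw [← Real.rpow_neg ht0.le]
      exact Real.rpow_le_rpow_of_exponent_ge ht0 (by linarith) (by linarith)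
    have hPpos : 0 < t ^ (e / 2) := by positivity
    have hP1 : t ^ (e / 2) ≤ 1 := Real.rpow_le_one ht0.le (by linarith) (by linarith)
    rw [hd, hτ]
    generalize t ^ (e / 2) = P at *
    have hP0 : (P : ℂ) ≠ 0 := by exact_mod_cast hPpos.ne'
    have he0 : (e : ℂ) ≠ 0 := by exact_mod_cast he.ne'
    have hv1 : (t : ℂ) * ζ - 1 = -(1 + s) := by rw [hs]; ring
    have e1 : etaCoeff x (t * ζ) ((P⁻¹ : ℝ) * E) * ζ =
        ((P⁻¹ : ℝ) : ℂ) * -ζ * (E * ((s + x ^ 2) ^ 2 / 2 / (1 + s) ^ 3)) := by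
      have a1 : (t : ℂ) * ζ - x ^ 2 = -(s + x ^ 2) := by rw [hs]; ring
      have a2 : (-(1 + s)) ^ 3 = -(1 + s) ^ 3 := by ring
      rw [etaCoeff, hv1, a1, neg_sq, a2]
      field_simp
    have e2 : gaussCoeff c2 (t * ζ) ((P⁻¹ : ℝ) * E) * ζ + ((c2 * (e / 2 * (P / t) / e) : ℝ) : ℂ) =
        -((c2 * P / (2 * t) : ℝ) : ℂ) * (E⁻¹ * (1 / (1 + s) ^ 1) - 1) := by
      rw [gaussCoeff, hv1]
      push_cast
      field_simp
      ring
    have b1 : ‖etaCoeff x (t * ζ) ((P⁻¹ : ℝ) * E) * ζ‖ ≤ (M₁ + x ^ 4) * Q := by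
      have g₃ : ‖E * ((s + x ^ 2) ^ 2 / 2 / (1 + s) ^ 3)‖ ≤ M₁ + x ^ 4 := by
        have := norm_add_le (E * ((s + x ^ 2) ^ 2 / 2 / (1 + s) ^ 3) - (0 + (x : ℂ) ^ 2) ^ 2 / 2)
          ((0 + (x : ℂ) ^ 2) ^ 2 / 2)
        rw [sub_add_cancel] at this
        have h6 : ‖(0 + (x : ℂ) ^ 2) ^ 2 / 2‖ = x ^ 4 / 2 := by
          have : (0 + (x : ℂ) ^ 2) ^ 2 / 2 = ((x ^ 4 / 2 : ℝ) : ℂ) := by push_cast; ring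
          rw [this, norm_real, Real.norm_of_nonneg (by positivity)]
        have h7 : M₁ * ‖s‖ ≤ M₁ * 1 := mul_le_mul_of_nonneg_left (by linarith) hM₁
        have h8 : 0 ≤ x ^ 4 := by positivity
        linarith
      rw [e1, norm_mul, norm_mul, norm_neg, hζ, mul_one, norm_real,
        Real.norm_of_nonneg (by positivity), mul_comm (M₁ + x ^ 4)]
      exact mul_le_mul hPQ g₃ (norm_nonneg _) (by positivity)
    have b2 : ‖gaussCoeff c2 (t * ζ) ((P⁻¹ : ℝ) * E) * ζ + ((c2 * (e / 2 * (P / t) / e) : ℝ) : ℂ)‖ ≤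
        M₂ * Q := by
      rw [e2, norm_mul, norm_neg, norm_real, Real.norm_of_nonneg (by positivity)]
      refine (mul_le_mul_of_nonneg_left g₂ (by positivity)).trans ?_
      rw [hsn]
      have e3 : c2 * P / (2 * t) * (M₂ * t) = M₂ * (c2 / 2 * P) := by field_simp
      rw [e3]
      refine mul_le_mul_of_nonneg_left ?_ hM₂
      have : c2 / 2 * P ≤ 1 * 1 := mul_le_mul (by linarith) hP1 hPpos.le zero_le_one
      linarith
    have e4 : etaCoeff x (t * ζ) ((P⁻¹ : ℝ) * E) * ζ - conj (gaussCoeff c2 (t * ζ) ((P⁻¹ : ℝ) * E) * ζ) -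
        ((c2 * (e / 2 * (P / t) / e) : ℝ) : ℂ) = etaCoeff x (t * ζ) ((P⁻¹ : ℝ) * E) * ζ -
        conj (gaussCoeff c2 (t * ζ) ((P⁻¹ : ℝ) * E) * ζ + ((c2 * (e / 2 * (P / t) / e) : ℝ) : ℂ)) := by
      rw [map_add, conj_ofReal]; ring
    rw [e4]
    refine (norm_sub_le _ _).trans ?_
    rw [norm_conj, hM]
    linarith

/-- Over the ends `v = 1` the horizontal coordinate is that of an Enneper type end, whose leading
term is of order `(v - 1) ^ (e - 2)`, with an error of order `1 / |v - 1|`. -/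
lemma exists_horiz_sub_le_atOne (x : ℝ) : ∃ M, 0 ≤ M ∧ ∀ e c2 : ℝ, 0 < e → e < 1 → 0 ≤ c2 →
    c2 ≤ 2 → c2 * betaB e = 2 * kappa e x * betaA e → ∀ ζ : ℂ, ‖ζ‖ = 1 → ∀ t : ℝ, 0 < t → t ≤ 1 / 2 →
    ‖horiz e x c2 (1 + (1 / 2 : ℝ) * ζ) (exp (e * logAtOne ζ (1 / 2))) -
      horiz e x c2 (1 + t * ζ) (exp (e * logAtOne ζ t)) -
      ((1 - x ^ 2) ^ 2 / 2 * ζ⁻¹ ^ 2 * ((1 / 2 : ℝ) ^ (e - 2) / (e - 2) : ℝ) -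
       (1 - x ^ 2) ^ 2 / 2 * ζ⁻¹ ^ 2 * (t ^ (e - 2) / (e - 2) : ℝ))‖ ≤ M / t := by
  obtain ⟨M₁, hM₁, h₁⟩ := exists_forall_norm_cpow_div_sub_le (fun s => (1 - x ^ 2 + s) ^ 2 / 2)
    (by fun_prop) 0
  obtain ⟨M₂, hM₂, h₂⟩ := exists_forall_norm_cpow_div_sub_le (fun _ => 1) (by fun_prop) 1
  set M := M₁ + (1 + M₂) with hM
  refine ⟨M, by positivity, fun e c2 he he1 hc0 hc2 hc ζ hζ T hT hT' => ?_⟩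
  have key := norm_image_sub_le_of_norm_deriv_le (a := T) (b := 1 / 2)
    (f := fun t => horiz e x c2 (1 + t * ζ) (exp (e * logAtOne ζ t)) -
      (1 - x ^ 2) ^ 2 / 2 * ζ⁻¹ ^ 2 * (t ^ (e - 2) / (e - 2) : ℝ))
    (f' := fun t => etaCoeff x (1 + t * ζ) (exp (e * logAtOne ζ t)) * ζ -
      conj (gaussCoeff c2 (1 + t * ζ) (exp (e * logAtOne ζ t)) * ζ) -
      (1 - x ^ 2) ^ 2 / 2 * ζ⁻¹ ^ 2 * ((e - 2) * t ^ (e - 2 - 1) / (e - 2) : ℝ))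
    (B := fun t => -(M * t⁻¹)) (B' := fun t => M / t ^ 2) hT' ?_ ?_ ?_
  · rw [sub_sub_sub_comm]
    refine key.trans ?_
    have hM0 : 0 ≤ M := by positivity
    rw [div_eq_mul_inv M T]
    have : (0 : ℝ) ≤ M * (1 / 2)⁻¹ := by positivity
    linarith
  · intro t ht
    have ht0 : 0 < t := by linarith [ht.1]
    have hn := norm_ofReal_mul_of_pos ht0 hζ
    refine (hasDerivAt_horiz_ray he he1 hc ((hasDerivAt_ofReal_mul ζ t).const_add 1)
      (hasDerivAt_logAtOne hζ ht0 ht.2) ?_ ?_ ?_).sub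
      ((((Real.hasDerivAt_rpow_const (Or.inl ht0.ne')).div_const (e - 2)).ofReal_comp).const_mul _)
    · filter_upwards [lt_mem_nhds ht0] with s hs using logAtOne_re hζ hs
    · exact one_add_ne_zero_of_mem_ball (by rw [mem_ball_zero_iff]; linarith [ht.2])
    · intro h
      rw [add_eq_left.1 h, norm_zero] at hn
      exact ht0.ne hn
  · intro t ht
    have ht0 : 0 < t := by linarith [ht.1]
    refine ((hasDerivAt_inv ht0.ne').const_mul M).neg.congr_deriv ?_
    field_simp
  · intro t ht
    have ht2 := ht.2
    have ht0 : 0 < t := by linarith [ht.1]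
    have hn := norm_ofReal_mul_of_pos ht0 hζ
    have hv : (t : ℂ) * ζ ≠ 0 := by rw [← norm_ne_zero_iff, hn]; exact ht0.ne'
    have hζ0 : ζ ≠ 0 := right_ne_zero_of_mul hv
    have ht0' : (t : ℂ) ≠ 0 := left_ne_zero_of_mul hv
    have hsn' : ‖(t : ℂ) * ζ‖ ≤ 1 / 2 := by rw [hn]; exact ht2
    have hs1 : 1 + (t : ℂ) * ζ ≠ 0 :=
      one_add_ne_zero_of_mem_ball (by rw [mem_ball_zero_iff]; linarith)
    have g₁ := h₁ (-(e / 2)) (t * ζ) (by rw [abs_neg, abs_of_pos (by linarith)]; linarith) hsn'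
    have g₂ := h₂ (e / 2) (t * ζ) (by rw [abs_of_pos (by linarith)]; linarith) hsn'
    have hτ : exp (e * logAtOne ζ t) = ((t ^ e : ℝ) : ℂ) * exp ((-(e / 2) : ℝ) * log (1 + t * ζ)) := by
      rw [logAtOne, exp_mul_log_add ht0, mul_one]
      congr 2
      push_cast
      ring
    have hE' : exp ((e / 2 : ℝ) * log (1 + t * ζ)) =
        (exp ((-(e / 2) : ℝ) * log (1 + t * ζ)))⁻¹ := by rw [← exp_neg]; push_cast; ring_nf
    rw [hE'] at g₂
    have hd : t ^ (e - 2 - 1) = t ^ e / t ^ 3 := by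
      rw [← Real.rpow_natCast t 3, ← Real.rpow_sub ht0]; congr 1; norm_num; ring
    have hP1 : t ^ e ≤ 1 := Real.rpow_le_one ht0.le (by linarith) he.le
    have hPt : t ≤ t ^ e := by
      have := Real.rpow_le_rpow_of_exponent_ge ht0 (by linarith) he1.le
      rwa [Real.rpow_one] at this
    have hPpos : 0 < t ^ e := by positivity
    rw [hd, hτ]
    have hE0 : exp ((-(e / 2) : ℝ) * log (1 + t * ζ)) ≠ 0 := exp_ne_zero _
    generalize exp ((-(e / 2) : ℝ) * log (1 + t * ζ)) = E at *
    generalize t ^ e = P at *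
    have hP0 : (P : ℂ) ≠ 0 := by exact_mod_cast hPpos.ne'
    have he0 : (e - 2 : ℂ) ≠ 0 := by exact_mod_cast (by linarith : e - 2 ≠ 0)
    have e1 : etaCoeff x (1 + t * ζ) (P * E) * ζ -
        (1 - x ^ 2) ^ 2 / 2 * ζ⁻¹ ^ 2 * ((e - 2) * (P / t ^ 3) / (e - 2) : ℝ) =
        ((P / t ^ 3 : ℝ) : ℂ) * ζ⁻¹ ^ 2 * (E * ((1 - x ^ 2 + t * ζ) ^ 2 / 2 / (1 + t * ζ) ^ 0) -
          (1 - x ^ 2 + 0) ^ 2 / 2) := by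
      have a1 : 1 + (t : ℂ) * ζ - x ^ 2 = 1 - x ^ 2 + t * ζ := by ring
      rw [etaCoeff, add_sub_cancel_left, a1]
      push_cast
      field_simp
      ring
    have e2 : gaussCoeff c2 (1 + t * ζ) (P * E) * ζ =
        ((c2 / (2 * P * t) : ℝ) : ℂ) * (E⁻¹ * (1 / (1 + t * ζ) ^ 1)) := by
      rw [gaussCoeff, add_sub_cancel_left]
      push_cast
      field_simp
    have b1 : ‖etaCoeff x (1 + t * ζ) (P * E) * ζ -
        (1 - x ^ 2) ^ 2 / 2 * ζ⁻¹ ^ 2 * ((e - 2) * (P / t ^ 3) / (e - 2) : ℝ)‖ ≤ M₁ / t ^ 2 := by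
      rw [e1, norm_mul, norm_mul, norm_pow, norm_inv, hζ, norm_real,
        Real.norm_of_nonneg (by positivity), inv_one, one_pow, mul_one]
      refine (mul_le_mul_of_nonneg_left g₁ (by positivity)).trans ?_
      rw [hn]
      have e3 : P / t ^ 3 * (M₁ * t) = M₁ / t ^ 2 * P := by field_simp
      rw [e3]
      exact mul_le_of_le_one_right (by positivity) hP1
    have b2 : ‖gaussCoeff c2 (1 + t * ζ) (P * E) * ζ‖ ≤ (1 + M₂) / t ^ 2 := by
      have g₃ : ‖E⁻¹ * (1 / (1 + t * ζ) ^ 1)‖ ≤ 1 + M₂ := by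
        have := norm_add_le (E⁻¹ * (1 / (1 + t * ζ) ^ 1) - 1) 1
        rw [sub_add_cancel, norm_one] at this
        have h7 : M₂ * ‖(t : ℂ) * ζ‖ ≤ M₂ * 1 := mul_le_mul_of_nonneg_left (by linarith) hM₂
        linarith
      rw [e2, norm_mul, norm_real, Real.norm_of_nonneg (by positivity), div_eq_inv_mul (1 + M₂)]
      refine mul_le_mul ?_ g₃ (norm_nonneg _) (by positivity)
      rw [← one_div, div_le_div_iff₀ (by positivity) (by positivity)]
      have : c2 * t ^ 2 ≤ 2 * (P * t) := by
        have := mul_le_mul_of_nonneg_right hPt ht0.le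
        nlinarith
      linarith
    have e4 : etaCoeff x (1 + t * ζ) (P * E) * ζ - conj (gaussCoeff c2 (1 + t * ζ) (P * E) * ζ) -
        (1 - x ^ 2) ^ 2 / 2 * ζ⁻¹ ^ 2 * ((e - 2) * (P / t ^ 3) / (e - 2) : ℝ) =
        etaCoeff x (1 + t * ζ) (P * E) * ζ -
        (1 - x ^ 2) ^ 2 / 2 * ζ⁻¹ ^ 2 * ((e - 2) * (P / t ^ 3) / (e - 2) : ℝ) -
        conj (gaussCoeff c2 (1 + t * ζ) (P * E) * ζ) := by ring
    rw [e4]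
    refine (norm_sub_le _ _).trans ?_
    rw [norm_conj, hM, add_div]
    exact add_le_add b1 b2

end Ends

/-! ### Escape at the ends -/

lemma norm_horiz_eq_of_norm_eq (e x c2 : ℝ) (v : ℂ) {τ τ' : ℂ} (h0 : τ' ≠ 0) (h : ‖τ‖ = ‖τ'‖) :
    ‖horiz e x c2 v τ‖ = ‖horiz e x c2 v τ'‖ := by
  have h1 : ‖τ / τ'‖ = 1 := by rw [norm_div, h, div_self (norm_ne_zero_iff.2 h0)]
  have := horiz_rotate e x c2 v τ' (τ / τ') h1
  rw [div_mul_cancel₀ _ h0] at this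
  rw [this, norm_mul, h1, one_mul]

lemma abs_logAtInfinity_im_le (ζ : ℂ) (t : ℝ) : |(logAtInfinity ζ t).im| ≤ Real.pi := by
  rw [logAtInfinity, add_im, ofReal_im, zero_add, log_im]
  exact abs_arg_le_pi _

lemma abs_logAtZero_im_le (ζ : ℂ) (t : ℝ) : |(logAtZero ζ t).im| ≤ Real.pi := by
  rw [logAtZero, add_im, ofReal_im, zero_add, log_im]
  exact abs_arg_le_pi _

lemma abs_logAtOne_im_le (ζ : ℂ) (t : ℝ) : |(logAtOne ζ t).im| ≤ Real.pi := by
  have : (-(1 / 2) : ℂ) = ((-(1 / 2) : ℝ) : ℂ) := by push_cast; rfl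
  rw [logAtOne, add_im, ofReal_im, zero_add, this, im_ofReal_mul, log_im, abs_mul]
  have := abs_arg_le_pi (1 + (t : ℂ) * ζ)
  norm_num
  linarith [Real.pi_pos]

lemma continuousOn_limitPart (x : ℝ) : ContinuousOn (limitPart x) ({0, 1}ᶜ : Set ℂ) := by
  intro v hv
  have hv' : v ≠ 0 ∧ v ≠ 1 := by simpa using hv
  have h1 : v - 1 ≠ 0 := sub_ne_zero.2 hv'.2
  refine ContinuousAt.continuousWithinAt ?_
  have a1 : ContinuousAt (fun v : ℂ => ((Real.log ‖v‖ / 2 : ℝ) : ℂ)) v :=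
    continuous_ofReal.continuousAt.comp
      ((continuousAt_id.norm.log (norm_ne_zero_iff.2 hv'.1)).div_const 2)
  have a2 : ContinuousAt (fun v : ℂ => (1 - (x : ℂ) ^ 2) / (v - 1)) v :=
    ContinuousAt.div (by fun_prop) (by fun_prop) h1
  have a3 : ContinuousAt (fun v : ℂ => (1 - (x : ℂ) ^ 2) ^ 2 / (4 * (v - 1) ^ 2)) v :=
    ContinuousAt.div (by fun_prop) (by fun_prop) (mul_ne_zero (by norm_num) (pow_ne_zero 2 h1))
  exact a1.sub (a2.add a3)

lemma exists_eventually_norm_reducedHoriz_le (x : ℝ) {S : Set ℂ} (hS : IsCompact S)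
    (hS' : S ⊆ {0, 1}ᶜ) : ∃ M, 0 ≤ M ∧ ∀ᶠ k in atTop, ∀ v ∈ S, ‖reducedHoriz x k v‖ ≤ M := by
  obtain ⟨M, hM⟩ := hS.exists_bound_of_continuousOn ((continuousOn_limitPart x).mono hS')
  refine ⟨|M| + 1, by positivity, ?_⟩
  have h := (tendstoLocallyUniformlyOn_iff_tendstoUniformlyOn_of_compact hS).1
    ((tendstoLocallyUniformlyOn_reducedHoriz x).mono hS')
  rw [Metric.tendstoUniformlyOn_iff] at h
  filter_upwards [h 1 one_pos] with k hk v hv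
  have h1 := hk v hv
  rw [dist_comm, dist_eq_norm] at h1
  have h2 := norm_add_le (reducedHoriz x k v - limitPart x v) (limitPart x v)
  rw [sub_add_cancel] at h2
  linarith [hM v hv, le_abs_self M]

/-- The parameters of `Σ_{k,x}` for large `k`. -/
lemma eventually_parameters (x : ℝ) : ∀ᶠ k in atTop, inv1 k < 1 / 2 ∧
    1 / 2 ≤ constC k x ∧ 1 / 2 ≤ constC k x ^ 2 ∧ constC k x ^ 2 ≤ 2 ∧
    constC k x ^ 2 * betaB (inv1 k) = 2 * kappa (inv1 k) x * betaA (inv1 k) ∧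
    3 / 4 < inv1 k * shift x k ∧ inv1 k * shift x k < 2 ∧ 0 < shift x k := by
  filter_upwards [tendsto_inv1.eventually_lt_const (by norm_num : (0 : ℝ) < 1 / 2),
    (tendsto_constC x).eventually_const_lt (by norm_num : (1 / 2 : ℝ) < 1),
    (tendsto_constC_sq x).eventually_const_lt (by norm_num : (1 / 2 : ℝ) < 1),
    (tendsto_constC_sq x).eventually_lt_const (by norm_num : (1 : ℝ) < 2),
    (tendsto_mul_shift x).eventually_const_lt (by norm_num : (3 / 4 : ℝ) < 1),
    (tendsto_mul_shift x).eventually_lt_const (by norm_num : (1 : ℝ) < 2),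
    eventually_admissible x] with k h1 h2 h3 h4 h5 h6 h7
  exact ⟨h1, h2.le, h3.le, h4.le, constC_period h7.1 h7.2, h5, h6,
    pos_of_mul_pos_right ((by norm_num : (0 : ℝ) < 3 / 4).trans h5) (inv1_pos k).le⟩

lemma exists_eventually_norm_horiz_sub_shift_le (x : ℝ) {S : Set ℂ} (hS : IsCompact S)
    (hS' : S ⊆ {0, 1}ᶜ) : ∃ M, 0 ≤ M ∧ ∀ᶠ k in atTop, ∀ v ∈ S, ∀ u : ℂ, u.re = logModulus v →
      |u.im| ≤ Real.pi →
      ‖horiz (inv1 k) x (constC k x ^ 2) v (exp (inv1 k * u)) - shift x k‖ ≤ M := by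
  obtain ⟨M, hM0, hM⟩ := exists_eventually_norm_reducedHoriz_le x hS hS'
  refine ⟨M + 2 * Real.pi, by positivity, ?_⟩
  filter_upwards [hM, eventually_parameters x] with k hk hp v hv u hu hu'
  obtain ⟨-, -, -, -, -, -, hs, hs0⟩ := hp
  rw [horiz_sub_shift x k hu]
  refine (norm_add_le _ _).trans ?_
  rw [norm_mul, norm_mul, mul_comm I, norm_exp_ofReal_mul_I, one_mul, norm_real,
    Real.norm_of_nonneg hs0.le, mul_comm _ I]
  have h1 : ‖exp (I * (inv1 k * u.im : ℝ)) - 1‖ ≤ inv1 k * |u.im| := by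
    refine Real.norm_exp_I_mul_ofReal_sub_one_le.trans ?_
    rw [Real.norm_eq_abs, abs_mul, abs_of_pos (inv1_pos k)]
  have h2 := mul_le_mul_of_nonneg_right h1 hs0.le
  have h3 : inv1 k * |u.im| * shift x k = inv1 k * shift x k * |u.im| := by ring
  have h4 : inv1 k * shift x k * |u.im| ≤ 2 * Real.pi :=
    mul_le_mul hs.le hu' (abs_nonneg _) zero_le_two
  linarith [hk v hv]

lemma sphere_subset_compl {r : ℝ} (h0 : r ≠ 0) (h1 : r ≠ 1) :
    Metric.sphere (0 : ℂ) r ⊆ {0, 1}ᶜ := by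
  intro v hv
  rw [mem_sphere_zero_iff_norm] at hv
  rw [mem_compl_iff, mem_insert_iff, mem_singleton_iff, not_or]
  refine ⟨?_, ?_⟩
  · rintro rfl; rw [norm_zero] at hv; exact h0 hv.symm
  · rintro rfl; rw [norm_one] at hv; exact h1 hv.symm

lemma norm_le_add_of_norm_sub_le {a b : ℂ} {C R : ℝ} (hC : 0 ≤ C) (h : ‖a‖ = ‖b‖)
    (hb : ‖b - C‖ ≤ R) : ‖a‖ ≤ C + R := by
  have := norm_add_le (b - C) C
  rw [sub_add_cancel, norm_real, Real.norm_of_nonneg hC] at this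
  linarith

lemma le_norm_of_norm_sub_le {a b : ℂ} {C R : ℝ} (h : ‖a‖ = ‖b‖)
    (hb : ‖b - C‖ ≤ R) : C - R ≤ ‖a‖ := by
  have := norm_sub_norm_le (C : ℂ) (C - b)
  rw [sub_sub_cancel, norm_sub_rev, norm_real, Real.norm_eq_abs] at this
  linarith [le_abs_self C]

/-- The part of `Σ_{k,x}` in a bounded region stays away from `z = ∞`, uniformly in `k`. -/
lemma exists_eventually_norm_le (x R : ℝ) : ∃ r, ∀ᶠ k in atTop, ∀ v τ : ℂ, v ≠ 0 →
    ‖τ‖ = Real.exp (inv1 k * logModulus v) →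
    ‖horiz (inv1 k) x (constC k x ^ 2) v τ - shift x k‖ ≤ R → ‖v‖ ≤ r := by
  obtain ⟨M₁, hM₁, h₁⟩ := exists_horiz_sub_le_atInfinity x
  obtain ⟨M₂, hM₂, h₂⟩ := exists_eventually_norm_horiz_sub_shift_le x (isCompact_sphere 0 2)
    (sphere_subset_compl two_ne_zero (by norm_num))
  refine ⟨max 2 (2 * Real.exp (2 * (R + M₁ + M₂))), ?_⟩
  filter_upwards [h₂, eventually_parameters x] with k hk hp v τ hv hτ hR
  rcases le_total ‖v‖ 2 with h2 | h2
  · exact h2.trans (le_max_left _ _)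
  refine le_trans ?_ (le_max_right _ _)
  obtain ⟨he, -, hc1, hc2, hc, -, -, hs0⟩ := hp
  have he0 := inv1_pos k
  set e := inv1 k
  have ht0 : 0 < ‖v‖ := norm_pos_iff.2 hv
  set t := ‖v‖ with ht
  set ζ : ℂ := v / t with hζ
  have ht0' : (t : ℂ) ≠ 0 := by exact_mod_cast ht0.ne'
  have hζn : ‖ζ‖ = 1 := by rw [hζ, norm_div, norm_real, ← ht, Real.norm_of_nonneg ht0.le, div_self ht0.ne']
  have hvζ : (t : ℂ) * ζ = v := mul_div_cancel₀ v ht0'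
  have g₁ := h₁ e _ he0 (by linarith) (by positivity) hc2 hc ζ hζn t h2
  have g₂ := hk (((2 : ℝ) : ℂ) * ζ)
    (by rw [mem_sphere_zero_iff_norm, norm_ofReal_mul_of_pos two_pos hζn])
    (logAtInfinity ζ 2) (logAtInfinity_re hζn one_lt_two) (abs_logAtInfinity_im_le _ _)
  have hn := norm_le_add_of_norm_sub_le hs0.le (norm_horiz_eq_of_norm_eq e x (constC k x ^ 2) v
    (τ := exp (e * logAtInfinity ζ t)) (τ' := τ)
    (by rw [← norm_ne_zero_iff, hτ]; exact (Real.exp_pos _).ne')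
    (by rw [hτ, norm_exp, re_ofReal_mul, logAtInfinity_re hζn (by linarith), hvζ])) hR
  rw [hvζ] at g₁
  set q := t ^ (e / 2) / e - 2 ^ (e / 2) / e with hq
  have h3 : shift x k + q ≤ ‖horiz e x (constC k x ^ 2) v (exp (e * logAtInfinity ζ t))‖ + M₁ + M₂ := by
    have h4 : ‖((shift x k + q : ℝ) : ℂ)‖ ≤
        ‖horiz e x (constC k x ^ 2) v (exp (e * logAtInfinity ζ t))‖ + M₁ + M₂ := by
      have h5 : ((shift x k + q : ℝ) : ℂ) = horiz e x (constC k x ^ 2) v (exp (e * logAtInfinity ζ t)) -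
          (horiz e x (constC k x ^ 2) v (exp (e * logAtInfinity ζ t)) -
            horiz e x (constC k x ^ 2) ((2 : ℝ) * ζ) (exp (e * logAtInfinity ζ 2)) - (q : ℂ)) -
          (horiz e x (constC k x ^ 2) ((2 : ℝ) * ζ) (exp (e * logAtInfinity ζ 2)) - shift x k) := by
        push_cast; ring
      rw [h5]
      refine (norm_sub_le _ _).trans (add_le_add ((norm_sub_le _ _).trans ?_) g₂)
      linarith
    rw [norm_real] at h4
    exact (le_abs_self _).trans h4
  have h6 : Real.log (t / 2) / 2 ≤ q := by
    have e1 : t ^ (e / 2) = 2 ^ (e / 2) * (t / 2) ^ (e / 2) := by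
      rw [← Real.mul_rpow two_pos.le (by positivity), mul_div_cancel₀ _ two_ne_zero]
    have e2 : (e / 2) * Real.log (t / 2) + 1 ≤ (t / 2) ^ (e / 2) := by
      rw [Real.rpow_def_of_pos (by positivity), mul_comm]
      exact Real.add_one_le_exp _
    have e3 : (1 : ℝ) ≤ 2 ^ (e / 2) := Real.one_le_rpow one_le_two (by linarith)
    have e4 : 0 ≤ Real.log (t / 2) := Real.log_nonneg (by linarith)
    have e5 : 0 ≤ (e / 2) * Real.log (t / 2) := by positivity
    rw [hq, ← sub_div, le_div_iff₀ he0, e1]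
    nlinarith
  have h7 : Real.log (t / 2) ≤ 2 * (R + M₁ + M₂) := by linarith
  have h8 := (Real.log_le_iff_le_exp (by positivity)).1 h7
  linarith

/-- The part of `Σ_{k,x}` in a bounded region stays away from `z = 0`, uniformly in `k`. -/
lemma exists_eventually_le_norm (x R : ℝ) : ∃ r > 0, ∀ᶠ k in atTop, ∀ v τ : ℂ, v ≠ 0 →
    ‖τ‖ = Real.exp (inv1 k * logModulus v) →
    ‖horiz (inv1 k) x (constC k x ^ 2) v τ - shift x k‖ ≤ R → r ≤ ‖v‖ := by
  obtain ⟨M₁, hM₁, h₁⟩ := exists_horiz_sub_le_atZero x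
  obtain ⟨M₂, hM₂, h₂⟩ := exists_eventually_norm_horiz_sub_shift_le x (isCompact_sphere 0 (1 / 2))
    (sphere_subset_compl (by norm_num) (by norm_num))
  set N := |R| + M₁ + M₂ with hN
  have hN0 : 0 ≤ N := by positivity
  have hlim : ∀ᶠ k in atTop, inv1 k * (4 * N) < 1 / 2 := by
    have := tendsto_inv1.mul_const (4 * N)
    rw [zero_mul] at this
    exact this.eventually_lt_const (by norm_num)
  have hlim' : ∀ᶠ k in atTop, constC k x ^ 2 < 5 / 4 :=
    (tendsto_constC_sq x).eventually_lt_const (by norm_num)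
  refine ⟨min (1 / 2) (Real.exp (-(16 * N)) / 2), by positivity, ?_⟩
  filter_upwards [h₂, eventually_parameters x, hlim, hlim'] with k hk hp hl hl' v τ hv hτ hR
  rcases le_total (1 / 2) ‖v‖ with h2 | h2
  · exact (min_le_left _ _).trans h2
  refine (min_le_right _ _).trans ?_
  obtain ⟨he, -, hc1, hc2, hc, hs1, -, hs0⟩ := hp
  have he0 := inv1_pos k
  set e := inv1 k
  have ht0 : 0 < ‖v‖ := norm_pos_iff.2 hv
  set t := ‖v‖ with ht
  set ζ : ℂ := v / t with hζ
  have ht0' : (t : ℂ) ≠ 0 := by exact_mod_cast ht0.ne'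
  have hζn : ‖ζ‖ = 1 := by rw [hζ, norm_div, norm_real, ← ht, Real.norm_of_nonneg ht0.le, div_self ht0.ne']
  have hvζ : (t : ℂ) * ζ = v := mul_div_cancel₀ v ht0'
  have g₁ := h₁ e _ he0 (by linarith) (by positivity) hc2 hc ζ hζn t ht0 h2
  have g₂ := hk (((1 / 2 : ℝ) : ℂ) * ζ)
    (by rw [mem_sphere_zero_iff_norm, norm_ofReal_mul_of_pos (by norm_num) hζn])
    (logAtZero ζ (1 / 2)) (logAtZero_re hζn (by norm_num)) (abs_logAtZero_im_le _ _)
  have hn := le_norm_of_norm_sub_le (norm_horiz_eq_of_norm_eq e x (constC k x ^ 2) v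
    (τ := exp (e * logAtZero ζ t)) (τ' := τ)
    (by rw [← norm_ne_zero_iff, hτ]; exact (Real.exp_pos _).ne')
    (by rw [hτ, norm_exp, re_ofReal_mul, logAtZero_re hζn ht0, hvζ])) hR
  rw [hvζ] at g₁
  set q := constC k x ^ 2 * ((1 / 2) ^ (e / 2) / e) - constC k x ^ 2 * (t ^ (e / 2) / e) with hq
  have h3 : ‖horiz e x (constC k x ^ 2) v (exp (e * logAtZero ζ t))‖ ≤ |shift x k - q| + M₁ + M₂ := by
    have h5 : horiz e x (constC k x ^ 2) v (exp (e * logAtZero ζ t)) = ((shift x k - q : ℝ) : ℂ) -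
        (horiz e x (constC k x ^ 2) ((1 / 2 : ℝ) * ζ) (exp (e * logAtZero ζ (1 / 2))) -
          horiz e x (constC k x ^ 2) v (exp (e * logAtZero ζ t)) - (q : ℂ)) +
        (horiz e x (constC k x ^ 2) ((1 / 2 : ℝ) * ζ) (exp (e * logAtZero ζ (1 / 2))) - shift x k) := by
      push_cast; ring
    calc _ = _ := congrArg norm h5
      _ ≤ _ := norm_add_le _ _
      _ ≤ _ := add_le_add ((norm_sub_le _ _).trans (add_le_add (le_of_eq (norm_real _)) g₁)) g₂
  have ha1 : (1 / 2 : ℝ) ^ (e / 2) ≤ 1 := Real.rpow_le_one (by norm_num) (by norm_num) (by linarith)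
  have ha2 : 1 / 2 ≤ (1 / 2 : ℝ) ^ (e / 2) := by
    have := Real.rpow_le_rpow_of_exponent_ge (by norm_num : (0 : ℝ) < 1 / 2) (by norm_num)
      (by linarith : e / 2 ≤ 1)
    rwa [Real.rpow_one] at this
  have htp : 0 < t ^ (e / 2) := by positivity
  have hqe : q * e = constC k x ^ 2 * ((1 / 2) ^ (e / 2) - t ^ (e / 2)) := by
    rw [hq]; field_simp
  -- If `q` exceeds the shift, which is about `1 / e`, then it exceeds twice the shift up to a
  -- bounded error; but it is at most about `1 / e`.
  have h6 : q ≤ N := by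
    rcases le_total 0 (shift x k - q) with h | h
    · rw [abs_of_nonneg h] at h3
      linarith [le_abs_self R]
    · exfalso
      rw [abs_of_nonpos h] at h3
      have h7 : 2 * shift x k - N ≤ q := by linarith [le_abs_self R]
      have h8 := mul_le_mul_of_nonneg_right h7 he0.le
      have h9 : q * e ≤ constC k x ^ 2 * 1 := by
        rw [hqe]
        exact mul_le_mul_of_nonneg_left (by linarith) (by positivity)
      linarith
  have h10 : (1 / 2 : ℝ) ^ (e / 2) - t ^ (e / 2) ≤ 2 * (e * N) := by
    have h11 := mul_le_mul_of_nonneg_right h6 he0.le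
    rw [hqe] at h11
    rcases le_total ((1 / 2 : ℝ) ^ (e / 2) - t ^ (e / 2)) 0 with h | h
    · have : 0 ≤ 2 * (e * N) := by positivity
      linarith
    · have := mul_le_mul_of_nonneg_right hc1 h
      linarith
  set y := (2 * t) ^ (e / 2) with hy
  have hy0 : 0 < y := by positivity
  have e1 : t ^ (e / 2) = (1 / 2 : ℝ) ^ (e / 2) * y := by
    rw [hy, ← Real.mul_rpow (by norm_num) (by positivity)]; ring_nf
  have h12 : 1 - y ≤ e * (4 * N) := by
    rw [e1] at h10
    rcases le_total (1 - y) 0 with h | h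
    · have : 0 ≤ e * (4 * N) := by positivity
      linarith
    · have := mul_le_mul_of_nonneg_right ha2 h
      linarith
  have h13 : 1 - y⁻¹ ≤ Real.log y := Real.one_sub_inv_le_log_of_pos hy0
  have h14 : -(2 * (e * (4 * N))) ≤ 1 - y⁻¹ := by
    have hy2 : 1 / 2 ≤ y := by linarith
    have : y⁻¹ ≤ 1 + 2 * (e * (4 * N)) := by
      rw [inv_le_iff_one_le_mul₀ hy0]
      have : 0 ≤ e * (4 * N) := by positivity
      nlinarith
    linarith
  have h15 : Real.log y = e / 2 * Real.log (2 * t) := Real.log_rpow (by positivity) _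
  have h16 : -(16 * N) ≤ Real.log (2 * t) := by
    by_contra! hcon
    have := mul_lt_mul_of_pos_left hcon he0
    rw [h15] at h13
    linarith
  have h17 := (Real.le_log_iff_exp_le (by positivity)).1 h16
  linarith

/-- If `x² ≠ 1`, then the part of `Σ_{k,x}` in a bounded region stays away from the directions of
the ends `v = 1` in which the leading term of the horizontal coordinate has positive real part. -/
lemma exists_eventually_le_norm_sub_one {x : ℝ} (hx : x ^ 2 ≠ 1) (R : ℝ) : ∃ r > 0, ∀ᶠ k in atTop,
    ∀ v τ : ℂ, v ≠ 1 → ‖v - 1‖ ≤ 1 / 2 → ‖τ‖ = Real.exp (inv1 k * logModulus v) →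
    ‖horiz (inv1 k) x (constC k x ^ 2) v τ - shift x k‖ ≤ R →
    (((v - 1) / ‖v - 1‖)⁻¹ ^ 2).re ≤ -(1 / 2) → r ≤ ‖v - 1‖ := by
  obtain ⟨M₁, hM₁, h₁⟩ := exists_horiz_sub_le_atOne x
  obtain ⟨M₂, hM₂, h₂⟩ := exists_eventually_norm_horiz_sub_shift_le x (isCompact_sphere 1 (1 / 2))
    (by
      intro v hv
      rw [mem_sphere_iff_norm] at hv
      rw [mem_compl_iff, mem_insert_iff, mem_singleton_iff, not_or]
      refine ⟨?_, ?_⟩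
      · rintro rfl; norm_num at hv
      · rintro rfl; norm_num at hv)
  set δ := 1 - x ^ 2 with hδ
  have hδ0 : 0 < δ ^ 2 := by
    have : δ ≠ 0 := fun h => hx (by linarith)
    positivity
  set N := |R| + M₁ + M₂ + 2 * δ ^ 2 with hN
  have hN0 : 0 < N := by positivity
  refine ⟨(δ ^ 2 / (8 * N)) ^ 2, by positivity, ?_⟩
  filter_upwards [h₂, eventually_parameters x] with k hk hp v τ hv h2 hτ hR hre
  obtain ⟨he, -, hc1, hc2, hc, hs1, -, hs0⟩ := hp
  have he0 := inv1_pos k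
  set e := inv1 k
  have ht0 : 0 < ‖v - 1‖ := norm_pos_iff.2 (sub_ne_zero.2 hv)
  set t := ‖v - 1‖ with ht
  set ζ : ℂ := (v - 1) / t with hζ
  have ht0' : (t : ℂ) ≠ 0 := by exact_mod_cast ht0.ne'
  have hζn : ‖ζ‖ = 1 := by rw [hζ, norm_div, norm_real, ← ht, Real.norm_of_nonneg ht0.le, div_self ht0.ne']
  have hvζ : 1 + (t : ℂ) * ζ = v := by rw [hζ, mul_div_cancel₀ _ ht0']; ring
  have g₁ := h₁ e _ he0 (by linarith) (by positivity) hc2 hc ζ hζn t ht0 h2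
  have g₂ := hk (1 + ((1 / 2 : ℝ) : ℂ) * ζ)
    (by rw [mem_sphere_iff_norm, add_sub_cancel_left, norm_ofReal_mul_of_pos (by norm_num) hζn])
    (logAtOne ζ (1 / 2)) (logAtOne_re hζn (by norm_num)) (abs_logAtOne_im_le _ _)
  have hn := norm_le_add_of_norm_sub_le hs0.le (norm_horiz_eq_of_norm_eq e x (constC k x ^ 2) v
    (τ := exp (e * logAtOne ζ t)) (τ' := τ)
    (by rw [← norm_ne_zero_iff, hτ]; exact (Real.exp_pos _).ne')
    (by rw [hτ, norm_exp, re_ofReal_mul, logAtOne_re hζn ht0, hvζ])) hR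
  rw [hvζ] at g₁
  set w : ℂ := (1 - (x : ℂ) ^ 2) ^ 2 / 2 * ζ⁻¹ ^ 2 with hw
  have hδw : w = ((δ ^ 2 / 2 : ℝ) : ℂ) * ζ⁻¹ ^ 2 := by rw [hw, hδ]; push_cast; ring
  have hwn : ‖w‖ = δ ^ 2 / 2 := by
    rw [hδw, norm_mul, norm_pow, norm_inv, hζn, norm_real, Real.norm_of_nonneg (by positivity)]
    norm_num
  have hwre : w.re ≤ -(δ ^ 2 / 4) := by
    rw [hδw, re_ofReal_mul]
    have := mul_le_mul_of_nonneg_left hre (by positivity : 0 ≤ δ ^ 2 / 2)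
    linarith
  set L := t ^ (e - 2) / (e - 2) with hL
  set L₀ := (1 / 2 : ℝ) ^ (e - 2) / (e - 2) with hL₀
  have hL₀n : |L₀| ≤ 4 := by
    have a1 : (1 / 2 : ℝ) ^ (e - 2) ≤ 4 := by
      have := Real.rpow_le_rpow_of_exponent_ge (by norm_num : (0 : ℝ) < 1 / 2) (by norm_num)
        (by linarith : (-2 : ℝ) ≤ e - 2)
      refine this.trans (le_of_eq ?_)
      rw [Real.rpow_neg (by norm_num)]
      norm_num
    have a2 : 0 < (1 / 2 : ℝ) ^ (e - 2) := by positivity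
    rw [hL₀, abs_div, abs_of_pos a2, abs_of_neg (by linarith), div_le_iff₀ (by linarith)]
    linarith
  have hLle : L ≤ -(t ^ (-(3 / 2) : ℝ) / 2) := by
    have a1 : t ^ (-(3 / 2) : ℝ) ≤ t ^ (e - 2) :=
      Real.rpow_le_rpow_of_exponent_ge ht0 (by linarith) (by linarith)
    have a2 : 0 < t ^ (-(3 / 2) : ℝ) := by positivity
    have a3 : L = -(t ^ (e - 2) / (2 - e)) := by rw [hL, ← div_neg, neg_sub]
    rw [a3, neg_le_neg_iff, div_le_div_iff₀ two_pos (by linarith)]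
    nlinarith
  have h3 : shift x k + w.re * L - (M₂ + 2 * δ ^ 2 + M₁ / t) ≤
      ‖horiz e x (constC k x ^ 2) v (exp (e * logAtOne ζ t))‖ := by
    set H := horiz e x (constC k x ^ 2) v (exp (e * logAtOne ζ t))
    set H₀ := horiz e x (constC k x ^ 2) (1 + (1 / 2 : ℝ) * ζ) (exp (e * logAtOne ζ (1 / 2)))
    have h5 : ‖((shift x k : ℂ) + w * L) - H‖ ≤ M₂ + 2 * δ ^ 2 + M₁ / t := by
      have : ((shift x k : ℂ) + w * L) - H = (H₀ - H - (w * L₀ - w * L)) - (H₀ - shift x k) + w * L₀ := by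
        ring
      rw [this]
      refine (norm_add_le _ _).trans ((add_le_add ((norm_sub_le _ _).trans (add_le_add g₁ g₂))
        (le_refl _)).trans ?_)
      rw [norm_mul, hwn, norm_real, Real.norm_eq_abs]
      have := mul_le_mul_of_nonneg_left hL₀n (by positivity : 0 ≤ δ ^ 2 / 2)
      linarith
    have h6 := (re_le_norm _).trans h5
    rw [sub_re, add_re, ofReal_re, re_mul_ofReal] at h6
    linarith [re_le_norm H]
  have h7 : δ ^ 2 / 8 * t ^ (-(3 / 2) : ℝ) ≤ w.re * L := by
    have a2 : 0 < t ^ (-(3 / 2) : ℝ) := by positivity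
    nlinarith
  have h8 : δ ^ 2 / 8 * t ^ (-(3 / 2) : ℝ) ≤ N / t := by
    have a1 : |R| + M₂ + 2 * δ ^ 2 ≤ (|R| + M₂ + 2 * δ ^ 2) / t := by
      rw [le_div_iff₀ ht0]
      exact mul_le_of_le_one_right (by positivity) (by linarith)
    have a2 : N / t = (|R| + M₂ + 2 * δ ^ 2) / t + M₁ / t := by rw [hN]; ring
    linarith [le_abs_self R]
  have h9 : t ^ (-(3 / 2) : ℝ) = (√t)⁻¹ / t := by
    rw [Real.sqrt_eq_rpow, ← Real.rpow_neg ht0.le, ← Real.rpow_sub_one ht0.ne']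
    norm_num
  have hst : 0 < √t := Real.sqrt_pos.2 ht0
  have h10 : δ ^ 2 / (8 * N) ≤ √t := by
    rw [h9, ← mul_div_assoc, div_le_div_iff_of_pos_right ht0, ← div_eq_mul_inv,
      div_le_iff₀ hst] at h8
    rw [div_le_iff₀ (by positivity)]
    linarith
  calc (δ ^ 2 / (8 * N)) ^ 2 ≤ (√t) ^ 2 := by gcongr
    _ = t := Real.sq_sqrt ht0.le

/-! ### Properness of the convergence -/

lemma norm_le_norm_spacePoint (H : ℂ) (h : ℝ) : ‖H‖ ≤ ‖spacePoint H h‖ := by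
  rw [EuclideanSpace.norm_eq, Complex.norm_def, normSq_apply]
  refine Real.sqrt_le_sqrt ?_
  simp only [spacePoint, Fin.sum_univ_three, Real.norm_eq_abs, sq_abs]
  simp
  nlinarith [sq_nonneg h]

lemma abs_le_norm_spacePoint (H : ℂ) (h : ℝ) : |h| ≤ ‖spacePoint H h‖ := by
  have := PiLp.norm_apply_le (spacePoint H h) 2
  simpa [spacePoint] using this

/-- A point is at most as far from one of `±1` as `z²` is from `1`, and far from the other one. -/
lemma norm_sub_one_or_norm_add_one (z : ℂ) :
    (‖z - 1‖ ≤ ‖z ^ 2 - 1‖ ∧ 1 ≤ ‖z + 1‖) ∨ (‖z + 1‖ ≤ ‖z ^ 2 - 1‖ ∧ 1 ≤ ‖z - 1‖) := by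
  have e : ‖z ^ 2 - 1‖ = ‖z - 1‖ * ‖z + 1‖ := by rw [← norm_mul]; ring_nf
  have h2 : (2 : ℝ) ≤ ‖z + 1‖ + ‖z - 1‖ := by
    have := norm_sub_le (z + 1) (z - 1)
    have e2 : z + 1 - (z - 1) = 2 := by ring
    rwa [e2, Complex.norm_two] at this
  have a := norm_nonneg (z - 1)
  have b := norm_nonneg (z + 1)
  rcases le_total 1 ‖z + 1‖ with h1 | h1
  · exact Or.inl ⟨by rw [e]; nlinarith, h1⟩
  · exact Or.inr ⟨by rw [e]; nlinarith, by linarith⟩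

lemma abs_log_sub_log_le {z : ℂ} (h0 : z ^ 2 - 1 ≠ 0) (h : ‖z ^ 2 - 1‖ ≤ 1 / 2) :
    |Real.log ‖z - 1‖ - Real.log ‖z + 1‖| ≤ 6 / √‖z ^ 2 - 1‖ := by
  have e : ‖z ^ 2 - 1‖ = ‖z - 1‖ * ‖z + 1‖ := by rw [← norm_mul]; ring_nf
  have ht : 0 < ‖z ^ 2 - 1‖ := norm_pos_iff.2 h0
  have hz : ‖z‖ ≤ 2 := by
    have h1 := norm_add_le (z ^ 2 - 1) 1
    rw [sub_add_cancel, norm_pow, norm_one] at h1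
    nlinarith [norm_nonneg z]
  have ha3 : ‖z - 1‖ ≤ 3 := (norm_sub_le _ _).trans (by rw [norm_one]; linarith)
  have hb3 : ‖z + 1‖ ≤ 3 := (norm_add_le _ _).trans (by rw [norm_one]; linarith)
  set t := ‖z ^ 2 - 1‖
  have ha : 0 < ‖z - 1‖ := pos_of_mul_pos_left (e ▸ ht) (norm_nonneg _)
  have hb : 0 < ‖z + 1‖ := pos_of_mul_pos_right (e ▸ ht) (norm_nonneg _)
  have key : ∀ a b : ℝ, 0 < a → 0 < b → a ≤ 3 → t = a * b → Real.log a - Real.log b ≤ 6 / √t := by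
    intro a b ha hb ha3 hab
    have hst : 0 < √t := Real.sqrt_pos.2 ht
    have e1 : a / b = a ^ 2 / t := by rw [hab]; field_simp
    have e2 : a ^ 2 / t ≤ (3 / √t) ^ 2 := by
      rw [div_pow, Real.sq_sqrt ht.le]
      gcongr
    rw [← Real.log_div ha.ne' hb.ne', e1]
    refine (Real.log_le_log (by positivity) e2).trans ?_
    rw [Real.log_pow]
    have := Real.log_le_sub_one_of_pos (by positivity : 0 < 3 / √t)
    have e3 : 6 / √t = 2 * (3 / √t) := by ring
    push_cast
    linarith
  rw [abs_le]
  have h1 := key _ _ ha hb ha3 e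
  have h2 := key _ _ hb ha hb3 (by rw [e, mul_comm])
  exact ⟨by linarith, h1⟩

/-- Close to the ends `v = 1` a bound on the height forces `v - 1` to be almost imaginary. -/
lemma exists_re_le_of_abs_height_le {x : ℝ} (hx : x ^ 2 ≠ 1) (R : ℝ) : ∃ r > 0, ∀ (c : ℝ) (z : ℂ),
    1 / 2 ≤ c → z ^ 2 - 1 ≠ 0 → ‖z ^ 2 - 1‖ ≤ r → |height x c z| ≤ R →
    (((z ^ 2 - 1) / ‖z ^ 2 - 1‖)⁻¹ ^ 2).re ≤ -(1 / 2) := by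
  set δ := |1 - x ^ 2| with hδ
  have hδ0 : 0 < δ := abs_pos.2 fun h => hx (by linarith)
  set N := (2 * |R| + 3 * (1 + x ^ 2)) / δ + 1 with hN
  have hN1 : 0 < N := by positivity
  refine ⟨min (1 / 2) ((1 / (2 * N)) ^ 2), by positivity, fun c z hc h0 hr hh => ?_⟩
  have h2 := hr.trans (min_le_left _ _)
  have h3 := hr.trans (min_le_right _ _)
  have hL := abs_log_sub_log_le h0 h2
  have hε := norm_sub_one_or_norm_add_one z
  have ht0 : 0 < ‖z ^ 2 - 1‖ := norm_pos_iff.2 h0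
  rw [height] at hh
  set L := Real.log ‖z - 1‖ - Real.log ‖z + 1‖
  set t := ‖z ^ 2 - 1‖ with ht
  set η : ℂ := ((z ^ 2 - 1) / t)⁻¹ with hη
  have ht0' : (t : ℂ) ≠ 0 := by exact_mod_cast ht0.ne'
  have hηn : ‖η‖ = 1 := by
    rw [hη, norm_inv, norm_div, norm_real, Real.norm_of_nonneg ht0.le, ← ht, div_self ht0.ne', inv_one]
  have hst : 0 < √t := Real.sqrt_pos.2 ht0
  have hst1 : √t ≤ 1 := Real.sqrt_le_one.2 (by linarith)
  have hss : √t * √t = t := Real.mul_self_sqrt ht0.le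
  have hstN : √t ≤ 1 / (2 * N) := Real.sqrt_le_iff.2 ⟨by positivity, h3⟩
  have e1 : (z / (z ^ 2 - 1)).re = (z * η).re / t := by
    have : z / (z ^ 2 - 1) = z * η / t := by rw [hη]; field_simp
    rw [this, div_ofReal_re]
  have h4 : δ * |(z * η).re| / t ≤ 2 * |R| + 3 * (1 + x ^ 2) / √t := by
    have h5 : |(1 + x ^ 2) / 2 * L - (1 - x ^ 2) * (z / (z ^ 2 - 1)).re| ≤ 2 * |R| := by
      rw [abs_mul, abs_of_pos (by linarith : 0 < c)] at hh
      have := mul_le_mul_of_nonneg_right hc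
        (abs_nonneg ((1 + x ^ 2) / 2 * L - (1 - x ^ 2) * (z / (z ^ 2 - 1)).re))
      linarith [le_abs_self R]
    have h6 : |(1 + x ^ 2) / 2 * L| ≤ 3 * (1 + x ^ 2) / √t := by
      rw [abs_mul, abs_of_pos (by positivity)]
      refine (mul_le_mul_of_nonneg_left hL (by positivity)).trans (le_of_eq ?_)
      ring
    have h7 : δ * |(z * η).re| / t = |(1 - x ^ 2) * (z / (z ^ 2 - 1)).re| := by
      rw [e1, abs_mul, abs_div, abs_of_pos ht0, mul_div_assoc]
    rw [h7]
    have := abs_sub_abs_le_abs_sub ((1 - x ^ 2) * (z / (z ^ 2 - 1)).re) ((1 + x ^ 2) / 2 * L)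
    rw [abs_sub_comm] at this
    linarith
  have h8 : |(z * η).re| ≤ √t * (N - 1) := by
    have e2 : √t * (N - 1) = √t * (2 * |R| + 3 * (1 + x ^ 2)) / δ := by rw [hN]; ring
    rw [e2, le_div_iff₀ hδ0]
    rw [div_le_iff₀ ht0] at h4
    have e3 : (2 * |R| + 3 * (1 + x ^ 2) / √t) * t = √t * (2 * |R| * √t + 3 * (1 + x ^ 2)) := by
      have : (2 * |R| + 3 * (1 + x ^ 2) / √t) * (√t * √t) =
          √t * (2 * |R| * √t + 3 * (1 + x ^ 2)) := by field_simp
      rwa [hss] at this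
    rw [e3] at h4
    have h9 : √t * (2 * |R| * √t + 3 * (1 + x ^ 2)) ≤ √t * (2 * |R| + 3 * (1 + x ^ 2)) := by
      refine mul_le_mul_of_nonneg_left ?_ hst.le
      have := mul_le_mul_of_nonneg_left hst1 (by positivity : 0 ≤ 2 * |R|)
      linarith
    linarith
  have h10 : |η.re| ≤ |(z * η).re| + t := by
    rcases hε with ⟨h, -⟩ | ⟨h, -⟩
    · have e2 : η.re = (z * η).re - ((z - 1) * η).re := by rw [← sub_re]; ring_nf
      have h11 : |((z - 1) * η).re| ≤ t := by
        refine (abs_re_le_norm _).trans ?_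
        rwa [norm_mul, hηn, mul_one]
      rw [e2]
      exact (abs_sub _ _).trans (by linarith)
    · have e2 : η.re = ((z + 1) * η).re - (z * η).re := by rw [← sub_re]; ring_nf
      have h11 : |((z + 1) * η).re| ≤ t := by
        refine (abs_re_le_norm _).trans ?_
        rwa [norm_mul, hηn, mul_one]
      rw [e2]
      exact (abs_sub _ _).trans (by linarith)
  have h12 : |η.re| ≤ 1 / 2 := by
    have h13 : t ≤ √t := by nlinarith
    have h14 : √t * N ≤ 1 / 2 := by
      rw [le_div_iff₀ (by positivity)] at hstN
      linarith
    linarith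
  have h15 : η.re ^ 2 + η.im ^ 2 = 1 := by
    rw [sq, sq, ← normSq_apply, normSq_eq_norm_sq, hηn, one_pow]
  rw [sq, mul_re]
  have h16 : η.re ^ 2 ≤ (1 / 2) ^ 2 := sq_le_sq' (by linarith [(abs_le.1 h12).1]) (abs_le.1 h12).2
  nlinarith

/-- If `x² = 1`, then the height is unbounded at the ends `v = 1`. -/
lemma exists_le_of_abs_height_le {x : ℝ} (hx : x ^ 2 = 1) (R : ℝ) : ∃ r > 0, ∀ (c : ℝ) (z : ℂ),
    1 / 2 ≤ c → z ^ 2 - 1 ≠ 0 → |height x c z| ≤ R → r ≤ ‖z ^ 2 - 1‖ := by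
  refine ⟨min (1 / 2) (Real.exp (-(2 * R))), by positivity, fun c z hc h0 hh => ?_⟩
  rcases le_total (1 / 2) ‖z ^ 2 - 1‖ with h | h
  · exact (min_le_left _ _).trans h
  refine (min_le_right _ _).trans ?_
  have ht0 : 0 < ‖z ^ 2 - 1‖ := norm_pos_iff.2 h0
  rw [height, hx, sub_self, zero_mul, sub_zero, add_self_div_two, one_mul, abs_mul,
    abs_of_pos (by linarith : 0 < c)] at hh
  have e : ‖z ^ 2 - 1‖ = ‖z - 1‖ * ‖z + 1‖ := by rw [← norm_mul]; ring_nf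
  have ha : 0 < ‖z - 1‖ := pos_of_mul_pos_left (e ▸ ht0) (norm_nonneg _)
  have hb : 0 < ‖z + 1‖ := pos_of_mul_pos_right (e ▸ ht0) (norm_nonneg _)
  have h1 := mul_le_mul_of_nonneg_right hc (abs_nonneg (Real.log ‖z - 1‖ - Real.log ‖z + 1‖))
  have h2 : |Real.log ‖z - 1‖ - Real.log ‖z + 1‖| ≤ 2 * R := by linarith
  rw [← Real.le_log_iff_exp_le ht0, e, Real.log_mul ha.ne' hb.ne']
  rcases norm_sub_one_or_norm_add_one z with ⟨-, h3⟩ | ⟨-, h3⟩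
  · linarith [(abs_le.1 h2).1, Real.log_nonneg h3]
  · linarith [(abs_le.1 h2).2, Real.log_nonneg h3]

/-- A point of `M_k` that is mapped to the ball of radius `R` satisfies the hypotheses of the lemmas on
the horizontal coordinate and on the height. -/
lemma bounds_of_norm_normalizedSigma_le {x R : ℝ} {k : ℕ} {p : ℂ × ℂ} (hp : p ∈ curveM k) (h0 : p.1 ≠ 0)
    (hR : ‖normalizedSigma x k p‖ ≤ R) :
    ‖p.2 / p.1‖ = Real.exp (inv1 k * logModulus (p.1 ^ 2)) ∧
    ‖horiz (inv1 k) x (constC k x ^ 2) (p.1 ^ 2) (p.2 / p.1) - shift x k‖ ≤ R ∧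
    |height x (constC k x) p.1| ≤ R :=
  ⟨norm_ratio h0 (sq_sub_one_ne_zero hp.2.1 hp.2.2) (curveM_ratio_pow hp h0),
    (norm_le_norm_spacePoint _ _).trans hR, (abs_le_norm_spacePoint _ _).trans hR⟩

/-- The part of `Σ_{k,x}` in a bounded region stays away from the ends `z = ±1`, uniformly in
`k`. -/
lemma exists_eventually_le_norm_sq_sub_one (x R : ℝ) : ∃ r > 0, ∀ᶠ k in atTop, ∀ p ∈ curveM k,
    p.1 ≠ 0 → ‖normalizedSigma x k p‖ ≤ R → r ≤ ‖p.1 ^ 2 - 1‖ := by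
  by_cases hx : x ^ 2 = 1
  · obtain ⟨r, hr, h⟩ := exists_le_of_abs_height_le hx R
    refine ⟨r, hr, ?_⟩
    filter_upwards [eventually_parameters x] with k hk p hp h0 hR
    exact h _ _ hk.2.1 (sq_sub_one_ne_zero hp.2.1 hp.2.2) (bounds_of_norm_normalizedSigma_le hp h0 hR).2.2
  · obtain ⟨r₁, hr₁, h₁⟩ := exists_re_le_of_abs_height_le hx R
    obtain ⟨r₂, hr₂, h₂⟩ := exists_eventually_le_norm_sub_one hx R
    refine ⟨min (min r₁ (1 / 2)) r₂, by positivity, ?_⟩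
    filter_upwards [eventually_parameters x, h₂] with k hk hk₂ p hp h0 hR
    by_cases h : min r₁ (1 / 2) ≤ ‖p.1 ^ 2 - 1‖
    · exact (min_le_left _ _).trans h
    · refine (min_le_right _ _).trans ?_
      obtain ⟨hτ, hH, hh⟩ := bounds_of_norm_normalizedSigma_le hp h0 hR
      have h3 := sq_sub_one_ne_zero hp.2.1 hp.2.2
      have h4 := (not_le.1 h).le
      exact hk₂ _ _ (sub_ne_zero.1 h3) (h4.trans (min_le_right _ _)) hτ hH
        (h₁ _ _ hk.2.1 h3 (h4.trans (min_le_left _ _)) hh)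

lemma two_div_pi_mul_abs_le {s : ℝ} (hs : |s| ≤ Real.pi) :
    2 / Real.pi * |s| ≤ ‖exp (I * (s : ℝ)) - 1‖ := by
  have h := Real.mul_abs_le_abs_sin (x := s / 2) (by rw [abs_div, abs_two]; linarith)
  rw [norm_exp_I_mul_ofReal_sub_one, norm_mul, Real.norm_eq_abs, Real.norm_eq_abs, abs_two]
  rw [abs_div, abs_two] at h
  linarith

/-- The compact parts of `limitCurve` that exhaust it. -/
def compactPart (r₀ r₁ r N : ℝ) : Set (ℂ × ℂ) :=
  {p | r₀ ≤ ‖p.1 ^ 2‖ ∧ ‖p.1 ^ 2‖ ≤ r₁ ∧ r ≤ ‖p.1 ^ 2 - 1‖ ∧ |p.2.im| ≤ N ∧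
    exp p.2 * p.1 = p.1 ^ 2 - 1}

lemma compactPart_subset {r₀ r₁ r N : ℝ} (h₀ : 0 < r₀) :
    compactPart r₀ r₁ r N ⊆ limitCurve := by
  rintro p ⟨h1, -, -, -, h2⟩
  have h0 : p.1 ≠ 0 := by
    rintro h
    rw [h] at h1
    norm_num at h1
    linarith
  exact ⟨h0, by rw [← h2, mul_div_cancel_right₀ _ h0]⟩

lemma isCompact_compactPart {r₀ r₁ r N : ℝ} (h₀ : 0 < r₀) (hr : 0 < r) :
    IsCompact (compactPart r₀ r₁ r N) := by
  refine Metric.isCompact_of_isClosed_isBounded ?_ ?_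
  · have h1 : IsClosed {p : ℂ × ℂ | r₀ ≤ ‖p.1 ^ 2‖} := isClosed_le (by fun_prop) (by fun_prop)
    have h2 : IsClosed {p : ℂ × ℂ | ‖p.1 ^ 2‖ ≤ r₁} := isClosed_le (by fun_prop) (by fun_prop)
    have h3 : IsClosed {p : ℂ × ℂ | r ≤ ‖p.1 ^ 2 - 1‖} := isClosed_le (by fun_prop) (by fun_prop)
    have h4 : IsClosed {p : ℂ × ℂ | |p.2.im| ≤ N} := isClosed_le (by fun_prop) (by fun_prop)
    have h5 : IsClosed {p : ℂ × ℂ | exp p.2 * p.1 = p.1 ^ 2 - 1} :=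
      isClosed_eq (by fun_prop) (by fun_prop)
    exact h1.inter (h2.inter (h3.inter (h4.inter h5)))
  · set B := max |Real.log r| |Real.log (r₁ + 1)| + max |Real.log r₀| |Real.log r₁| / 2 + N + (r₁ + 1) with hB
    refine (Metric.isBounded_iff_subset_closedBall 0).2 ⟨B, fun p hp => ?_⟩
    have hlc := compactPart_subset h₀ hp
    obtain ⟨h1, h2, h3, h4, -⟩ := hp
    have hv : 0 < ‖p.1 ^ 2‖ := h₀.trans_le h1
    have hv1 : 0 < ‖p.1 ^ 2 - 1‖ := hr.trans_le h3
    have h5 : ‖p.1 ^ 2 - 1‖ ≤ r₁ + 1 := (norm_sub_le _ _).trans (by rw [norm_one]; linarith)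
    have a1 : |Real.log ‖p.1 ^ 2 - 1‖| ≤ max |Real.log r| |Real.log (r₁ + 1)| :=
      abs_le_max_abs_abs (Real.log_le_log hr h3) (Real.log_le_log hv1 h5)
    have a2 : |Real.log ‖p.1 ^ 2‖| ≤ max |Real.log r₀| |Real.log r₁| :=
      abs_le_max_abs_abs (Real.log_le_log h₀ h1) (Real.log_le_log hv h2)
    have a3 : |p.2.re| ≤ max |Real.log r| |Real.log (r₁ + 1)| + max |Real.log r₀| |Real.log r₁| / 2 := by
      rw [limitCurve_re hlc, logModulus]
      refine (abs_sub _ _).trans (add_le_add a1 ?_)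
      rw [abs_div, abs_two]
      linarith
    have a4 := norm_le_abs_re_add_abs_im p.2
    have a5 : ‖p.1‖ ≤ r₁ + 1 := by
      rw [norm_pow] at h2
      nlinarith [sq_nonneg (‖p.1‖ - 1), norm_nonneg p.1]
    have a6 : 0 ≤ ‖p.1‖ := norm_nonneg _
    have a7 : 0 ≤ |p.2.im| := abs_nonneg _
    have a8 := (abs_nonneg _).trans a3
    rw [mem_closedBall_zero_iff, Prod.norm_def]
    exact max_le (by linarith [abs_nonneg p.2.im]) (by linarith)

/-- All points of `Σ_{k,x}` in a bounded region come from a fixed compact part of `limitCurve`. -/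
theorem exists_isCompact_image_sheetMap (x R : ℝ) : ∃ K : Set (ℂ × ℂ), K ⊆ limitCurve ∧ IsCompact K ∧
    ∀ᶠ k in atTop, ∀ p ∈ curveM k, ‖normalizedSigma x k p‖ ≤ R → p ∈ sheetMap k '' K := by
  obtain ⟨r₁, h₁⟩ := exists_eventually_norm_le x R
  obtain ⟨r₀, hr₀, h₀⟩ := exists_eventually_le_norm x R
  obtain ⟨r, hr, h⟩ := exists_eventually_le_norm_sq_sub_one x R
  have hSc : IsCompact {v : ℂ | r₀ ≤ ‖v‖ ∧ ‖v‖ ≤ r₁ ∧ r ≤ ‖v - 1‖} := by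
    refine (isCompact_closedBall (0 : ℂ) r₁).of_isClosed_subset ?_ fun v hv => by simpa using hv.2.1
    have h1 : IsClosed {v : ℂ | r₀ ≤ ‖v‖} := isClosed_le (by fun_prop) (by fun_prop)
    have h2 : IsClosed {v : ℂ | ‖v‖ ≤ r₁} := isClosed_le (by fun_prop) (by fun_prop)
    have h3 : IsClosed {v : ℂ | r ≤ ‖v - 1‖} := isClosed_le (by fun_prop) (by fun_prop)
    exact h1.inter (h2.inter h3)
  obtain ⟨M, hM, hS⟩ := exists_eventually_norm_reducedHoriz_le x hSc (by
    rintro v ⟨hv0, -, hv1⟩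
    rw [mem_compl_iff, mem_insert_iff, mem_singleton_iff, not_or]
    refine ⟨?_, ?_⟩
    · rintro rfl; rw [norm_zero] at hv0; linarith
    · rintro rfl; rw [sub_self, norm_zero] at hv1; linarith)
  refine ⟨compactPart r₀ r₁ r (Real.pi * (|R| + M)), compactPart_subset hr₀,
    isCompact_compactPart hr₀ hr, ?_⟩
  have hsmall : ∀ᶠ k in atTop, inv1 k * |R| < 3 / 4 := by
    have := tendsto_inv1.mul_const |R|
    rw [zero_mul] at this
    exact this.eventually_lt_const (by norm_num)
  filter_upwards [h₁, h₀, h, hS, eventually_parameters x, eventually_admissible x, hsmall]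
    with k hk₁ hk₀ hk hkS hpar hadm hks p hp hR
  obtain ⟨-, -, -, -, -, hs1, -, hs0⟩ := hpar
  have he0 := inv1_pos k
  by_cases h0 : p.1 = 0
  · -- The point `(0, 0)` goes to infinity with the translations.
    exfalso
    obtain rfl := curveM_zero hadm.1 hp h0
    have h3 := (norm_le_norm_spacePoint _ _).trans hR
    have h4 : horiz (inv1 k) x (constC k x ^ 2) ((0 : ℂ) ^ 2) (0 / 0) = 0 := by
      simp [horiz, primEta, primGauss]
    simp only at h3
    rw [h4, zero_sub, norm_neg, norm_real, Real.norm_of_nonneg hs0.le] at h3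
    have := mul_le_mul_of_nonneg_left (h3.trans (le_abs_self R)) he0.le
    linarith
  obtain ⟨hτ, hH, -⟩ := bounds_of_norm_normalizedSigma_le hp h0 hR
  have hv0 : p.1 ^ 2 ≠ 0 := pow_ne_zero 2 h0
  have hτ0 : p.2 / p.1 ≠ 0 := by rw [← norm_ne_zero_iff, hτ]; exact (Real.exp_pos _).ne'
  have hk1 : ((k : ℂ) + 1) ≠ 0 := by exact_mod_cast Nat.succ_ne_zero k
  -- the principal logarithm of `τ` gives the lift with rotation angle `|e Im u| ≤ π`
  set u : ℂ := (k + 1) * log (p.2 / p.1) with hu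
  have hexp : exp (u / (k + 1)) = p.2 / p.1 := by
    rw [hu, mul_div_cancel_left₀ _ hk1, exp_log hτ0]
  have hexpu : exp u = (p.1 ^ 2 - 1) / p.1 := by
    rw [← curveM_ratio_pow hp h0, ← hexp, ← exp_nat_mul]
    congr 1
    push_cast
    field_simp
  have hcurve : (p.1, u) ∈ limitCurve := ⟨h0, hexpu⟩
  have hure : u.re = logModulus (p.1 ^ 2) := limitCurve_re hcurve
  have hs : inv1 k * u.im = (log (p.2 / p.1)).im := by
    have e1 : (inv1 k : ℂ) * u = log (p.2 / p.1) := by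
      rw [← div_eq_inv1_mul, hu, mul_div_cancel_left₀ _ hk1]
    rw [← e1, im_ofReal_mul]
  have hspi : |inv1 k * u.im| ≤ Real.pi := by
    rw [hs, log_im]; exact abs_arg_le_pi _
  have hsplit := horiz_sub_shift x k hure
  rw [← div_eq_inv1_mul, hexp] at hsplit
  have hred := hkS (p.1 ^ 2) ⟨hk₀ _ _ hv0 hτ hH, hk₁ _ _ hv0 hτ hH, hk p hp h0 hR⟩
  -- the chord of that rotation is bounded and its radius is about `1 / e`, so `Im u` is bounded
  have him : |u.im| ≤ Real.pi * (|R| + M) := by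
    have h5 : ‖(exp (I * (inv1 k * u.im : ℝ)) - 1) * shift x k‖ ≤ R + M := by
      have e1 : (exp (I * (inv1 k * u.im : ℝ)) - 1) * shift x k =
          horiz (inv1 k) x (constC k x ^ 2) (p.1 ^ 2) (p.2 / p.1) - shift x k -
          exp (I * (inv1 k * u.im : ℝ)) * reducedHoriz x k (p.1 ^ 2) := by
        rw [hsplit]; ring
      rw [e1]
      refine (norm_sub_le _ _).trans (add_le_add hH ?_)
      rwa [norm_mul, mul_comm I, norm_exp_ofReal_mul_I, one_mul]
    rw [norm_mul, norm_real, Real.norm_of_nonneg hs0.le] at h5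
    have h6 := mul_le_mul_of_nonneg_right (two_div_pi_mul_abs_le hspi) hs0.le
    rw [abs_mul, abs_of_pos he0] at h6
    have h7 : 2 / Real.pi * (inv1 k * |u.im|) * shift x k =
        2 / Real.pi * |u.im| * (inv1 k * shift x k) := by ring
    have h8 : 2 / Real.pi * |u.im| * (1 / 2) ≤ 2 / Real.pi * |u.im| * (inv1 k * shift x k) :=
      mul_le_mul_of_nonneg_left (by linarith) (by positivity)
    have h9 : |u.im| / Real.pi ≤ |R| + M := by
      have : 2 / Real.pi * |u.im| * (1 / 2) = |u.im| / Real.pi := by ring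
      linarith [le_abs_self R]
    rwa [div_le_iff₀ Real.pi_pos, mul_comm] at h9
  refine ⟨(p.1, u), ⟨hk₀ _ _ hv0 hτ hH, hk₁ _ _ hv0 hτ hH, hk p hp h0 hR, him, ?_⟩, ?_⟩
  · rw [hexpu, div_mul_cancel₀ _ h0]
  · rw [sheetMap, hexp, mul_div_cancel₀ _ h0]

/-- The translated surfaces `Σ_{k,x}` converge smoothly to the limit surface, for every `x`. -/
theorem convergesSmoothly_normalizedSigma (x : ℝ) :
    ConvergesSmoothly sheetMap curveM (normalizedSigma x) limitCurve (limitMap x) := by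
  refine ⟨Eventually.of_forall sheetMap_mapsTo, fun K hK hc => ?_, fun U s hU hs hS =>
    smooth_convergence_section x hU hs hS, exists_isCompact_image_sheetMap x⟩
  have := sheetMap_eventually_injOn hc
  rwa [inter_eq_left.2 hK] at this

end ScherkLimit
end

/-- For every real `x`, the Weierstrass maps `X k` of the surfaces `Σ_{k,x}` exist for all `k ≥ 1`
with `|x| < √(2 √(k+1) - 1)` (hence for all large `k`) and can be normalized by translations so
that, as `k → ∞`, they converge smoothly to Scherk's fifth surface if `|x| = 1`, and to the
Scherk-Enneper surface with parameter `x` if `|x| ≠ 1`. -/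
theorem corollary4p2 (x : ℝ) :
    (|x| = 1 → ∃ (X : ℕ → ℂ × ℂ → ScherkLimit.E3) (Y : ℂ × ℂ → ScherkLimit.E3),
      (∀ k : ℕ, 1 ≤ k → |x| < √(2 * √((k : ℝ) + 1) - 1) →
        0 < ScherkLimit.constC k x ∧ ScherkLimit.IsSigma k x (X k)) ∧
      ScherkLimit.IsScherkFifth Y ∧
      ScherkLimit.ConvergesSmoothly ScherkLimit.sheetMap ScherkLimit.curveM X
        ScherkLimit.limitCurve Y) ∧
    (|x| ≠ 1 → ∃ (X : ℕ → ℂ × ℂ → ScherkLimit.E3) (Y : ℂ × ℂ → ScherkLimit.E3),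
      (∀ k : ℕ, 1 ≤ k → |x| < √(2 * √((k : ℝ) + 1) - 1) →
        0 < ScherkLimit.constC k x ∧ ScherkLimit.IsSigma k x (X k)) ∧
      ScherkLimit.IsScherkEnneper x Y ∧
      ScherkLimit.ConvergesSmoothly ScherkLimit.sheetMap ScherkLimit.curveM X
        ScherkLimit.limitCurve Y) := by
  have hX : ∀ k : ℕ, 1 ≤ k → |x| < √(2 * √((k : ℝ) + 1) - 1) →
      0 < ScherkLimit.constC k x ∧ ScherkLimit.IsSigma k x (ScherkLimit.normalizedSigma x k) :=
    fun k hk hx =>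
      have h := ScherkLimit.admissible_of_abs_lt k x hx
      ⟨ScherkLimit.constC_pos hk h, ScherkLimit.isSigma_sigmaMap hk h _⟩
  refine ⟨fun hx => ⟨ScherkLimit.normalizedSigma x, ScherkLimit.limitMap x, hX,
    ScherkLimit.isScherkFifth_limitMap ?_, ScherkLimit.convergesSmoothly_normalizedSigma x⟩,
    fun _ => ⟨ScherkLimit.normalizedSigma x, ScherkLimit.limitMap x, hX,
    ScherkLimit.isScherkEnneper_limitMap x, ScherkLimit.convergesSmoothly_normalizedSigma x⟩⟩
  rw [← sq_abs, hx, one_pow]
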